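/- **Setting.** Let $\kappa$ be the security parameter, let $m=2^{\ell_m}$, $\ell\ge\ell_m$ and $N$ (the number of selections) be polynomially bounded functions of $\kappa$, and fix an $\mathbb F_2$-basis of $\mathbb F_{2^\ell}$, by which field elements are $\ell$-bit strings. Indices $j\in[m]$ are $\ell_m$-bit strings; they are added by $\oplus$ and, padded with zeros, are regarded as elements of $\mathbb F_{2^\ell}$. Efficient means computed by Boolean circuits of size polynomial in $\kappa$. The three parties are $P_0,P_1,P_2$ (indices mod 3). A replicated (RSS) sharing $[x]$ of $x=x_0+x_1+x_2$ gives $(x_i,x_{i-1})$ to $P_i$. **Primitives.** $F:\{0,1\}^\kappa\times\{0,1\}^\kappa\to\mathbb F_{2^\ell}$ is a secure PRF, and for $i\in\{0,1,2\}$ a uniformly random PRF key $k_i$ is common to $P_i$ and $P_{i+1}$. VDPF is a secure verifiable distributed point function for point functions $f_{\alpha,\beta}:[m]\to\mathbb F_{2^\ell}$, possibly with a uniformly random public string: its algorithms are efficient; up to negligible probability honestly generated keys $K_0,K_1$ expand to vectors with sum $f_{\alpha,\beta}$ and their proofs $\pi_0,\pi_1$ are accepted; for each $b$ the pair $(K_b,\pi_{1-b})$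 can be efficiently simulated without $(\alpha,\beta)$; and no efficient adversary makes, except with negligible probability, keys whose proofs are accepted but whose expansions do not add up to a point function. **Functionality $\mathcal F_{os}$.** On consistent RSS sharings of $\mathbf T\in\mathbb F_{2^\ell}^m$ and of $idx\in[m]$ it gives a fresh RSS sharing of $\mathbf T[idx]+e$ to the parties. If $P_c$ is corrupted, the adversary gets the input shares of $P_c$ and the uniformly random output share $z_{c-1}$, and then chooses the error $e\in\mathbb F_{2^\ell}$ and the output share $z_c$; it may abort, or prevent an honest party from getting its output. If no party is corrupted, $e=0$ and the sharing is uniformly random. **Functionality $\mathcal F_{recon}$.** On a consistent RSS sharing $[x]$ and a receiver it gives $x$ to the receiver; the adversary may make the delivery to an honest receiver fail. **Protocol $\Pi_{dpf\text{-}os}$.** *Preprocessing*, for each of the $N$ selections and each $i\in\{0,1,2\}$: the dealer $P_{i+2}$ samples $rdx\in[m]$ at random, generates VDPF keys $(K_0,K_1)$ of $f_{rdx,1}$, splits $rdx=rdx_0\oplus rdx_1$ at random, and sends $(K_b,rdx_b)$ to $P_{i+b}$ for $b\in\{0,1\}$. $P_i$ and $P_{i+1}$ exchange their VDPF proofs and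 verify them; they expand their keys to shares $v_b$ of a vector $v$, exchange $t_b=\sum_j v_b[j]$ and $s_b=rdx_b-\sum_j j\cdot v_b[j]$, and check $t_0+t_1=1$ and $s_0+s_1=0$. If a check fails, the protocol aborts. *Selection*, on a session identifier $sid$ and consistent RSS sharings of $\mathbf T$ and $idx$: for each $i$ the parties turn the dealt sharing of $rdx$ into the RSS sharing with pairs $(0,rdx_0)$, $(rdx_1,0)$, $(rdx_0,rdx_1)$ for $P_i,P_{i+1},P_{i+2}$, and $\Delta=rdx\oplus idx$ is reconstructed to $P_i$ and $P_{i+1}$ only, by $\mathcal F_{recon}$ (abort if this fails); $P_{i+b}$ computes $\sum_j\mathbf T_i[j]\cdot v_b[j\oplus\Delta]$. Each $P_i$ adds its two results to $y_i$ and sends $z_i=y_i+F(k_i,sid)-F(k_{i-1},sid)$ to $P_{i+1}$; its output is $(z_i,z_{i-1})$. The protocol runs the preprocessing for all $N$ selections first, and then the $N$ selections with the same PRF keys and pairwise distinct session identifiers. **Theorem.** $\Pi_{dpf\text{-}os}$ securely computes $\mathcal F_{os}$ with additive attacks, with abort, in the $\mathcal F_{recon}$-hybrid model, against a malicious adversary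 that statically corrupts at most one of the three parties. That is: for each corrupted party $P_c$ there is an efficient simulator $S$ such that for every efficient environment, which chooses the inputs of all selections adaptively, sees the outputs of the honest parties and controls $P_c$ (acting in every round after it has seen the messages of the honest parties in that round), the probabilities that it outputs $1$ in the real execution and in the ideal execution with $\mathcal F_{os}$ and $S$ differ by a negligible function of $\kappa$; and the same holds, without a simulator, for every efficient environment that corrupts no party, chooses the inputs and sees all outputs. -/

import Mathlib

noncomputable section

namespace ObliviousSelection

/-! ## Bit strings, circuits, non-uniform polynomial time -/

abbrev Bits (n : ℕ) : Type := Fin n → Bool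

/-- A Boolean circuit with input wires `I` and output wires `O`: a straight-line program of
NAND gates. The wire `inl i` is the input `i`, the wire `inr n` is the output of gate number `n`;
a gate that is not yet computed reads as `false`, so the constants are available. -/
structure Circuit (I O : Type) where
  gates : List ((I ⊕ ℕ) × (I ⊕ ℕ))
  out : O → I ⊕ ℕ

def readWire {I : Type} (x : I → Bool) (vals : List Bool) : I ⊕ ℕ → Bool
  | Sum.inl i => x i
  | Sum.inr n => vals.getD n false

def Circuit.eval {I O : Type} (C : Circuit I O) (x : I → Bool) : O → Bool :=
  fun o => readWire x
    (C.gates.foldl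
      (fun vals g => vals ++ [!(readWire x vals g.1 && readWire x vals g.2)]) []) (C.out o)

/-- Input wires, output wires and gates are all counted. -/
def Circuit.size {I O : Type} [Fintype I] [Fintype O] (C : Circuit I O) : ℕ :=
  Fintype.card I + Fintype.card O + C.gates.length

/-- A fixed-length binary encoding of a type. -/
class BitEnc (α : Type) where
  Wire : Type
  wireFintype : Fintype Wire
  enc : α → Wire → Bool
  enc_injective : Function.Injective enc

attribute [reducible] BitEnc.wireFintype

attribute [instance] BitEnc.wireFintype

instance : BitEnc Bool where
  Wire := Unit
  wireFintype := inferInstance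
  enc b := fun _ => b
  enc_injective _ _ h := congrFun h ()

instance : BitEnc (ZMod 2) where
  Wire := Unit
  wireFintype := inferInstance
  enc a := fun _ => decide (a = 1)
  enc_injective := by
    have h0 : ∀ a b : ZMod 2, decide (a = 1) = decide (b = 1) → a = b := by decide
    exact fun _ _ h => h0 _ _ (congrFun h ())

instance {α β : Type} [BitEnc α] [BitEnc β] : BitEnc (α × β) where
  Wire := BitEnc.Wire α ⊕ BitEnc.Wire β
  wireFintype := inferInstance
  enc a := Sum.elim (BitEnc.enc a.1) (BitEnc.enc a.2)
  enc_injective := by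
    intro a b h
    refine Prod.ext (BitEnc.enc_injective ?_) (BitEnc.enc_injective ?_)
    · funext w
      exact congrFun h (Sum.inl w)
    · funext w
      exact congrFun h (Sum.inr w)

instance {ι α : Type} [Fintype ι] [BitEnc α] : BitEnc (ι → α) where
  Wire := ι × BitEnc.Wire α
  wireFintype := inferInstance
  enc f := fun w => BitEnc.enc (f w.1) w.2
  enc_injective := by
    intro f g h
    funext i
    apply BitEnc.enc_injective
    funext w
    exact congrFun h (i, w)

instance {α : Type} [BitEnc α] : BitEnc (Option α) where
  Wire := Option (BitEnc.Wire α)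
  wireFintype := inferInstance
  enc o := fun w => match o, w with
    | none, _ => false
    | some _, none => true
    | some a, some w => BitEnc.enc a w
  enc_injective := by
    intro a b h
    cases a with
    | none =>
      cases b with
      | none => rfl
      | some b => exact absurd (congrFun h none) (by simp)
    | some a =>
      cases b with
      | none => exact absurd (congrFun h none) (by simp)
      | some b =>
        congr 1
        apply BitEnc.enc_injective
        funext w
        exact congrFun h (some w)

/-- `f` is computed by a circuit of size at most `s`. -/
def HasCircuit {α β : Type} [BitEnc α] [BitEnc β] (s : ℕ) (f : α → β) : Prop :=
  ∃ C : Circuit (BitEnc.Wire α) (BitEnc.Wire β),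
    C.size ≤ s ∧ ∀ a, C.eval (BitEnc.enc a) = BitEnc.enc (f a)

def PolyBounded (s : ℕ → ℕ) : Prop := ∃ p : Polynomial ℕ, ∀ κ, s κ ≤ p.eval κ

/-- Non-uniform polynomial time: a family of functions with circuits of polynomial size. -/
def PolyTime {A B : ℕ → Type} [∀ κ, BitEnc (A κ)] [∀ κ, BitEnc (B κ)]
    (f : ∀ κ, A κ → B κ) : Prop :=
  ∃ p : Polynomial ℕ, ∀ κ, HasCircuit (p.eval κ) (f κ)

def Negligible (f : ℕ → ℝ) : Prop :=
  Asymptotics.SuperpolynomialDecay Filter.atTop (fun κ : ℕ => (κ : ℝ)) f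

/-- The probability of the event `p` for a uniformly distributed `ω : Ω`. -/
def prob {Ω : Type} [Fintype Ω] (p : Ω → Bool) : ℝ :=
  ((Finset.univ.filter (fun ω => p ω = true)).card : ℝ) / (Fintype.card Ω : ℝ)

/-! ## Pseudorandom functions -/

/-- An adversary with adaptive access to an oracle `X → Y`. -/
structure OracleAdversary (X Y : Type) where
  queries : ℕ
  stateLen : ℕ
  start : Bits stateLen
  query : Fin queries → Bits stateLen → X
  update : Fin queries → Bits stateLen × Y → Bits stateLen
  guess : Bits stateLen → Bool

def OracleAdversary.run {X Y : Type} (A : OracleAdversary X Y) (f : X → Y) : Bool :=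
  A.guess ((List.finRange A.queries).foldl
    (fun st k => A.update k (st, f (A.query k st))) A.start)

def OracleAdversary.Bounded {X Y : Type} [BitEnc X] [BitEnc Y] (A : OracleAdversary X Y)
    (s : ℕ) : Prop :=
  A.queries ≤ s ∧ (∀ k, HasCircuit s (A.query k)) ∧ (∀ k, HasCircuit s (A.update k)) ∧
    HasCircuit s A.guess

/-- A secure PRF `{0,1}^κ × {0,1}^κ → Y κ`: it is computable in polynomial time, and no
polynomial-time oracle adversary distinguishes it, under a random key, from a uniformly random
function. -/
def IsSecurePRF {Y : ℕ → Type} [∀ κ, BitEnc (Y κ)] [∀ κ, Fintype (Y κ)]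
    (F : ∀ κ, Bits κ → Bits κ → Y κ) : Prop :=
  PolyTime (fun κ (a : Bits κ × Bits κ) => F κ a.1 a.2) ∧
  ∀ A : ∀ κ, OracleAdversary (Bits κ) (Y κ),
    (∃ p : Polynomial ℕ, ∀ κ, (A κ).Bounded (p.eval κ)) →
    Negligible fun κ =>
      |prob (fun key : Bits κ => (A κ).run (F κ key)) -
        prob (fun f : Bits κ → Y κ => (A κ).run f)|

/-! ## Parameters -/

/-- The parameters for one value of the security parameter: the array has `m = 2 ^ ellm`
entries in the field with `2 ^ ell` elements, whose elements are represented by `ell` bits through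
a basis over the field with two elements; `runs` is the number of selections for which the
preprocessing provides. -/
structure Params where
  ell : ℕ
  ellm : ℕ
  ellm_le : ellm ≤ ell
  basis : Module.Basis (Fin ell) (ZMod 2) (GaloisField 2 ell)
  runs : ℕ

/-- The field with `2 ^ ell` elements. -/
def Params.K (P : Params) : Type := GaloisField 2 P.ell

instance (P : Params) : Field P.K := inferInstanceAs (Field (GaloisField 2 P.ell))

instance (P : Params) : Fintype P.K :=
  @Fintype.ofFinite _ (inferInstanceAs (Finite (GaloisField 2 P.ell)))

instance (P : Params) : DecidableEq P.K := Classical.decEq _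

instance (P : Params) : BitEnc P.K where
  Wire := BitEnc.Wire (Fin P.ell → ZMod 2)
  wireFintype := inferInstance
  enc a := BitEnc.enc (fun i => P.basis.repr (show GaloisField 2 P.ell from a) i)
  enc_injective := by
    intro a b h
    have h1 := BitEnc.enc_injective h
    exact P.basis.repr.injective (Finsupp.ext fun i => congrFun h1 i)

/-- The index set `[m]`, as the group of bit strings of length `ellm`; its addition is the
bitwise exclusive or. -/
abbrev Params.Idx (P : Params) : Type := Fin P.ellm → ZMod 2

/-- An index as a field element: the bit string `j` padded with zeros. -/
def Params.emb (P : Params) (j : P.Idx) : P.K :=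
  show GaloisField 2 P.ell from ∑ i, j i • P.basis (Fin.castLE P.ellm_le i)

/-! ## Verifiable distributed point functions -/

/-- A two-party verifiable distributed point function with domain `[m]` and outputs in the field
with `2 ^ ell` elements. `gen` makes the two keys of the point function with value `β` at `α`;
`eval` is the expansion over the whole domain of the key of evaluator `b`, and `proof` its proof,
which the two evaluators exchange and submit to `verify`. The public string `pp` (for instance the
description of a hash function) is uniformly random; it may be empty. -/
structure VDPF (P : Params) where
  ppLen : ℕ
  coinLen : ℕ
  keyLen : ℕ
  proofLen : ℕ
  gen : Bits ppLen → P.Idx → P.K → Bits coinLen → Fin 2 → Bits keyLen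
  eval : Bits ppLen → Fin 2 → Bits keyLen → P.Idx → P.K
  proof : Bits ppLen → Fin 2 → Bits keyLen → Bits proofLen
  verify : Bits ppLen → Bits proofLen → Bits proofLen → Bool

abbrev VDPF.PP {P : Params} (V : VDPF P) : Type := Bits V.ppLen
abbrev VDPF.Coins {P : Params} (V : VDPF P) : Type := Bits V.coinLen
abbrev VDPF.Key {P : Params} (V : VDPF P) : Type := Bits V.keyLen
abbrev VDPF.Proof {P : Params} (V : VDPF P) : Type := Bits V.proofLen

/-- The two keys expand to a sharing of the point function with value `β` at `α`. -/
def VDPF.Shares {P : Params} (V : VDPF P) (pp : V.PP) (key : Fin 2 → V.Key)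
    (α : P.Idx) (β : P.K) : Prop :=
  ∀ x, V.eval pp 0 (key 0) x + V.eval pp 1 (key 1) x = if x = α then β else 0

/-- The keys pass the verification when both proofs are computed honestly. -/
def VDPF.Accepts {P : Params} (V : VDPF P) (pp : V.PP) (key : Fin 2 → V.Key) : Prop :=
  V.verify pp (V.proof pp 0 (key 0)) (V.proof pp 1 (key 1)) = true

section
variable {P : ℕ → Params} (V : ∀ κ, VDPF (P κ))

def VDPFEfficient : Prop :=
  PolyTime (fun κ (a : (V κ).PP × (P κ).Idx × (P κ).K × (V κ).Coins) =>
    (V κ).gen a.1 a.2.1 a.2.2.1 a.2.2.2) ∧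
  (∀ b, PolyTime (fun κ (a : (V κ).PP × (V κ).Key) => (V κ).eval a.1 b a.2)) ∧
  (∀ b, PolyTime (fun κ (a : (V κ).PP × (V κ).Key) => (V κ).proof a.1 b a.2)) ∧
  PolyTime (fun κ (a : (V κ).PP × (V κ).Proof × (V κ).Proof) =>
    (V κ).verify a.1 a.2.1 a.2.2)

open Classical in
/-- Honestly generated keys share the point function and are accepted, up to a negligible
probability. -/
def VDPFCorrect : Prop :=
  ∀ (α : ∀ κ, (P κ).Idx) (β : ∀ κ, (P κ).K), Negligible fun κ =>
    prob (fun ω : (V κ).PP × (V κ).Coins =>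
      decide (¬ ((V κ).Shares ω.1 ((V κ).gen ω.1 (α κ) (β κ) ω.2) (α κ) (β κ) ∧
        (V κ).Accepts ω.1 ((V κ).gen ω.1 (α κ) (β κ) ω.2))))

/-- One key together with the proof of the other evaluator can be simulated without the point
function. -/
def VDPFPrivate : Prop :=
  ∀ b : Fin 2, ∃ (r : ℕ → ℕ) (sim : ∀ κ, (V κ).PP × Bits (r κ) → (V κ).Key × (V κ).Proof),
    PolyTime sim ∧
    ∀ (α : ∀ κ, (P κ).Idx) (β : ∀ κ, (P κ).K)
      (D : ∀ κ, (V κ).PP × (V κ).Key × (V κ).Proof → Bool), PolyTime D →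
      Negligible fun κ =>
        |prob (fun ω : (V κ).PP × (V κ).Coins =>
            D κ (ω.1, (V κ).gen ω.1 (α κ) (β κ) ω.2 b,
              (V κ).proof ω.1 (1 - b) ((V κ).gen ω.1 (α κ) (β κ) ω.2 (1 - b)))) -
          prob (fun ω : (V κ).PP × Bits (r κ) => D κ (ω.1, sim κ ω))|

open Classical in
/-- Maliciously generated keys that are accepted share some point function, up to a negligible
probability. -/
def VDPFVerifiable : Prop :=
  ∀ A : ∀ κ, (V κ).PP → Fin 2 → (V κ).Key, PolyTime A →
    Negligible fun κ =>
      prob (fun pp : (V κ).PP =>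
        decide ((V κ).Accepts pp (A κ pp) ∧ ¬ ∃ α β, (V κ).Shares pp (A κ pp) α β))

def IsSecureVDPF : Prop :=
  VDPFEfficient V ∧ VDPFCorrect V ∧ VDPFPrivate V ∧ VDPFVerifiable V

end

/-! ## Replicated sharings and reconstruction -/

/-- The pair held by party `p` when the three shares of a replicated sharing are `x`. -/
def rssPair {G : Type} (x : Fin 3 → G) (p : Fin 3) : G × G := (x p, x (p - 1))

/-- The replicated sharing that the parties define without interaction from a two-party sharing
`r` between the parties `i` and `i + 1` that was dealt by the party `i + 2`. -/
def dealtRSS {G : Type} [Zero G] (i : Fin 3) (r : Fin 2 → G) (p : Fin 3) : G × G :=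
  if p = i then (0, r 0) else if p = i + 1 then (r 1, 0) else (r 0, r 1)

/-- The value computed by the reconstruction functionality from the pairs of the two honest
parties `c + 1` and `c + 2` of a consistent replicated sharing. (The functionality sends it to the
receiving party; the adversary may prevent the delivery to an honest receiver.) -/
def reconstruct {G : Type} [Add G] (c : Fin 3) (u : Fin 3 → G × G) : G :=
  (u (c + 1)).2 + (u (c + 1)).1 + (u (c + 2)).1

/-! ## Local computations of the protocol

For `i : Fin 3`, the pair number `i` consists of the evaluators `i` (role `0`) and `i + 1`
(role `1`), and its dealer is the party `i + 2`. -/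

/-- The party with role `b` in pair `i`. -/
def evaluator (i : Fin 3) (b : Fin 2) : Fin 3 := i + b.castSucc

/-- The pair in which party `c` has role `b`. -/
def pairOf (c : Fin 3) (b : Fin 2) : Fin 3 := c - b.castSucc

section
variable {P : Params} (V : VDPF P)

/-- What a dealer sends to an evaluator: a key and a share of the index. -/
abbrev VDPF.Deal : Type := V.Key × P.Idx

/-- The messages of an honest dealer: keys for the value `1` at the random index `rdx = ω.1`, and
a random sharing of `rdx`. -/
def VDPF.honestDeal (pp : V.PP) (ω : P.Idx × P.Idx × V.Coins) (b : Fin 2) : V.Deal :=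
  (V.gen pp ω.1 1 ω.2.2 b, if b = 0 then ω.2.1 else ω.1 - ω.2.1)

/-- The shares of `t = ∑ j, v j` and `s = rdx - ∑ j, j * v j` of the evaluator `b`. -/
def VDPF.checkShares (pp : V.PP) (b : Fin 2) (d : V.Deal) : P.K × P.K :=
  (∑ j, V.eval pp b d.1 j, P.emb d.2 - ∑ j, P.emb j * V.eval pp b d.1 j)

/-- In every pair the exchanged proofs are accepted. -/
def VDPF.proofsOk (pp : V.PP) (π : Fin 3 → Fin 2 → V.Proof) : Prop :=
  ∀ i, V.verify pp (π i 0) (π i 1) = true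

/-- In every pair the opened values are `t = 1` and `s = 0`. -/
def openingsOk (o : Fin 3 → Fin 2 → P.K × P.K) : Prop :=
  ∀ i, (o i 0).1 + (o i 1).1 = 1 ∧ (o i 0).2 + (o i 1).2 = 0

/-- The pairs of the replicated sharing of `Δ = rdx ⊕ idx` for pair `i`. -/
def deltaRSS (i : Fin 3) (d : Fin 2 → V.Deal) (idx : Fin 3 → P.Idx) (p : Fin 3) :
    P.Idx × P.Idx :=
  dealtRSS i (fun b => (d b).2) p + rssPair idx p

/-- The share of the selected entry of the array share `T` of the evaluator `b`. -/
def VDPF.selectShare (pp : V.PP) (b : Fin 2) (key : V.Key) (T : P.Idx → P.K) (Δ : P.Idx) : P.K :=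
  ∑ j, T j * V.eval pp b key (j + Δ)

/-- The value `z p` that party `p` sends to party `p + 1` for resharing; `mask p` stands for the
value of the PRF under the key common to the parties `p` and `p + 1`. -/
def VDPF.reshareMsg (pp : V.PP) (d : Fin 3 → Fin 2 → V.Deal) (T : Fin 3 → P.Idx → P.K)
    (Δ : Fin 3 → P.Idx) (mask : Fin 3 → P.K) (p : Fin 3) : P.K :=
  V.selectShare pp 0 (d p 0).1 (T p) (Δ p) +
    V.selectShare pp 1 (d (p - 1) 1).1 (T (p - 1)) (Δ (p - 1)) + mask p - mask (p - 1)

end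

/-- Run the steps one after the other until one of them returns `false` (abort). -/
def runSteps {σ : Type} (n : ℕ) (step : Fin n → σ → σ × Bool) (s : σ) : σ × Bool :=
  (List.finRange n).foldl (fun a k => if a.2 = true then step k a.1 else a) (s, true)

/-! ## One corrupted party -/

section
variable (κ : ℕ) {P : Params} (V : VDPF P)

/-- An environment that chooses the inputs of all parties, sees their outputs, controls the
corrupted party `c`, and outputs a bit. In each round it acts after it has seen the messages of
the honest parties. The answer `none` or `false` means that the corrupted party makes the protocol
abort. The messages to and from the corrupted party that are indexed by `b : Fin 2` are those
that concern its role `b`. -/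
structure Environment where
  coinLen : ℕ
  stateLen : ℕ
  /-- Gets the public string and the two PRF keys of the corrupted party. -/
  setup : Bits coinLen × V.PP × Bits κ × Bits κ → Bits stateLen
  /-- Gets the keys and index shares for the corrupted party; answers with the keys and index
  shares that the corrupted party deals. -/
  deal : Fin P.runs → Bits stateLen × (Fin 2 → V.Deal) → Bits stateLen × Option (Fin 2 → V.Deal)
  /-- Exchange of the proofs for the verification of the keys. -/
  prove : Fin P.runs → Bits stateLen × (Fin 2 → V.Proof) →
    Bits stateLen × Option (Fin 2 → V.Proof)
  /-- Exchange of the shares of `t` and `s`. -/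
  opening : Fin P.runs → Bits stateLen × (Fin 2 → P.K × P.K) →
    Bits stateLen × Option (Fin 2 → P.K × P.K)
  /-- The shares of the array and of the index for a selection. -/
  input : Fin P.runs → Bits stateLen → Bits stateLen × (Fin 3 → P.Idx → P.K) × (Fin 3 → P.Idx)
  /-- Gets the reconstructed values; answers whether the reconstruction to the honest parties
  succeeds. -/
  recon : Fin P.runs → Bits stateLen × (Fin 2 → P.Idx) → Bits stateLen × Bool
  /-- Gets the resharing message of party `c - 1`; answers with the message to party `c + 1` and
  whether the honest parties `c + 1` and `c + 2` are allowed to finish. -/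
  reshare : Fin P.runs → Bits stateLen × P.K → Bits stateLen × P.K × (Fin 2 → Bool)
  /-- Gets the outputs of the parties `c + 1` and `c + 2`. -/
  output : Fin P.runs → Bits stateLen × (Fin 2 → Option (P.K × P.K)) → Bits stateLen
  /-- The final bit; the argument tells whether the execution ended without abort. -/
  decision : Bits stateLen × Bool → Bool

def Environment.Bounded {κ : ℕ} {P : Params} {V : VDPF P} (E : Environment κ V) (s : ℕ) : Prop :=
  HasCircuit s E.setup ∧ (∀ k, HasCircuit s (E.deal k)) ∧ (∀ k, HasCircuit s (E.prove k)) ∧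
  (∀ k, HasCircuit s (E.opening k)) ∧ (∀ k, HasCircuit s (E.input k)) ∧
  (∀ k, HasCircuit s (E.recon k)) ∧ (∀ k, HasCircuit s (E.reshare k)) ∧
  (∀ k, HasCircuit s (E.output k)) ∧ HasCircuit s E.decision

/-- A simulator for the corrupted party: it talks to the environment in place of the honest
parties and of the reconstruction functionality, and to the selection functionality as the ideal
adversary. Its random coins are given to `setup`, which can keep them in the state. -/
structure Simulator where
  coinLen : ℕ
  stateLen : ℕ
  setup : Bits coinLen × V.PP → Bits stateLen × Bits κ × Bits κ
  deal : Fin P.runs → Bits stateLen → Bits stateLen × (Fin 2 → V.Deal)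
  prove : Fin P.runs → Bits stateLen × (Fin 2 → V.Deal) → Bits stateLen × (Fin 2 → V.Proof)
  /-- The answer `none` makes the execution abort. -/
  opening : Fin P.runs → Bits stateLen × (Fin 2 → V.Proof) →
    Bits stateLen × Option (Fin 2 → P.K × P.K)
  /-- The answer `false` makes the execution abort. -/
  finish : Fin P.runs → Bits stateLen × (Fin 2 → P.K × P.K) → Bits stateLen × Bool
  /-- Gets from the functionality the input shares of the corrupted party. -/
  recon : Fin P.runs → Bits stateLen × (Fin 2 → P.Idx → P.K) × (Fin 2 → P.Idx) →
    Bits stateLen × (Fin 2 → P.Idx)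
  /-- Gets from the functionality the fresh random output share of the corrupted party. -/
  reshare : Fin P.runs → Bits stateLen × P.K → Bits stateLen × P.K
  /-- Gives to the functionality the error and the other output share of the corrupted party. -/
  inject : Fin P.runs → Bits stateLen × P.K → Bits stateLen × P.K × P.K

def Simulator.Bounded {κ : ℕ} {P : Params} {V : VDPF P} (S : Simulator κ V) (s : ℕ) : Prop :=
  HasCircuit s S.setup ∧ (∀ k, HasCircuit s (S.deal k)) ∧ (∀ k, HasCircuit s (S.prove k)) ∧
  (∀ k, HasCircuit s (S.opening k)) ∧ (∀ k, HasCircuit s (S.finish k)) ∧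
  (∀ k, HasCircuit s (S.recon k)) ∧ (∀ k, HasCircuit s (S.reshare k)) ∧
  (∀ k, HasCircuit s (S.inject k))

end

section
variable {κ : ℕ} {P : Params} {V : VDPF P}

/-- The random choices of the real execution: public string, PRF keys (the key number `p` is
common to the parties `p` and `p + 1`), and for every selection and every pair the random choices
of its dealer. -/
abbrev RealCoins (κ : ℕ) {P : Params} (V : VDPF P) : Type :=
  V.PP × (Fin 3 → Bits κ) × (Fin P.runs → Fin 3 → P.Idx × P.Idx × V.Coins)

/-- What all evaluators received in the preprocessing of all selections. -/
abbrev Store {P : Params} (V : VDPF P) : Type := Fin P.runs → Fin 3 → Fin 2 → V.Deal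

open Classical in
/-- The preprocessing for selection `k` when party `c` is corrupted. -/
def realPreprocess (E : Environment κ V) (c : Fin 3) (ω : RealCoins κ V) (k : Fin P.runs)
    (σ : Bits E.stateLen × Store V) : (Bits E.stateLen × Store V) × Bool :=
  let pp := ω.1
  let h := fun i => V.honestDeal pp (ω.2.2 k i)
  match E.deal k (σ.1, fun b => h (pairOf c b) b) with
  | (st, none) => ((st, σ.2), false)
  | (st, some bad) =>
    let d := fun i => if i = c + 1 then bad else h i
    let π := fun i b => V.proof pp b (d i b).1
    match E.prove k (st, fun b => π (pairOf c b) (1 - b)) with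
    | (st, none) => ((st, σ.2), false)
    | (st, some bad) =>
      if V.proofsOk pp (fun i b => if evaluator i b = c then bad b else π i b) then
        let o := fun i b => V.checkShares pp b (d i b)
        match E.opening k (st, fun b => o (pairOf c b) (1 - b)) with
        | (st, none) => ((st, σ.2), false)
        | (st, some bad) =>
          if openingsOk (fun i b => if evaluator i b = c then bad b else o i b) then
            ((st, Function.update σ.2 k d), true)
          else ((st, σ.2), false)
      else ((st, σ.2), false)

/-- The selection `k` when party `c` is corrupted. -/
def realSelect (F : Bits κ → Bits κ → P.K) (sid : Fin P.runs → Bits κ) (E : Environment κ V)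
    (c : Fin 3) (ω : RealCoins κ V) (store : Store V) (k : Fin P.runs) (st : Bits E.stateLen) :
    Bits E.stateLen × Bool :=
  match E.input k st with
  | (st, T, idx) =>
    let Δ := fun i => reconstruct c (deltaRSS V i (store k i) idx)
    match E.recon k (st, fun b => Δ (pairOf c b)) with
    | (st, false) => (st, false)
    | (st, true) =>
      let z := V.reshareMsg ω.1 (store k) T Δ (fun p => F (ω.2.1 p) (sid k))
      match E.reshare k (st, z (c - 1)) with
      | (st, zc, fin) =>
        (E.output k (st, ![if fin 0 then some (z (c + 1), zc) else none,
            if fin 1 then some (z (c + 2), z (c + 1)) else none]),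
          fin 0 && fin 1)

/-- The bit of the environment in the real execution with corrupted party `c`: first the
preprocessing for all selections, then the selections. -/
def realRun (F : Bits κ → Bits κ → P.K) (sid : Fin P.runs → Bits κ) (E : Environment κ V)
    (c : Fin 3) (ω : RealCoins κ V × Bits E.coinLen) : Bool :=
  let keys := ω.1.2.1
  match runSteps P.runs (realPreprocess E c ω.1)
      (E.setup (ω.2, ω.1.1, keys c, keys (c - 1)), fun _ _ _ => 0) with
  | (σ, false) => E.decision (σ.1, false)
  | (σ, true) => E.decision (runSteps P.runs (realSelect F sid E c ω.1 σ.2) σ.1)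

/-- The entry that the replicated sharings of an array and of an index determine. -/
def selected (T : Fin 3 → P.Idx → P.K) (idx : Fin 3 → P.Idx) : P.K := ∑ i, T i (∑ p, idx p)

/-- The three output shares of the selection functionality with additive attacks: they add up to
the selected entry plus the error `e`; the share number `c - 1` is the random element `r`
chosen by the functionality, and the share number `c` is chosen by the adversary. -/
def osShares (c : Fin 3) (T : Fin 3 → P.Idx → P.K) (idx : Fin 3 → P.Idx) (r e zc : P.K)
    (p : Fin 3) : P.K :=
  if p = c then zc else if p = c - 1 then r else selected T idx + e - zc - r

/-- The random choices of the ideal execution: public string, coins of the simulator, and the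
random shares chosen by the functionality. -/
abbrev IdealCoins {κ : ℕ} {P : Params} {V : VDPF P} (S : Simulator κ V) : Type :=
  V.PP × Bits S.coinLen × (Fin P.runs → P.K)

def idealPreprocess (E : Environment κ V) (S : Simulator κ V) (k : Fin P.runs)
    (σ : Bits E.stateLen × Bits S.stateLen) : (Bits E.stateLen × Bits S.stateLen) × Bool :=
  match S.deal k σ.2 with
  | (ss, msg) =>
    match E.deal k (σ.1, msg) with
    | (st, none) => ((st, ss), false)
    | (st, some bad) =>
      match S.prove k (ss, bad) with
      | (ss, msg) =>
        match E.prove k (st, msg) with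
        | (st, none) => ((st, ss), false)
        | (st, some bad) =>
          match S.opening k (ss, bad) with
          | (ss, none) => ((st, ss), false)
          | (ss, some msg) =>
            match E.opening k (st, msg) with
            | (st, none) => ((st, ss), false)
            | (st, some bad) =>
              match S.finish k (ss, bad) with
              | (ss, ok) => ((st, ss), ok)

/-- The selection `k` in the ideal execution. The functionality gives to the simulator the input
shares number `c` and `c - 1` and the random output share `r k`, and the honest parties output
what they get from the functionality. -/
def idealSelect (E : Environment κ V) (S : Simulator κ V) (c : Fin 3) (r : Fin P.runs → P.K)
    (k : Fin P.runs) (σ : Bits E.stateLen × Bits S.stateLen) :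
    (Bits E.stateLen × Bits S.stateLen) × Bool :=
  match E.input k σ.1 with
  | (st, T, idx) =>
    match S.recon k (σ.2, fun b => T (pairOf c b), fun b => idx (pairOf c b)) with
    | (ss, Δ) =>
      match E.recon k (st, Δ) with
      | (st, false) => ((st, ss), false)
      | (st, true) =>
        match S.reshare k (ss, r k) with
        | (ss, msg) =>
          match E.reshare k (st, msg) with
          | (st, bad, fin) =>
            match S.inject k (ss, bad) with
            | (ss, e, zc) =>
              let z := rssPair (osShares c T idx (r k) e zc)
              ((E.output k (st, ![if fin 0 then some (z (c + 1)) else none,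
                  if fin 1 then some (z (c + 2)) else none]), ss),
                fin 0 && fin 1)

/-- The bit of the environment in the ideal execution with corrupted party `c`. -/
def idealRun (E : Environment κ V) (S : Simulator κ V) (c : Fin 3)
    (ω : IdealCoins S × Bits E.coinLen) : Bool :=
  match S.setup (ω.1.2.1, ω.1.1) with
  | (ss, key, key2) =>
    match runSteps P.runs (idealPreprocess E S) (E.setup (ω.2, ω.1.1, key, key2), ss) with
    | (σ, false) => E.decision (σ.1, false)
    | (σ, true) =>
      match runSteps P.runs (idealSelect E S c ω.1.2.2) σ with
      | (σ, ok) => E.decision (σ.1, ok)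

end

/-! ## No corrupted party -/

/-- An environment that corrupts no party: it chooses the inputs and sees the outputs. -/
structure HonestEnvironment {P : Params} (V : VDPF P) where
  coinLen : ℕ
  stateLen : ℕ
  setup : Bits coinLen × V.PP → Bits stateLen
  input : Fin P.runs → Bits stateLen → Bits stateLen × (Fin 3 → P.Idx → P.K) × (Fin 3 → P.Idx)
  output : Fin P.runs → Bits stateLen × (Fin 3 → P.K × P.K) → Bits stateLen
  /-- The final bit; the argument tells whether the execution ended without abort. -/
  decision : Bits stateLen × Bool → Bool

section
variable {κ : ℕ} {P : Params} {V : VDPF P}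

def HonestEnvironment.Bounded (E : HonestEnvironment V) (s : ℕ) : Prop :=
  HasCircuit s E.setup ∧ (∀ k, HasCircuit s (E.input k)) ∧ (∀ k, HasCircuit s (E.output k)) ∧
    HasCircuit s E.decision

/-- The selections with all parties honest. As all pairs of a sharing are consistent, the choice
of the two pairs from which the reconstruction is done is immaterial. -/
def honestSelect (F : Bits κ → Bits κ → P.K) (sid : Fin P.runs → Bits κ)
    (E : HonestEnvironment V) (ω : RealCoins κ V) (store : Store V) (k : Fin P.runs)
    (st : Bits E.stateLen) : Bits E.stateLen × Bool :=
  match E.input k st with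
  | (st, T, idx) =>
    let Δ := fun i => reconstruct 0 (deltaRSS V i (store k i) idx)
    let z := V.reshareMsg ω.1 (store k) T Δ (fun p => F (ω.2.1 p) (sid k))
    (E.output k (st, rssPair z), true)

open Classical in
def honestRealRun (F : Bits κ → Bits κ → P.K) (sid : Fin P.runs → Bits κ)
    (E : HonestEnvironment V) (ω : RealCoins κ V × Bits E.coinLen) : Bool :=
  let pp := ω.1.1
  let st := E.setup (ω.2, pp)
  let store : Store V := fun k i => V.honestDeal pp (ω.1.2.2 k i)
  if ∀ k, V.proofsOk pp (fun i b => V.proof pp b (store k i b).1) ∧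
      openingsOk (fun i b => V.checkShares pp b (store k i b)) then
    E.decision (runSteps P.runs (honestSelect F sid E ω.1 store) st)
  else E.decision (st, false)

/-- With all parties honest the functionality hands out fresh random sharings of the selected
entries, without error. -/
def honestIdealRun (E : HonestEnvironment V)
    (ω : (V.PP × (Fin P.runs → P.K × P.K)) × Bits E.coinLen) : Bool :=
  E.decision (runSteps P.runs (fun k st =>
    match E.input k st with
    | (st, T, idx) =>
      let r := ω.1.2 k
      (E.output k (st, rssPair ![r.1, r.2, selected T idx - r.1 - r.2]), true))
    (E.setup (ω.2, ω.1.1)))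

end

/-- The protocol, with the VDPF `V`, the PRF `F` and the session identifiers `sid`, securely
computes the oblivious selection functionality with additive attacks, in the hybrid model with the
reconstruction functionality, against a malicious adversary that statically corrupts at most one of
the three parties (with abort). -/
def SecurelyComputesOS {P : ℕ → Params} (V : ∀ κ, VDPF (P κ))
    (F : ∀ κ, Bits κ → Bits κ → (P κ).K) (sid : ∀ κ, Fin (P κ).runs → Bits κ) : Prop :=
  (∀ c : Fin 3, ∃ S : ∀ κ, Simulator κ (V κ),
    (∃ p : Polynomial ℕ, ∀ κ, (S κ).Bounded (p.eval κ)) ∧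
    ∀ E : ∀ κ, Environment κ (V κ), (∃ p : Polynomial ℕ, ∀ κ, (E κ).Bounded (p.eval κ)) →
      Negligible fun κ =>
        |prob (realRun (F κ) (sid κ) (E κ) c) - prob (idealRun (E κ) (S κ) c)|) ∧
  (∀ E : ∀ κ, HonestEnvironment (V κ), (∃ p : Polynomial ℕ, ∀ κ, (E κ).Bounded (p.eval κ)) →
      Negligible fun κ =>
        |prob (honestRealRun (F κ) (sid κ) (E κ)) - prob (honestIdealRun (E κ))|)

end ObliviousSelection

end

noncomputable section

namespace ObliviousSelection

/-! ## Straight-line programs -/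

/-! Fix a corrupted party `c`. It evaluates in the pairs `c` and `c - 1`, deals for the pair `c +
1`, and knows every PRF key except number `c + 1`.

Correctness. If the keys of each pair share the unit function at the dealt index `rdx` (`GoodPair`),
then shifting by `Δ = rdx + idx` extracts the entry at `idx` from each array share. The masks
telescope, so the three resharing messages add up to the selected entry (`reshareMsg_sum`). For
honest dealers this is correctness of the VDPF. For the pair dealt by `c`, verifiability yields a
point function with some value `β` at some `α`; the opened values are then `t = β` and `s = emb rdx
- emb α * β`, so the two checks force `β = 1` and `α = rdx` (`goodPair_of_checks`). Once all pairs
are good, sending a wrong resharing message amounts to an additive error, namely the difference from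
the correct message, which the simulator can compute.

Privacy. Four steps lead from the real to the ideal execution. The PRF values under key `c + 1`
become random (`maskedRun_prf`). Outside unlikely events these values make the message of party `c -
1` uniform, and the execution becomes the function `hybRun` of what `c` receives (`maskedRun_hyb`).
The key and the partner's proof in each slot are then simulated, one slot after the other
(`hybRun_private`); this suffices because the partner's opening shares are the complements to `(1,
0)` of the shares of `c`. Finally `rdx` survives only in one index share and in `Δ`; the share is
uniform and independent of `rdx`, which therefore acts as a one-time pad for the selected index, so
`Δ` is uniform (`prob_idealRun`).

The environment is adaptive, so each change of variables depends on the state reached so far; this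
is `avg_foldl_bijective`. Adversaries are non-uniform, so all coins that a reduction does not attack
are fixed as advice, and `exists_negligible_bound` gives one negligible function valid for all
advice. That the simulator and the reductions have polynomial size is derived from a calculus of
circuits, `PolyCirc`, closed under composition, iteration and field arithmetic.

With no corruption, two PRF keys are replaced by random values. Two messages are then uniform and
the third is determined by the sum. -/

def runGates {I : Type} (x : I → Bool) (gs : List ((I ⊕ ℕ) × (I ⊕ ℕ))) (vals : List Bool) :
    List Bool :=
  gs.foldl (fun vals g => vals ++ [!(readWire x vals g.1 && readWire x vals g.2)]) vals

theorem runGates_length {I : Type} (x : I → Bool) (gs : List ((I ⊕ ℕ) × (I ⊕ ℕ)))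
    (vals : List Bool) : (runGates x gs vals).length = vals.length + gs.length := by
  induction gs generalizing vals with
  | nil => simp [runGates]
  | cons g gs ih =>
    have := ih (vals ++ [!(readWire x vals g.1 && readWire x vals g.2)])
    simp only [runGates, List.foldl_cons] at this ⊢
    rw [this]
    simp only [List.length_append, List.length_cons, List.length_nil]
    omega

/-- The wire is an input or the output of one of the first `m` gates. -/
def WireBelow {I : Type} (m : ℕ) (w : I ⊕ ℕ) : Prop := ∀ n, w = Sum.inr n → n < m

theorem WireBelow.mono {I : Type} {m m' : ℕ} {w : I ⊕ ℕ} (h : WireBelow m w) (hm : m ≤ m') :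
    WireBelow m' w := fun n hn => (h n hn).trans_le hm

theorem readWire_append {I : Type} (x : I → Bool) (vals v : List Bool) {w : I ⊕ ℕ}
    (h : WireBelow vals.length w) : readWire x (vals ++ v) w = readWire x vals w := by
  cases w with
  | inl i => rfl
  | inr n =>
    have := h n rfl
    simp [readWire, List.getD_eq_getElem?_getD, List.getElem?_append_left this]

/-- Relabelling of the wires of a program whose inputs are computed by another one. -/
def substWire {I J : Type} (out : J → I ⊕ ℕ) (m : ℕ) : J ⊕ ℕ → I ⊕ ℕ :=
  Sum.elim out (fun n => Sum.inr (m + n))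

/-- A wire beyond the end of `v` is still beyond the end of `vals ++ v` after the shift, so it reads
`false` on both sides. Hence only the wires in `out` must be known to be computed. -/
theorem readWire_subst {I J : Type} (x : I → Bool) (vals v : List Bool) (out : J → I ⊕ ℕ)
    (h : ∀ j, WireBelow vals.length (out j)) (w : J ⊕ ℕ) :
    readWire x (vals ++ v) (substWire out vals.length w) =
      readWire (fun j => readWire x vals (out j)) v w := by
  cases w with
  | inl j => exact readWire_append x vals v (h j)
  | inr n =>
    simp [substWire, readWire, List.getD_eq_getElem?_getD, List.getElem?_append_right]

theorem runGates_subst {I J : Type} (x : I → Bool) (vals : List Bool) (out : J → I ⊕ ℕ)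
    (h : ∀ j, WireBelow vals.length (out j)) (gs : List ((J ⊕ ℕ) × (J ⊕ ℕ))) (v : List Bool) :
    runGates x (gs.map (Prod.map (substWire out vals.length) (substWire out vals.length)))
        (vals ++ v) =
      vals ++ runGates (fun j => readWire x vals (out j)) gs v := by
  induction gs generalizing v with
  | nil => rfl
  | cons g gs ih =>
    simp only [runGates, List.map_cons, List.foldl_cons, Prod.map_fst, Prod.map_snd,
      readWire_subst x vals v out h] at ih ⊢
    rw [List.append_assoc]
    exact ih _

/-- The bits `g x` are computed from the bits `u x` by at most `s` gates. -/
def Gates {X I O : Type} (s : ℕ) (u : X → I → Bool) (g : X → O → Bool) : Prop :=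
  ∃ (gs : List ((I ⊕ ℕ) × (I ⊕ ℕ))) (out : O → I ⊕ ℕ), gs.length ≤ s ∧
    (∀ o, WireBelow gs.length (out o)) ∧
    ∀ x o, readWire (u x) (runGates (u x) gs []) (out o) = g x o

section
variable {X Y I J O : Type} {s t : ℕ}

theorem Gates.mono {u : X → I → Bool} {g : X → O → Bool} (h : Gates s u g) (hst : s ≤ t) :
    Gates t u g := by
  obtain ⟨gs, out, h1, h2⟩ := h
  exact ⟨gs, out, h1.trans hst, h2⟩

theorem Gates.precomp {u : X → I → Bool} {g : X → O → Bool} (h : Gates s u g) (f : Y → X) :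
    Gates s (fun y => u (f y)) (fun y => g (f y)) := by
  obtain ⟨gs, out, h1, h2, h3⟩ := h
  exact ⟨gs, out, h1, h2, fun y => h3 (f y)⟩

/-- The second program is appended with its inputs rewired to the outputs of the first and its gate
numbers shifted. This is where `WireBelow` matters: an output wire to a gate not yet computed reads
`false`, but could change its value once further gates are appended. -/
theorem Gates.comp {u : X → I → Bool} {v : X → J → Bool} {g : X → O → Bool}
    (h : Gates s u v) (h' : Gates t v g) : Gates (s + t) u g := by
  obtain ⟨gs, out, h1, h2, h3⟩ := h
  obtain ⟨gs', out', h1', h2', h3'⟩ := h'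
  refine ⟨gs ++ gs'.map (Prod.map (substWire out gs.length) (substWire out gs.length)),
    fun o => substWire out gs.length (out' o), ?_, ?_, ?_⟩
  · simp only [List.length_append, List.length_map]
    omega
  · intro o n hn
    simp only [List.length_append, List.length_map] at hn ⊢
    cases hw : out' o with
    | inl j =>
      rw [hw] at hn
      have := h2 j n hn
      omega
    | inr k =>
      rw [hw] at hn
      simp only [substWire, Sum.elim_inr, Sum.inr.injEq] at hn
      have := h2' o k hw
      omega
  · intro x o
    have hlen : (runGates (u x) gs []).length = gs.length := by simp [runGates_length]
    have h2l : ∀ j, WireBelow (runGates (u x) gs []).length (out j) := by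
      rw [hlen]; exact h2
    have key := runGates_subst (u x) (runGates (u x) gs []) out h2l gs' []
    rw [hlen, List.append_nil] at key
    have happ : runGates (u x)
        (gs ++ gs'.map (Prod.map (substWire out gs.length) (substWire out gs.length))) [] =
        runGates (u x) (gs'.map (Prod.map (substWire out gs.length) (substWire out gs.length)))
          (runGates (u x) gs []) := by
      simp [runGates, List.foldl_append]
    rw [happ, key]
    have hr := readWire_subst (u x) (runGates (u x) gs [])
      (runGates (fun j => readWire (u x) (runGates (u x) gs []) (out j)) gs' []) out h2l (out' o)
    rw [hlen] at hr
    have hv : (fun j => readWire (u x) (runGates (u x) gs []) (out j)) = v x := funext (h3 x)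
    rw [hr, hv, h3']

theorem Gates.wiring {u : X → I → Bool} {g : X → O → Bool}
    (h : ∀ o, (∃ i, ∀ x, g x o = u x i) ∨ ∃ b, ∀ x, g x o = b) : Gates 2 u g := by
  have h' : ∀ o, ∃ w : I ⊕ ℕ, WireBelow 2 w ∧ ∀ x, readWire (u x) [true, false] w = g x o := by
    intro o
    rcases h o with ⟨i, hi⟩ | ⟨b, hb⟩
    · exact ⟨Sum.inl i, fun n hn => by simp at hn, fun x => (hi x).symm⟩
    · cases b with
      | true => exact ⟨Sum.inr 0, fun n hn => by simp at hn; omega, fun x => (hb x).symm⟩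
      | false => exact ⟨Sum.inr 1, fun n hn => by simp at hn; omega, fun x => (hb x).symm⟩
  choose out h1 h2 using h'
  -- Gate `0` reads itself before it is computed, so it is the negation of `false`; gate `1` negates
  -- gate `0`. Both constants thus become available on computed wires.
  exact ⟨[(Sum.inr 0, Sum.inr 0), (Sum.inr 0, Sum.inr 0)], out, le_rfl, h1,
    fun x o => h2 o x⟩

/-- Blocks of outputs are computed one after the other. -/
theorem Gates.blocks {ι : Type} [Fintype ι] {u : X → I → Bool} {g : X → O → Bool} (blk : O → ι)
    {s : ι → ℕ} (h : ∀ j, Gates (s j) u (fun x (o : {o // blk o = j}) => g x o)) :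
    Gates (∑ j, s j) u g := by
  classical
  have key : ∀ l : List ι, ∃ (gs : List ((I ⊕ ℕ) × (I ⊕ ℕ))) (out : O → I ⊕ ℕ),
      gs.length ≤ (l.map s).sum ∧ ∀ o, blk o ∈ l → (WireBelow gs.length (out o) ∧
        ∀ x, readWire (u x) (runGates (u x) gs []) (out o) = g x o) := by
    intro l
    induction l with
    | nil =>
      refine ⟨[], fun _ => Sum.inr 0, by simp, fun o ho => by simp at ho⟩
    | cons j l ih =>
      obtain ⟨gs, out, h1, h2⟩ := ih
      obtain ⟨gs', out', h1', h2', h3'⟩ := h j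
      refine ⟨gs ++ gs'.map (Prod.map (substWire Sum.inl gs.length) (substWire Sum.inl gs.length)),
        fun o => if ho : blk o = j then substWire Sum.inl gs.length (out' ⟨o, ho⟩) else out o,
        ?_, ?_⟩
      · simp only [List.length_append, List.length_map, List.map_cons, List.sum_cons]
        omega
      · intro o ho
        have hlen : ∀ x, (runGates (u x) gs []).length = gs.length := by simp [runGates_length]
        have hrun : ∀ x, runGates (u x)
            (gs ++ gs'.map (Prod.map (substWire Sum.inl gs.length) (substWire Sum.inl gs.length)))
              [] = runGates (u x) gs [] ++ runGates (u x) gs' [] := by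
          intro x
          have := runGates_subst (u x) (runGates (u x) gs []) Sum.inl
            (fun j n hn => by simp at hn) gs' []
          rw [hlen, List.append_nil] at this
          rw [← show runGates (u x) gs' [] = runGates (fun j => readWire (u x)
            (runGates (u x) gs []) (Sum.inl j)) gs' [] from rfl] at this
          rw [← this]
          simp [runGates, List.foldl_append]
        by_cases hj : blk o = j
        · simp only [hj, dif_pos]
          constructor
          · intro n hn
            simp only [List.length_append, List.length_map]
            cases hw : out' ⟨o, hj⟩ with
            | inl i => rw [hw] at hn; simp [substWire] at hn
            | inr k =>
              rw [hw] at hn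
              simp only [substWire, Sum.elim_inr, Sum.inr.injEq] at hn
              have := h2' ⟨o, hj⟩ k hw
              omega
          · intro x
            have hr := readWire_subst (u x) (runGates (u x) gs []) (runGates (u x) gs' []) Sum.inl
              (fun j n hn => by simp at hn) (out' ⟨o, hj⟩)
            rw [hlen] at hr
            rw [hrun, hr]
            exact h3' x ⟨o, hj⟩
        · simp only [hj, dif_neg, not_false_eq_true]
          have ho' : blk o ∈ l := by
            rcases List.mem_cons.1 ho with h | h
            · exact absurd h hj
            · exact h
          obtain ⟨h4, h5⟩ := h2 o ho'
          refine ⟨h4.mono (by simp), fun x => ?_⟩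
          rw [hrun, readWire_append _ _ _ (by rw [hlen]; exact h4), h5]
  obtain ⟨gs, out, h1, h2⟩ := key Finset.univ.toList
  refine ⟨gs, out, by rwa [Finset.sum_map_toList] at h1, fun o => (h2 o (by simp)).1, fun x o => (h2 o (by simp)).2 x⟩

end

/-! ## Functions between encoded types -/

/-- `f` is computed by at most `s` gates. -/
def HasGates {α β : Type} [BitEnc α] [BitEnc β] (s : ℕ) (f : α → β) : Prop :=
  Gates s (fun a : α => BitEnc.enc a) (fun a => BitEnc.enc (f a))

abbrev wires (α : Type) [BitEnc α] : ℕ := Fintype.card (BitEnc.Wire α)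

theorem HasGates.hasCircuit {α β : Type} [BitEnc α] [BitEnc β] {s t : ℕ} {f : α → β}
    (h : HasGates s f) (ht : wires α + wires β + s ≤ t) : HasCircuit t f := by
  obtain ⟨gs, out, h1, h2, h3⟩ := h
  refine ⟨⟨gs, out⟩, ?_, fun a => funext fun o => h3 a o⟩
  have : Circuit.size ⟨gs, out⟩ = wires α + wires β + gs.length := rfl
  omega

theorem HasCircuit.wires_left {α β : Type} [BitEnc α] [BitEnc β] {s : ℕ} {f : α → β}
    (h : HasCircuit s f) : wires α ≤ s := by
  obtain ⟨C, h1, -⟩ := h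
  simp only [Circuit.size] at h1
  simp only [wires]
  omega

theorem HasCircuit.wires_right {α β : Type} [BitEnc α] [BitEnc β] {s : ℕ} {f : α → β}
    (h : HasCircuit s f) : wires β ≤ s := by
  obtain ⟨C, h1, -⟩ := h
  simp only [Circuit.size] at h1
  simp only [wires]
  omega

/-- A `Circuit` may use an output wire past its last gate, which reads `false`. Two more gates make
the constants `true` at position `m` and `false` at position `m + 1`, and such outputs are
redirected to the latter. The wire `m + 2` is not computed when gate `m` reads it. -/
theorem HasCircuit.hasGates {α β : Type} [BitEnc α] [BitEnc β] {s : ℕ} {f : α → β}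
    (h : HasCircuit s f) : HasGates (s + 2) f := by
  obtain ⟨⟨gs, out⟩, h1, h2⟩ := h
  have hlen : gs.length ≤ s := by
    simp only [Circuit.size] at h1
    omega
  set m := gs.length with hm
  refine ⟨gs ++ [(Sum.inr (m + 2), Sum.inr (m + 2)), (Sum.inr m, Sum.inr m)],
    fun o => match out o with
      | Sum.inl i => Sum.inl i
      | Sum.inr n => if n < m then Sum.inr n else Sum.inr (m + 1), by simp; omega, ?_, ?_⟩
  · intro o n hn
    simp only [List.length_append, List.length_cons, List.length_nil]
    cases hw : out o with
    | inl i => simp [hw] at hn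
    | inr k =>
      simp only [hw] at hn
      split_ifs at hn with hk <;> simp only [Sum.inr.injEq] at hn <;> omega
  · intro a o
    have h2' : readWire (BitEnc.enc a) (runGates (BitEnc.enc a) gs []) (out o) =
      BitEnc.enc (f a) o := congrFun (h2 a) o
    refine Eq.trans ?_ h2'
    have hl : (runGates (BitEnc.enc a) gs []).length = m := by simp [runGates_length, hm]
    have hrun : runGates (BitEnc.enc a)
        (gs ++ [(Sum.inr (m + 2), Sum.inr (m + 2)), (Sum.inr m, Sum.inr m)]) [] =
        runGates (BitEnc.enc a) gs [] ++ [true, false] := by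
      have : runGates (BitEnc.enc a)
          (gs ++ [(Sum.inr (m + 2), Sum.inr (m + 2)), (Sum.inr m, Sum.inr m)]) [] =
          runGates (BitEnc.enc a) [(Sum.inr (m + 2), Sum.inr (m + 2)), (Sum.inr m, Sum.inr m)]
            (runGates (BitEnc.enc a) gs []) := by
        simp [runGates, List.foldl_append]
      rw [this]
      generalize runGates (BitEnc.enc a) gs [] = vals at hl
      simp [runGates, readWire, List.getD_eq_getElem?_getD, hl]
    simp only [hrun]
    cases hw : out o with
    | inl i => rfl
    | inr k =>
      simp only
      split_ifs with hk
      · exact readWire_append _ _ _ (fun n hn => by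
          simp only [Sum.inr.injEq] at hn; omega)
      · have hk' : m ≤ k := not_lt.1 hk
        simp [readWire, List.getD_eq_getElem?_getD, hl,
          List.getElem?_eq_none (hl.trans_le hk')]

theorem hasGates_nand : HasGates 1 (fun a : Bool × Bool => !(a.1 && a.2)) := by
  refine ⟨[(Sum.inl (Sum.inl ()), Sum.inl (Sum.inr ()))], fun _ => Sum.inr 0, le_rfl, ?_, ?_⟩
  · intro o n hn
    simp only [Sum.inr.injEq] at hn
    simp [← hn]
  · intro a o
    rfl

section
variable {α β γ δ : Type} [BitEnc α] [BitEnc β] [BitEnc γ] [BitEnc δ] {s t : ℕ}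

theorem HasGates.comp {g : β → γ} {f : α → β} (hg : HasGates t g) (hf : HasGates s f) :
    HasGates (s + t) (fun a => g (f a)) :=
  Gates.comp hf (Gates.precomp hg f)

theorem HasGates.pi {ι : Type} [Fintype ι] {f : α → ι → β}
    (h : ∀ j, HasGates s (fun a => f a j)) : HasGates (Fintype.card ι * s) f := by
  have h0 : ∑ _j : ι, s = Fintype.card ι * s := by simp
  rw [← h0]
  refine Gates.blocks (fun o : ι × BitEnc.Wire β => o.1) fun j => ?_
  obtain ⟨gs, out, h1, h2, h3⟩ := h j
  refine ⟨gs, fun o => out o.1.2, h1, fun o => h2 _, fun x o => ?_⟩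
  rw [h3]
  obtain ⟨⟨j', w⟩, rfl⟩ := o
  rfl

theorem HasGates.prodMk {f : α → β} {g : α → γ} (hf : HasGates s f) (hg : HasGates t g) :
    HasGates (s + t) (fun a => (f a, g a)) := by
  have := Gates.blocks (ι := Bool) (s := fun j => if j then s else t) (u := fun a : α => BitEnc.enc a)
    (g := fun a => BitEnc.enc (f a, g a))
    (fun o : BitEnc.Wire β ⊕ BitEnc.Wire γ => o.isLeft) ?_
  · rw [Fintype.sum_bool] at this
    exact this
  · intro j
    cases j with
    | true =>
      obtain ⟨gs, out, h1, h2, h3⟩ := hf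
      refine ⟨gs, fun o => match o with
        | ⟨Sum.inl w, _⟩ => out w
        | ⟨Sum.inr w, h⟩ => by simp at h, h1, ?_, ?_⟩
      · rintro ⟨w | w, h⟩
        · exact h2 w
        · simp at h
      · rintro x ⟨w | w, h⟩
        · exact h3 x w
        · simp at h
    | false =>
      obtain ⟨gs, out, h1, h2, h3⟩ := hg
      refine ⟨gs, fun o => match o with
        | ⟨Sum.inr w, _⟩ => out w
        | ⟨Sum.inl w, h⟩ => by simp at h, h1, ?_, ?_⟩
      · rintro ⟨w | w, h⟩
        · simp at h
        · exact h2 w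
      · rintro x ⟨w | w, h⟩
        · simp at h
        · exact h3 x w

/-- Every output bit is a fixed function of three input bits. -/
theorem HasGates.bitwise {f : α → β} {φ : Bool × Bool × Bool → Bool} (hφ : HasGates s φ)
    (h : ∀ o, ∃ i j k, ∀ a, BitEnc.enc (f a) o =
      φ (BitEnc.enc a i, BitEnc.enc a j, BitEnc.enc a k)) :
    HasGates (wires β * (2 + s)) f := by
  have h0 : ∑ _j : BitEnc.Wire β, (2 + s) = wires β * (2 + s) := by simp
  rw [← h0]
  refine Gates.blocks (fun o : BitEnc.Wire β => o) fun o => ?_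
  obtain ⟨i, j, k, hijk⟩ := h o
  have h1 : Gates 2 (fun a : α => BitEnc.enc a)
      (fun a => BitEnc.enc (BitEnc.enc a i, BitEnc.enc a j, BitEnc.enc a k)) :=
    Gates.wiring fun o => Or.inl <| by
      rcases o with _ | _ | _
      · exact ⟨i, fun _ => rfl⟩
      · exact ⟨j, fun _ => rfl⟩
      · exact ⟨k, fun _ => rfl⟩
  have h2 := h1.comp (hφ.precomp fun a => (BitEnc.enc a i, BitEnc.enc a j, BitEnc.enc a k))
  obtain ⟨gs, out, h3, h4, h5⟩ := h2
  refine ⟨gs, fun _ => out (), h3, fun _ => h4 _, ?_⟩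
  rintro x ⟨o', rfl⟩
  rw [h5]
  exact (hijk x).symm

end

/-! ## Polynomial bounds for indexed families -/

/-- The index may carry more than the security parameter, for instance a round number or an advice
as in `Σ κ, Adv κ`. A single polynomial then serves all rounds and all advice, which is the
uniformity that the reductions need. -/
def PolyBd {I : Type} (n : I → ℕ) (s : I → ℕ) : Prop :=
  ∃ p : Polynomial ℕ, ∀ i, s i ≤ p.eval (n i)

section
variable {I I' : Type} {n s t : I → ℕ}

theorem PolyBd.mono (h : PolyBd n t) (hst : ∀ i, s i ≤ t i) : PolyBd n s := by
  obtain ⟨p, hp⟩ := h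
  exact ⟨p, fun i => (hst i).trans (hp i)⟩

theorem PolyBd.const (c : ℕ) : PolyBd n (fun _ => c) :=
  ⟨Polynomial.C c, fun i => by simp⟩

theorem PolyBd.add (hs : PolyBd n s) (ht : PolyBd n t) : PolyBd n (fun i => s i + t i) := by
  obtain ⟨p, hp⟩ := hs
  obtain ⟨q, hq⟩ := ht
  exact ⟨p + q, fun i => by rw [Polynomial.eval_add]; exact add_le_add (hp i) (hq i)⟩

theorem PolyBd.mul (hs : PolyBd n s) (ht : PolyBd n t) : PolyBd n (fun i => s i * t i) := by
  obtain ⟨p, hp⟩ := hs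
  obtain ⟨q, hq⟩ := ht
  exact ⟨p * q, fun i => by rw [Polynomial.eval_mul]; exact Nat.mul_le_mul (hp i) (hq i)⟩

theorem PolyBd.reindex (hs : PolyBd n s) (φ : I' → I) :
    PolyBd (fun j => n (φ j)) (fun j => s (φ j)) := by
  obtain ⟨p, hp⟩ := hs
  exact ⟨p, fun j => hp (φ j)⟩

theorem PolyBd.self : PolyBd n n := ⟨Polynomial.X, fun i => by simp⟩

end

/-- The encodings of the types `A i` have polynomial length in `n i`. -/
class PolyWires {I : Type} (n : I → ℕ) (A : I → Type) [∀ i, BitEnc (A i)] : Prop where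
  bd : PolyBd n (fun i => wires (A i))

theorem wires_prod (α β : Type) [BitEnc α] [BitEnc β] : wires (α × β) = wires α + wires β :=
  Fintype.card_sum

theorem wires_pi (ι α : Type) [Fintype ι] [BitEnc α] :
    wires (ι → α) = Fintype.card ι * wires α :=
  Fintype.card_prod ι (BitEnc.Wire α)

theorem wires_bool : wires Bool = 1 := rfl

theorem wires_zmod : wires (ZMod 2) = 1 := rfl

theorem wires_bits (n : ℕ) : wires (Bits n) = n := by
  rw [wires_pi, wires_bool, Fintype.card_fin, mul_one]

theorem wires_option (α : Type) [BitEnc α] : wires (Option α) = wires α + 1 :=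
  Fintype.card_option

section
variable {I : Type} {n : I → ℕ} {A B : I → Type} [∀ i, BitEnc (A i)] [∀ i, BitEnc (B i)]

instance PolyWires.prod [PolyWires n A] [PolyWires n B] : PolyWires n (fun i => A i × B i) where
  bd := (PolyWires.bd.add PolyWires.bd).mono fun _ => (wires_prod _ _).le

instance PolyWires.bool : PolyWires n (fun _ => Bool) where
  bd := PolyBd.const 1

instance PolyWires.finite {ι : Type} [Fintype ι] [PolyWires n A] :
    PolyWires n (fun i => ι → A i) where
  bd := ((PolyBd.const (Fintype.card ι)).mul PolyWires.bd).mono fun _ => (wires_pi _ _).le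

instance PolyWires.option [PolyWires n A] : PolyWires n (fun i => Option (A i)) where
  bd := (PolyWires.bd.add (PolyBd.const 1)).mono fun _ => (wires_option _).le

theorem PolyWires.pi {J : I → Type} [∀ i, Fintype (J i)]
    (hJ : PolyBd n fun i => Fintype.card (J i)) [PolyWires n A] :
    PolyWires n (fun i => J i → A i) where
  bd := (hJ.mul PolyWires.bd).mono fun _ => (wires_pi _ _).le

theorem PolyWires.bits {k : I → ℕ} (hk : PolyBd n k) : PolyWires n (fun i => Bits (k i)) where
  bd := hk.mono fun _ => (wires_bits _).le

theorem PolyWires.reindex {I' : Type} (h : PolyWires n A) (φ : I' → I) :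
    PolyWires (fun j => n (φ j)) (fun j => A (φ j)) where
  bd := h.bd.reindex φ

instance PolyWires.sigma {J : I → Type} [h : PolyWires n A] :
    PolyWires (fun x : Σ i, J i => n x.1) (fun x => A x.1) :=
  h.reindex Sigma.fst

end

/-! ## Families of functions with circuits of polynomial size -/

/-- The functions `f i` have circuits of polynomial size in `n i`. -/
def PolyCirc {I : Type} (n : I → ℕ) {A B : I → Type} [∀ i, BitEnc (A i)] [∀ i, BitEnc (B i)]
    (f : ∀ i, A i → B i) : Prop :=
  PolyWires n A ∧ PolyWires n B ∧ ∃ s, PolyBd n s ∧ ∀ i, HasGates (s i) (f i)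

section
variable {I I' : Type} {n : I → ℕ} {A B C D : I → Type} [∀ i, BitEnc (A i)] [∀ i, BitEnc (B i)]
  [∀ i, BitEnc (C i)] [∀ i, BitEnc (D i)]

theorem PolyCirc.left {f : ∀ i, A i → B i} (h : PolyCirc n f) : PolyWires n A := h.1

theorem PolyCirc.right {f : ∀ i, A i → B i} (h : PolyCirc n f) : PolyWires n B := h.2.1

theorem PolyCirc.of_hasCircuit {f : ∀ i, A i → B i}
    (h : ∃ p : Polynomial ℕ, ∀ i, HasCircuit (p.eval (n i)) (f i)) : PolyCirc n f := by
  obtain ⟨p, hp⟩ := h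
  have hb : PolyBd n fun i => p.eval (n i) := ⟨p, fun _ => le_rfl⟩
  exact ⟨⟨hb.mono fun i => (hp i).wires_left⟩, ⟨hb.mono fun i => (hp i).wires_right⟩,
    fun i => p.eval (n i) + 2, hb.add (PolyBd.const 2), fun i => (hp i).hasGates⟩

theorem PolyCirc.hasCircuit {f : ∀ i, A i → B i} (h : PolyCirc n f) :
    ∃ p : Polynomial ℕ, ∀ i, HasCircuit (p.eval (n i)) (f i) := by
  obtain ⟨⟨h1⟩, ⟨h2⟩, s, h3, h4⟩ := h
  obtain ⟨p, hp⟩ := (h1.add h2).add h3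
  exact ⟨p, fun i => (h4 i).hasCircuit (hp i)⟩

theorem PolyCirc.reindex {f : ∀ i, A i → B i} (h : PolyCirc n f) (φ : I' → I) :
    PolyCirc (fun j => n (φ j)) (fun j => f (φ j)) := by
  obtain ⟨⟨h1⟩, ⟨h2⟩, s, h3, h4⟩ := h
  exact ⟨⟨h1.reindex φ⟩, ⟨h2.reindex φ⟩, fun j => s (φ j), h3.reindex φ, fun j => h4 (φ j)⟩

theorem PolyCirc.congr {f g : ∀ i, A i → B i} (h : PolyCirc n f) (hfg : ∀ i a, g i a = f i a) :
    PolyCirc n g := by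
  have : g = f := funext fun i => funext (hfg i)
  rwa [this]

theorem PolyCirc.comp {g : ∀ i, B i → C i} {f : ∀ i, A i → B i} (hg : PolyCirc n g)
    (hf : PolyCirc n f) : PolyCirc n (fun i a => g i (f i a)) := by
  obtain ⟨h1, -, s, h3, h4⟩ := hf
  obtain ⟨-, h2', t, h3', h4'⟩ := hg
  exact ⟨h1, h2', _, h3.add h3', fun i => (h4' i).comp (h4 i)⟩

theorem PolyCirc.pair {f : ∀ i, A i → B i} {g : ∀ i, A i → C i} (hf : PolyCirc n f)
    (hg : PolyCirc n g) : PolyCirc n (fun i a => (f i a, g i a)) := by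
  obtain ⟨h1, h2, s, h3, h4⟩ := hf
  obtain ⟨-, h2', t, h3', h4'⟩ := hg
  exact ⟨h1, inferInstance, _, h3.add h3', fun i => (h4 i).prodMk (h4' i)⟩

theorem PolyCirc.wiring [hA : PolyWires n A] [hB : PolyWires n B] {f : ∀ i, A i → B i}
    (h : ∀ i o, (∃ w, ∀ a, BitEnc.enc (f i a) o = BitEnc.enc a w) ∨
      ∃ b, ∀ a, BitEnc.enc (f i a) o = b) : PolyCirc n f :=
  ⟨hA, hB, fun _ => 2, PolyBd.const 2, fun i => Gates.wiring (h i)⟩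

theorem PolyCirc.const [PolyWires n A] [PolyWires n B] (b : ∀ i, B i) :
    PolyCirc n (fun i (_ : A i) => b i) :=
  PolyCirc.wiring fun i o => Or.inr ⟨BitEnc.enc (b i) o, fun _ => rfl⟩

theorem PolyCirc.id [PolyWires n A] : PolyCirc n (fun i (a : A i) => a) :=
  PolyCirc.wiring fun _ o => Or.inl ⟨o, fun _ => rfl⟩

theorem PolyWires.of_prod_left [h : PolyWires n (fun i => A i × B i)] : PolyWires n A where
  bd := h.bd.mono fun _ => by rw [wires_prod]; exact Nat.le_add_right _ _

theorem PolyWires.of_prod_right [h : PolyWires n (fun i => A i × B i)] : PolyWires n B where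
  bd := h.bd.mono fun _ => by rw [wires_prod]; exact Nat.le_add_left _ _

theorem PolyCirc.fst {f : ∀ i, A i → B i × C i} (h : PolyCirc n f) :
    PolyCirc n (fun i a => (f i a).1) := by
  have := h.right
  have : PolyWires n B := PolyWires.of_prod_left (B := C)
  exact PolyCirc.comp (g := fun i (x : B i × C i) => x.1)
    (PolyCirc.wiring fun _ o => Or.inl ⟨Sum.inl o, fun _ => rfl⟩) h

theorem PolyCirc.snd {f : ∀ i, A i → B i × C i} (h : PolyCirc n f) :
    PolyCirc n (fun i a => (f i a).2) := by
  have := h.right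
  have : PolyWires n C := PolyWires.of_prod_right (A := B)
  exact PolyCirc.comp (g := fun i (x : B i × C i) => x.2)
    (PolyCirc.wiring fun _ o => Or.inl ⟨Sum.inr o, fun _ => rfl⟩) h

theorem PolyCirc.curryFst [PolyWires n A] [PolyWires n B] : PolyCirc n (fun i (x : A i × B i) => x.1) :=
  PolyCirc.id.fst

theorem PolyCirc.currySnd [PolyWires n A] [PolyWires n B] : PolyCirc n (fun i (x : A i × B i) => x.2) :=
  PolyCirc.id.snd

/-- A member of a family that is chosen by the index. -/
theorem PolyCirc.apply {J : I → Type} [∀ i, Fintype (J i)] {f : ∀ i, A i → J i → B i}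
    (h : PolyCirc n f) (j : ∀ i, J i) : PolyCirc n (fun i a => f i a (j i)) := by
  have h1 := h.right
  have : PolyWires n B := ⟨h1.bd.mono fun i => by
    rw [wires_pi]
    exact Nat.le_mul_of_pos_left _ (Fintype.card_pos_iff.2 ⟨j i⟩)⟩
  exact PolyCirc.comp (g := fun i (x : J i → B i) => x (j i))
    (PolyCirc.wiring fun i o => Or.inl ⟨(j i, o), fun _ => rfl⟩) h

theorem PolyCirc.pi {J : I → Type} [∀ i, Fintype (J i)] [PolyWires n A]
    (hJ : PolyBd n fun i => Fintype.card (J i)) {f : ∀ i, A i → J i → B i}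
    (h : PolyCirc (fun x : Σ i, J i => n x.1) (A := fun x => A x.1) (B := fun x => B x.1)
      (fun x a => f x.1 a x.2)) : PolyCirc n f := by
  obtain ⟨-, ⟨q, hq⟩, s, ⟨p, hp⟩, h2⟩ := h
  refine ⟨inferInstance, ⟨(hJ.mul (t := fun i => q.eval (n i)) ⟨q, fun _ => le_rfl⟩).mono ?_⟩,
    fun i => Fintype.card (J i) * p.eval (n i), hJ.mul ⟨p, fun _ => le_rfl⟩, ?_⟩
  · intro i
    rw [wires_pi]
    rcases isEmpty_or_nonempty (J i) with hi | ⟨⟨j⟩⟩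
    · simp
    · exact Nat.mul_le_mul_left _ (hq ⟨i, j⟩)
  · exact fun i => HasGates.pi fun j => (h2 ⟨i, j⟩).mono (hp ⟨i, j⟩)

/-- The separate polynomials for the members of `J` are replaced by their sum; this needs `J` to be
finite and the same for all indices. -/
theorem PolyCirc.of_forall {J : Type} [Finite J] {f : ∀ i, J → A i → B i}
    (h : ∀ j, PolyCirc n (fun i => f i j)) :
    PolyCirc (fun x : Σ _ : I, J => n x.1) (A := fun x => A x.1) (B := fun x => B x.1)
      (fun x => f x.1 x.2) := by
  have := Fintype.ofFinite J
  choose h1 h2 s h3 h4 using h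
  choose p hp using h3
  have key : ∀ (q : J → Polynomial ℕ) (x : Σ _ : I, J),
      (q x.2).eval (n x.1) ≤ (∑ j, q j).eval (n x.1) := by
    intro q x
    rw [Polynomial.eval_finsetSum]
    exact Finset.single_le_sum (f := fun j => (q j).eval (n x.1)) (fun _ _ => Nat.zero_le _)
      (Finset.mem_univ x.2)
  choose q1 hq1 using fun j => (h1 j).bd
  choose q2 hq2 using fun j => (h2 j).bd
  exact ⟨⟨⟨∑ j, q1 j, fun x => (hq1 x.2 x.1).trans (key q1 x)⟩⟩,
    ⟨⟨∑ j, q2 j, fun x => (hq2 x.2 x.1).trans (key q2 x)⟩⟩,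
    fun x => s x.2 x.1, ⟨∑ j, p j, fun x => (hp x.2 x.1).trans (key p x)⟩, fun x => h4 x.2 x.1⟩

theorem PolyCirc.piFinite {J : Type} [Fintype J] [PolyWires n A] {f : ∀ i, A i → J → B i}
    (h : ∀ j, PolyCirc n (fun i a => f i a j)) : PolyCirc n f :=
  PolyCirc.pi (J := fun _ => J) (PolyBd.const _)
    (PolyCirc.of_forall (f := fun i j a => f i a j) h)

/-! ### Boolean operations -/

theorem PolyCirc.nand {f g : ∀ i, A i → Bool} (hf : PolyCirc n f) (hg : PolyCirc n g) :
    PolyCirc n (fun i a => !(f i a && g i a)) :=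
  PolyCirc.comp (g := fun _ (x : Bool × Bool) => !(x.1 && x.2))
    ⟨inferInstance, inferInstance, _, PolyBd.const 1, fun _ => hasGates_nand⟩ (hf.pair hg)

theorem PolyCirc.not {f : ∀ i, A i → Bool} (hf : PolyCirc n f) :
    PolyCirc n (fun i a => !(f i a)) :=
  (hf.nand hf).congr fun i a => by simp

theorem PolyCirc.and {f g : ∀ i, A i → Bool} (hf : PolyCirc n f) (hg : PolyCirc n g) :
    PolyCirc n (fun i a => f i a && g i a) :=
  (hf.nand hg).not.congr fun i a => by simp

theorem PolyCirc.or {f g : ∀ i, A i → Bool} (hf : PolyCirc n f) (hg : PolyCirc n g) :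
    PolyCirc n (fun i a => f i a || g i a) :=
  (hf.not.nand hg.not).congr fun i a => by simp

theorem PolyCirc.xor {f g : ∀ i, A i → Bool} (hf : PolyCirc n f) (hg : PolyCirc n g) :
    PolyCirc n (fun i a => Bool.xor (f i a) (g i a)) :=
  ((hf.and hg.not).or (hf.not.and hg)).congr fun i a => by
    cases f i a <;> cases g i a <;> rfl

theorem PolyCirc.bitwise {f : ∀ i, A i → B i} [PolyWires n A] [hB : PolyWires n B]
    {φ : Bool × Bool × Bool → Bool} (hφ : PolyCirc (fun _ : Unit => 0) (fun _ => φ))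
    (h : ∀ i o, ∃ j k l, ∀ a, BitEnc.enc (f i a) o =
      φ (BitEnc.enc a j, BitEnc.enc a k, BitEnc.enc a l)) : PolyCirc n f := by
  obtain ⟨-, -, s, -, hs⟩ := hφ
  exact ⟨inferInstance, inferInstance, _, hB.bd.mul (PolyBd.const (2 + s ())),
    fun i => HasGates.bitwise (hs ()) (h i)⟩

end

/-- Addition is the exclusive or of the encodings. -/
class XorEnc (G : Type) [Add G] [BitEnc G] : Prop where
  enc_add : ∀ (a b : G) w, BitEnc.enc (a + b) w = Bool.xor (BitEnc.enc a w) (BitEnc.enc b w)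

instance : XorEnc (ZMod 2) where
  enc_add a b _ := by
    change decide (a + b = 1) = Bool.xor (decide (a = 1)) (decide (b = 1))
    revert a b
    decide

instance {ι G : Type} [Fintype ι] [Add G] [BitEnc G] [XorEnc G] : XorEnc (ι → G) where
  enc_add a b w := XorEnc.enc_add (a w.1) (b w.1) w.2

instance (P : Params) : XorEnc P.K where
  enc_add a b w := by
    change BitEnc.enc (fun i => P.basis.repr (show GaloisField 2 P.ell from a + b) i) w = _
    have : (fun i => P.basis.repr (show GaloisField 2 P.ell from a + b) i) =
        (fun i => P.basis.repr (show GaloisField 2 P.ell from a) i) +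
        (fun i => P.basis.repr (show GaloisField 2 P.ell from b) i) := by
      funext i
      exact DFunLike.congr_fun (map_add P.basis.repr (show GaloisField 2 P.ell from a)
        (show GaloisField 2 P.ell from b)) i
    rw [this]
    exact XorEnc.enc_add (G := Fin P.ell → ZMod 2) _ _ w

/-! ### Circuits for addition, conditionals and optional values -/

section
variable {I I' : Type} {n : I → ℕ} {A B C D : I → Type} [∀ i, BitEnc (A i)] [∀ i, BitEnc (B i)]
  [∀ i, BitEnc (C i)] [∀ i, BitEnc (D i)]

theorem PolyCirc.add [∀ i, Add (B i)] [∀ i, XorEnc (B i)] {f g : ∀ i, A i → B i}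
    (hf : PolyCirc n f) (hg : PolyCirc n g) : PolyCirc n (fun i a => f i a + g i a) := by
  have := hf.right
  refine PolyCirc.comp (g := fun i (x : B i × B i) => x.1 + x.2) ?_ (hf.pair hg)
  refine PolyCirc.bitwise (φ := fun x => Bool.xor x.1 x.2.1) (PolyCirc.id.fst.xor
    PolyCirc.id.snd.fst) ?_
  exact fun i o => ⟨Sum.inl o, Sum.inr o, Sum.inr o, fun a => XorEnc.enc_add _ _ _⟩

theorem PolyCirc.ite {c : ∀ i, A i → Bool} {f g : ∀ i, A i → B i} (hc : PolyCirc n c)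
    (hf : PolyCirc n f) (hg : PolyCirc n g) :
    PolyCirc n (fun i a => if c i a = true then f i a else g i a) := by
  have := hf.right
  refine PolyCirc.comp (g := fun i (x : Bool × B i × B i) => if x.1 = true then x.2.1 else x.2.2)
    ?_ (hc.pair (hf.pair hg))
  refine PolyCirc.bitwise (φ := fun x => (x.1 && x.2.1) || (!x.1 && x.2.2))
    ((PolyCirc.id.fst.and PolyCirc.id.snd.fst).or (PolyCirc.id.fst.not.and PolyCirc.id.snd.snd)) ?_
  refine fun i o => ⟨Sum.inl (), Sum.inr (Sum.inl o), Sum.inr (Sum.inr o), ?_⟩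
  rintro ⟨b, x, y⟩
  cases b
  · exact (Bool.false_or _).symm
  · exact (Bool.or_false _).symm

theorem PolyCirc.optionIsSome {f : ∀ i, A i → Option (B i)} (hf : PolyCirc n f) :
    PolyCirc n (fun i a => (f i a).isSome) := by
  have := hf.right
  refine PolyCirc.comp (g := fun i (x : Option (B i)) => x.isSome) ?_ hf
  exact PolyCirc.wiring fun i o => Or.inl ⟨none, fun a => by cases a <;> rfl⟩

theorem PolyWires.of_option [h : PolyWires n (fun i => Option (B i))] : PolyWires n B where
  bd := h.bd.mono fun _ => by rw [wires_option]; exact Nat.le_add_right _ _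

theorem PolyCirc.some {f : ∀ i, A i → B i} (hf : PolyCirc n f) :
    PolyCirc n (fun i a => some (f i a)) := by
  have := hf.right
  refine PolyCirc.comp (g := fun i (x : B i) => Option.some x) ?_ hf
  refine PolyCirc.wiring fun i o => ?_
  cases o with
  | none => exact Or.inr ⟨true, fun _ => rfl⟩
  | some w => exact Or.inl ⟨w, fun _ => rfl⟩

end

/-- Every bit string of the right length is an encoding. -/
class BitEncBij (α : Type) [BitEnc α] : Prop where
  surj : Function.Surjective (BitEnc.enc (α := α))

instance : BitEncBij Bool := ⟨fun x => ⟨x (), rfl⟩⟩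

instance : BitEncBij (ZMod 2) := ⟨fun x => ⟨if x () then 1 else 0, by
  funext w
  change decide ((if x () then (1 : ZMod 2) else 0) = 1) = x ()
  cases x () <;> rfl⟩⟩

instance {α β : Type} [BitEnc α] [BitEnc β] [BitEncBij α] [BitEncBij β] : BitEncBij (α × β) :=
  ⟨fun x => by
    obtain ⟨a, ha⟩ := BitEncBij.surj fun w => x (Sum.inl w)
    obtain ⟨b, hb⟩ := BitEncBij.surj fun w => x (Sum.inr w)
    refine ⟨(a, b), funext fun w => ?_⟩
    cases w with
    | inl w => exact congrFun ha w
    | inr w => exact congrFun hb w⟩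

instance {ι α : Type} [Fintype ι] [BitEnc α] [BitEncBij α] : BitEncBij (ι → α) :=
  ⟨fun x => by
    choose a ha using fun i => BitEncBij.surj (α := α) fun w => x (i, w)
    exact ⟨a, funext fun w => congrFun (ha w.1) w.2⟩⟩

instance (P : Params) : BitEncBij P.K := ⟨fun x => by
  obtain ⟨a, ha⟩ := BitEncBij.surj (α := Fin P.ell → ZMod 2) x
  refine ⟨(show P.K from P.basis.repr.symm (Finsupp.equivFunOnFinite.symm a)), ?_⟩
  rw [← ha]
  change BitEnc.enc (fun i => P.basis.repr (P.basis.repr.symm _) i) = _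
  simp⟩

/-- The value of the encoding, and an arbitrary one for `none`. -/
def optionVal {α : Type} [BitEnc α] [BitEncBij α] (o : Option α) : α :=
  o.getD (Classical.choose (BitEncBij.surj fun _ => false))

section
variable {I I' : Type} {n : I → ℕ} {A B C D : I → Type} [∀ i, BitEnc (A i)] [∀ i, BitEnc (B i)]
  [∀ i, BitEnc (C i)] [∀ i, BitEnc (D i)]

/-- All wires of `none` are `false`, and the default in `optionVal` is the element with the zero
encoding. With this choice the value wires are merely copied. -/
theorem PolyCirc.optionVal [∀ i, BitEncBij (B i)] {f : ∀ i, A i → Option (B i)}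
    (hf : PolyCirc n f) : PolyCirc n (fun i a => optionVal (f i a)) := by
  have := hf.right
  have : PolyWires n B := PolyWires.of_option
  refine PolyCirc.comp (g := fun i (x : Option (B i)) => ObliviousSelection.optionVal x) ?_ hf
  refine PolyCirc.wiring fun i o => Or.inl ⟨Option.some o, fun a => ?_⟩
  cases a with
  | none =>
    exact congrFun (Classical.choose_spec (BitEncBij.surj (α := B i) fun _ => false)) o
  | some a => rfl

theorem PolyCirc.optionElim [∀ i, BitEncBij (B i)] {o : ∀ i, A i → Option (B i)}
    {g : ∀ i, A i → C i} {f : ∀ i, A i → B i → C i} (ho : PolyCirc n o) (hg : PolyCirc n g)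
    (hf : PolyCirc n (fun i (x : A i × B i) => f i x.1 x.2)) :
    PolyCirc n (fun i a => (o i a).elim (g i a) (f i a)) := by
  have := ho.left
  have h := PolyCirc.ite ho.optionIsSome (hf.comp (PolyCirc.id.pair ho.optionVal)) hg
  refine h.congr fun i a => ?_
  cases h : o i a <;> simp [ObliviousSelection.optionVal]

/-! ### Iteration -/

theorem PolyCirc.foldl {J : I → Type} {l : ∀ i, List (J i)}
    (hl : PolyBd n fun i => (l i).length) {step : ∀ i, J i → B i × A i → B i}
    {init : ∀ i, A i → B i}
    (hstep : PolyCirc (fun x : Σ i, J i => n x.1) (A := fun x => B x.1 × A x.1)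
      (B := fun x => B x.1) (fun x => step x.1 x.2))
    (hinit : PolyCirc n init) :
    PolyCirc n (fun i a => (l i).foldl (fun b j => step i j (b, a)) (init i a)) := by
  obtain ⟨h1, h2, s, h3, h4⟩ := hinit
  obtain ⟨-, -, t, ⟨p, hp⟩, h5⟩ := hstep
  -- Every round costs its step circuit and two gates that pass on the input `a`.
  refine ⟨h1, h2, fun i => s i + (l i).length * (2 + p.eval (n i)),
    h3.add (hl.mul ((PolyBd.const 2).add ⟨p, fun _ => le_rfl⟩)), fun i => ?_⟩
  have key : ∀ l : List (J i), HasGates (s i + l.length * (2 + p.eval (n i)))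
      (fun a => l.foldl (fun b j => step i j (b, a)) (init i a)) := by
    intro l
    induction l using List.reverseRecOn with
    | nil => exact (h4 i).mono (Nat.le_add_right _ _)
    | append_singleton l j ih =>
      have hid : HasGates 2 (fun a : A i => a) := Gates.wiring fun o => Or.inl ⟨o, fun _ => rfl⟩
      have hj : HasGates (p.eval (n i)) (step i j) := (h5 ⟨i, j⟩).mono (hp ⟨i, j⟩)
      have := HasGates.comp hj (HasGates.prodMk ih hid)
      simp only [List.foldl_append, List.foldl_cons, List.foldl_nil, List.length_append,
        List.length_cons, List.length_nil]
      refine Gates.mono this ?_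
      rw [show (l.length + (0 + 1)) * (2 + p.eval (n i)) =
        l.length * (2 + p.eval (n i)) + (2 + p.eval (n i)) by ring]
      omega
  exact key (l i)

theorem PolyCirc.sum [∀ i, AddCommMonoid (B i)] [∀ i, XorEnc (B i)] {J : I → Type}
    [∀ i, Fintype (J i)] [PolyWires n A] [PolyWires n B]
    (hJ : PolyBd n fun i => Fintype.card (J i)) {f : ∀ i, A i → J i → B i}
    (h : PolyCirc (fun x : Σ i, J i => n x.1) (A := fun x => A x.1) (B := fun x => B x.1)
      (fun x a => f x.1 a x.2)) : PolyCirc n (fun i a => ∑ j, f i a j) := by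
  have := PolyCirc.foldl (l := fun i => (Finset.univ : Finset (J i)).toList)
    (hJ.mono fun i => by simp) (step := fun i j (x : B i × A i) => x.1 + f i x.2 j)
    (init := fun i _ => 0) ?_ (PolyCirc.const _)
  · refine this.congr fun i a => ?_
    rw [← Finset.sum_map_toList, ← List.foldl_map (f := fun j => f i a j) (g := (· + ·)),
      List.sum_eq_foldl]
  · exact PolyCirc.id.fst.add (h.comp (PolyCirc.id (A := fun x : Σ i, J i => B x.1 × A x.1)).snd)

theorem PolyCirc.all {J : I → Type} [∀ i, Fintype (J i)] [PolyWires n A]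
    (hJ : PolyBd n fun i => Fintype.card (J i)) {f : ∀ i, A i → J i → Bool}
    (h : PolyCirc (fun x : Σ i, J i => n x.1) (A := fun x => A x.1)
      (fun x a => f x.1 a x.2)) : PolyCirc n (fun i a => decide (∀ j, f i a j = true)) := by
  have := PolyCirc.foldl (l := fun i => (Finset.univ : Finset (J i)).toList)
    (hJ.mono fun i => by simp) (step := fun i j (x : Bool × A i) => x.1 && f i x.2 j)
    (init := fun i _ => true) ?_ (PolyCirc.const _)
  · refine this.congr fun i a => ?_
    have key : ∀ (l : List (J i)) (b : Bool), l.foldl (fun b j => b && f i a j) b =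
        (b && decide (∀ j ∈ l, f i a j = true)) := by
      intro l
      induction l with
      | nil => simp
      | cons j l ih =>
        intro b
        rw [List.foldl_cons, ih, Bool.eq_iff_iff]
        simp [and_assoc]
    rw [key]
    simp
  · exact PolyCirc.id.fst.and (h.comp (PolyCirc.id (A := fun x : Σ i, J i => Bool × A x.1)).snd)

theorem PolyCirc.decideEq {f g : ∀ i, A i → B i} (d : ∀ i a, Decidable (f i a = g i a))
    (hf : PolyCirc n f) (hg : PolyCirc n g) :
    PolyCirc n (fun i a => @decide (f i a = g i a) (d i a)) := by
  have := hf.left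
  have hB := hf.right
  have h : PolyCirc n (fun i a => decide (∀ w, (!(Bool.xor (BitEnc.enc (f i a) w)
      (BitEnc.enc (g i a) w))) = true)) := by
    refine PolyCirc.all (J := fun i => BitEnc.Wire (B i)) hB.bd
      (f := fun i a w => !(Bool.xor (BitEnc.enc (f i a) w) (BitEnc.enc (g i a) w))) ?_
    have key : PolyCirc (fun x : Σ i, BitEnc.Wire (B i) => n x.1) (A := fun x => B x.1)
        (fun x b => BitEnc.enc b x.2) :=
      PolyCirc.wiring fun x _ => Or.inl ⟨x.2, fun _ => rfl⟩
    exact ((key.comp (hf.reindex Sigma.fst)).xor (key.comp (hg.reindex Sigma.fst))).not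
  refine h.congr fun i a => ?_
  rw [decide_eq_decide]
  constructor
  · intro h w
    simp [h]
  · intro h
    apply BitEnc.enc_injective
    funext w
    simpa using h w

end

/-! ## Field arithmetic -/

instance (P : Params) : CharP P.K 2 := inferInstanceAs (CharP (GaloisField 2 P.ell) 2)

/-- A coordinate of a field element. -/
def Params.coef (P : Params) (a : P.K) (l : Fin P.ell) : Bool :=
  decide (P.basis.repr (show GaloisField 2 P.ell from a) l = 1)

def Params.vec (P : Params) (l : Fin P.ell) : P.K := show GaloisField 2 P.ell from P.basis l

theorem zmod_two_smul {M : Type} [AddCommGroup M] [Module (ZMod 2) M] (c : ZMod 2) (x : M) :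
    c • x = if decide (c = 1) = true then x else 0 := by
  have : c = 0 ∨ c = 1 := by revert c; decide
  rcases this with rfl | rfl <;> simp

theorem Params.sum_coef (P : Params) (a : P.K) :
    ∑ l, (if P.coef a l = true then P.vec l else 0) = a := by
  have h : ∑ l, P.basis.repr (show GaloisField 2 P.ell from a) l • P.basis l =
      (show GaloisField 2 P.ell from a) := P.basis.sum_repr _
  simp only [zmod_two_smul] at h
  exact h

theorem Params.emb_eq (P : Params) (j : P.Idx) :
    P.emb j = ∑ i, if decide (j i = 1) = true then P.vec (Fin.castLE P.ellm_le i) else 0 := by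
  have h : (∑ i, j i • P.basis (Fin.castLE P.ellm_le i) : GaloisField 2 P.ell) =
      ∑ i, if decide (j i = 1) = true then P.basis (Fin.castLE P.ellm_le i) else 0 :=
    Finset.sum_congr rfl fun i _ => zmod_two_smul _ _
  exact h

theorem Params.emb_add (P : Params) (j j' : P.Idx) : P.emb (j + j') = P.emb j + P.emb j' := by
  have h : (∑ i, (j + j') i • P.basis (Fin.castLE P.ellm_le i) : GaloisField 2 P.ell) =
      ∑ i, j i • P.basis (Fin.castLE P.ellm_le i) +
      ∑ i, j' i • P.basis (Fin.castLE P.ellm_le i) := by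
    rw [← Finset.sum_add_distrib]
    exact Finset.sum_congr rfl fun i _ => add_smul _ _ _
  exact h

/-- The padded index lists the coordinates with respect to a subfamily of a basis. Injectivity is
what turns the check `s = 0`, an equation in the field, into an equality of indices. -/
theorem Params.emb_injective (P : Params) : Function.Injective P.emb := by
  intro j j' h
  have hli := P.basis.linearIndependent.comp (Fin.castLE P.ellm_le) (Fin.castLE_injective _)
  rw [Fintype.linearIndependent_iff] at hli
  have h0 : ∑ i, (j - j') i • (P.basis ∘ Fin.castLE P.ellm_le) i = 0 := by
    have h' : (∑ i, j i • P.basis (Fin.castLE P.ellm_le i) : GaloisField 2 P.ell) =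
      ∑ i, j' i • P.basis (Fin.castLE P.ellm_le i) := h
    have : ∀ i, (j - j') i • (P.basis ∘ Fin.castLE P.ellm_le) i =
        j i • P.basis (Fin.castLE P.ellm_le i) - j' i • P.basis (Fin.castLE P.ellm_le i) :=
      fun i => sub_smul _ _ _
    rw [Finset.sum_congr rfl fun i _ => this i, Finset.sum_sub_distrib, h', sub_self]
  funext i
  exact sub_eq_zero.1 (hli _ h0 i)

section
variable {I : Type} {n : I → ℕ} {A : I → Type} [∀ i, BitEnc (A i)] {P : I → Params}

theorem PolyWires.field (hell : PolyBd n fun i => (P i).ell) : PolyWires n fun i => (P i).K where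
  bd := hell.mono fun i => by
    have : wires (P i).K = wires (Fin (P i).ell → ZMod 2) := rfl
    rw [this, wires_pi, wires_zmod, Fintype.card_fin, mul_one]

theorem PolyWires.idx (hell : PolyBd n fun i => (P i).ell) :
    PolyWires n fun i => (P i).Idx where
  bd := hell.mono fun i => by
    rw [wires_pi, wires_zmod, Fintype.card_fin, mul_one]
    exact (P i).ellm_le

theorem Params.card_idx (P : Params) : Fintype.card P.Idx = 2 ^ P.ellm := by
  simp [ZMod.card]

theorem PolyWires.table (hell : PolyBd n fun i => (P i).ell)
    (hm : PolyBd n fun i => 2 ^ (P i).ellm) : PolyWires n fun i => (P i).Idx → (P i).K := by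
  have := PolyWires.field hell
  exact PolyWires.pi (hm.mono fun i => (P i).card_idx.le)

theorem PolyCirc.sub {f g : ∀ i, A i → (P i).K} (hf : PolyCirc n f) (hg : PolyCirc n g) :
    PolyCirc n (fun i a => f i a - g i a) :=
  (hf.add hg).congr fun _ _ => CharTwo.sub_eq_add _ _

/-- Multiplication is bilinear over the field with two elements. The products of basis vectors are
constants wired into the circuit, which leaves a double sum over the coordinates. -/
theorem PolyCirc.mul (hell : PolyBd n fun i => (P i).ell) {f g : ∀ i, A i → (P i).K}
    (hf : PolyCirc n f) (hg : PolyCirc n g) : PolyCirc n (fun i a => f i a * g i a) := by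
  have := PolyWires.field hell
  have := this.reindex (Sigma.fst : (Σ i, Fin (P i).ell) → I)
  have := this.reindex (Sigma.fst : (Σ y : (Σ i, Fin (P i).ell), Fin (P y.1).ell) → _)
  have := hf.left
  have := this.reindex (Sigma.fst : (Σ i, Fin (P i).ell) → I)
  have := this.reindex (Sigma.fst : (Σ y : (Σ i, Fin (P i).ell), Fin (P y.1).ell) → _)
  have hcard : PolyBd n fun i => Fintype.card (Fin (P i).ell) := hell.mono fun i => by simp
  have hcoef : PolyCirc (fun x : Σ i, Fin (P i).ell => n x.1) (A := fun x => (P x.1).K)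
      (fun x b => (P x.1).coef b x.2) :=
    PolyCirc.wiring fun x _ => Or.inl ⟨(x.2, ()), fun _ => rfl⟩
  have h : PolyCirc n (fun i a => ∑ l, if (P i).coef (f i a) l = true then
      (∑ l', if (P i).coef (g i a) l' = true then (P i).vec l * (P i).vec l' else 0) else 0) := by
    refine PolyCirc.sum hcard ?_
    refine PolyCirc.ite (hcoef.comp (hf.reindex Sigma.fst)) ?_ (PolyCirc.const _)
    refine PolyCirc.sum (J := fun x : Σ i, Fin (P i).ell => Fin (P x.1).ell)
      (hcard.reindex Sigma.fst) ?_
    refine PolyCirc.ite ?_ (PolyCirc.const _) (PolyCirc.const _)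
    exact (hcoef.comp (hg.reindex Sigma.fst)).reindex
      (fun x : Σ y : (Σ i, Fin (P i).ell), Fin (P y.1).ell =>
        (⟨x.1.1, x.2⟩ : Σ i, Fin (P i).ell))
  refine h.congr fun i a => ?_
  conv_lhs => rw [← (P i).sum_coef (f i a), ← (P i).sum_coef (g i a)]
  rw [Finset.sum_mul]
  refine Finset.sum_congr rfl fun l _ => ?_
  rw [ite_mul, zero_mul, Finset.mul_sum]
  simp only [mul_ite, mul_zero]

theorem PolyCirc.emb (hell : PolyBd n fun i => (P i).ell) {f : ∀ i, A i → (P i).Idx}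
    (hf : PolyCirc n f) : PolyCirc n (fun i a => (P i).emb (f i a)) := by
  have := PolyWires.field hell
  have := this.reindex (Sigma.fst : (Σ i, Fin (P i).ellm) → I)
  have := hf.left
  have := this.reindex (Sigma.fst : (Σ i, Fin (P i).ellm) → I)
  have := hf.right.reindex (Sigma.fst : (Σ i, Fin (P i).ellm) → I)
  have hbit : PolyCirc (fun x : Σ i, Fin (P i).ellm => n x.1) (A := fun x => (P x.1).Idx)
      (fun x b => decide (b x.2 = 1)) :=
    PolyCirc.wiring fun x _ => Or.inl ⟨(x.2, ()), fun _ => rfl⟩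
  have h : PolyCirc n (fun i a => ∑ l, if decide (f i a l = 1) = true then
      (P i).vec (Fin.castLE (P i).ellm_le l) else 0) := by
    refine PolyCirc.sum (hell.mono fun i => by simpa using (P i).ellm_le) ?_
    exact PolyCirc.ite (hbit.comp (hf.reindex Sigma.fst)) (PolyCirc.const _) (PolyCirc.const _)
  exact h.congr fun i a => (P i).emb_eq _

/-- Table lookup. -/
theorem PolyCirc.lookup (hell : PolyBd n fun i => (P i).ell)
    (hm : PolyBd n fun i => 2 ^ (P i).ellm) {x : ∀ i, A i → (P i).Idx}
    {f : ∀ i, A i → (P i).Idx → (P i).K} (hx : PolyCirc n x)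
    (hf : PolyCirc (fun y : Σ i, (P i).Idx => n y.1) (A := fun y => A y.1)
      (fun y a => f y.1 a y.2)) : PolyCirc n (fun i a => f i a (x i a)) := by
  have := PolyWires.field hell
  have := this.reindex (Sigma.fst : (Σ i, (P i).Idx) → I)
  have := hx.left
  have := this.reindex (Sigma.fst : (Σ i, (P i).Idx) → I)
  have := hx.right.reindex (Sigma.fst : (Σ i, (P i).Idx) → I)
  -- There are only polynomially many indices, so the address may be compared with each of them.
  have h : PolyCirc n (fun i a => ∑ j, if decide (x i a = j) = true then f i a j else 0) := by
    refine PolyCirc.sum (hm.mono fun i => (P i).card_idx.le) ?_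
    refine PolyCirc.ite ?_ hf (PolyCirc.const _)
    exact PolyCirc.decideEq (fun (y : Σ i, (P i).Idx) (a : A y.1) => inferInstance)
      (hx.reindex Sigma.fst) (PolyCirc.const (A := fun y : Σ i, (P i).Idx => A y.1) _)
  refine h.congr fun i a => ?_
  simp

/-- The sum `∑ j, T j * v (j + Δ)`. -/
theorem PolyCirc.shiftedSum (hell : PolyBd n fun i => (P i).ell)
    (hm : PolyBd n fun i => 2 ^ (P i).ellm) {T v : ∀ i, A i → (P i).Idx → (P i).K}
    {x : ∀ i, A i → (P i).Idx} (hT : PolyCirc n T) (hv : PolyCirc n v) (hx : PolyCirc n x) :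
    PolyCirc n (fun i a => ∑ j, T i a j * v i a (j + x i a)) := by
  have := (PolyWires.field hell).reindex (Sigma.fst : (Σ i, (P i).Idx) → I)
  have := hx.left.reindex (Sigma.fst : (Σ i, (P i).Idx) → I)
  -- For a fixed shift `δ`, reading the table at `j + δ` is mere wiring. The sums for all shifts are
  -- computed and the lookup picks the right one.
  refine PolyCirc.lookup hell hm (f := fun i a δ => ∑ j, T i a j * v i a (j + δ)) hx ?_
  refine PolyCirc.sum (J := fun y : Σ i, (P i).Idx => (P y.1).Idx)
    ((hm.mono fun i => (P i).card_idx.le).reindex Sigma.fst) ?_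
  refine PolyCirc.mul ((hell.reindex Sigma.fst).reindex Sigma.fst) ?_ ?_
  · exact ((hT.reindex Sigma.fst).reindex Sigma.fst).apply
      (fun z : Σ y : (Σ i, (P i).Idx), (P y.1).Idx => z.2)
  · exact ((hv.reindex Sigma.fst).reindex Sigma.fst).apply
      (fun z : Σ y : (Σ i, (P i).Idx), (P y.1).Idx => z.2 + z.1.2)

end

/-! ## States as bit strings -/

/-- The encoding as a bijection with the bit strings of the right length. -/
def toBits (α : Type) [BitEnc α] [BitEncBij α] : α ≃ Bits (wires α) :=
  (Equiv.ofBijective BitEnc.enc ⟨BitEnc.enc_injective, BitEncBij.surj⟩).trans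
    ((Fintype.equivFin (BitEnc.Wire α)).arrowCongr (Equiv.refl Bool))

section
variable {I : Type} {n : I → ℕ} {A B : I → Type} [∀ i, BitEnc (A i)] [∀ i, BitEnc (B i)]
  [∀ i, BitEncBij (B i)]

theorem enc_toBits {α : Type} [BitEnc α] [BitEncBij α] (a : α) (w : BitEnc.Wire α) :
    toBits α a (Fintype.equivFin _ w) = BitEnc.enc a w := by
  simp [toBits, Equiv.arrowCongr]
  rfl

instance PolyWires.toBits [PolyWires n B] : PolyWires n fun i => Bits (wires (B i)) :=
  PolyWires.bits PolyWires.bd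

theorem PolyCirc.toBits {f : ∀ i, A i → B i} (hf : PolyCirc n f) :
    PolyCirc n (fun i a => ObliviousSelection.toBits (B i) (f i a)) := by
  have := hf.right
  refine PolyCirc.comp (g := fun i (b : B i) => ObliviousSelection.toBits (B i) b)
    (PolyCirc.wiring fun i o => Or.inl ⟨(Fintype.equivFin _).symm o.1, fun b => ?_⟩) hf
  rw [← enc_toBits b, Equiv.apply_symm_apply]
  rfl

theorem PolyCirc.ofBits [PolyWires n B] {f : ∀ i, A i → Bits (wires (B i))}
    (hf : PolyCirc n f) : PolyCirc n (fun i a => (ObliviousSelection.toBits (B i)).symm (f i a)) := by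
  refine PolyCirc.comp (g := fun i (b : Bits (wires (B i))) =>
    (ObliviousSelection.toBits (B i)).symm b)
    (PolyCirc.wiring fun i o => Or.inl ⟨(Fintype.equivFin _ o, ()), fun b => ?_⟩) hf
  rw [← enc_toBits, Equiv.apply_symm_apply]
  rfl

end

/-! ## Averages over finite sample spaces -/

def avg {Ω : Type} [Fintype Ω] (g : Ω → ℝ) : ℝ := (∑ ω, g ω) / (Fintype.card Ω : ℝ)

def ind (b : Bool) : ℝ := if b = true then 1 else 0

theorem ind_nonneg (b : Bool) : 0 ≤ ind b := by cases b <;> simp [ind]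

theorem ind_le_one (b : Bool) : ind b ≤ 1 := by cases b <;> simp [ind]

theorem prob_eq_avg {Ω : Type} [Fintype Ω] (p : Ω → Bool) : prob p = avg fun ω => ind (p ω) := by
  simp [prob, avg, ind, Finset.sum_boole]

section
variable {Ω Ω' A B : Type} [Fintype Ω] [Fintype Ω'] [Fintype A] [Fintype B]

theorem avg_equiv (e : Ω ≃ Ω') (g : Ω' → ℝ) : avg (fun ω => g (e ω)) = avg g := by
  rw [avg, avg, Fintype.card_congr e, e.sum_comp]

theorem avg_prod (g : A × B → ℝ) : avg g = avg fun a => avg fun b => g (a, b) := by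
  simp only [avg]
  rw [Fintype.sum_prod_type, Fintype.card_prod, Nat.cast_mul, ← Finset.sum_div, div_div, mul_comm]

theorem avg_comm (g : A → B → ℝ) :
    (avg fun a => avg fun b => g a b) = avg fun b => avg fun a => g a b := by
  rw [← avg_prod (fun x : A × B => g x.1 x.2), ← avg_prod (fun x : B × A => g x.2 x.1)]
  exact (avg_equiv (Equiv.prodComm B A) (fun x : A × B => g x.1 x.2)).symm

theorem avg_const [Nonempty Ω] (c : ℝ) : avg (fun _ : Ω => c) = c := by
  simp [avg]

theorem avg_mono {f g : Ω → ℝ} (h : ∀ ω, f ω ≤ g ω) : avg f ≤ avg g :=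
  div_le_div_of_nonneg_right (Finset.sum_le_sum fun ω _ => h ω) (Nat.cast_nonneg _)

theorem avg_sub (f g : Ω → ℝ) : (avg fun ω => f ω - g ω) = avg f - avg g := by
  simp only [avg, Finset.sum_sub_distrib, sub_div]

theorem avg_sum {J : Type} (s : Finset J) (f : J → Ω → ℝ) :
    (avg fun ω => ∑ j ∈ s, f j ω) = ∑ j ∈ s, avg (f j) := by
  simp only [avg]
  rw [Finset.sum_comm, Finset.sum_div]

theorem abs_avg_le (f : Ω → ℝ) : |avg f| ≤ avg fun ω => |f ω| := by
  rw [avg, avg, abs_div, Nat.abs_cast]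
  exact div_le_div_of_nonneg_right (Finset.abs_sum_le_sum_abs _ _) (Nat.cast_nonneg _)

theorem abs_avg_sub_le (f g : Ω → ℝ) : |avg f - avg g| ≤ avg fun ω => |f ω - g ω| := by
  rw [← avg_sub]
  exact abs_avg_le _

theorem avg_le_const [Nonempty Ω] {f : Ω → ℝ} {c : ℝ} (h : ∀ ω, f ω ≤ c) : avg f ≤ c :=
  (avg_mono h).trans (avg_const c).le

theorem avg_nonneg {f : Ω → ℝ} (h : ∀ ω, 0 ≤ f ω) : 0 ≤ avg f :=
  div_nonneg (Finset.sum_nonneg fun ω _ => h ω) (Nat.cast_nonneg _)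

theorem abs_avg_sub_le_const [Nonempty Ω] {f g : Ω → ℝ} {c : ℝ} (h : ∀ ω, |f ω - g ω| ≤ c) :
    |avg f - avg g| ≤ c :=
  (abs_avg_sub_le f g).trans (avg_le_const h)

theorem abs_avg_ind_sub_le_one [Nonempty A] [Nonempty B] (p : A → Bool) (q : B → Bool) :
    |(avg fun a => ind (p a)) - avg fun b => ind (q b)| ≤ 1 := by
  have h1 : (avg fun a => ind (p a)) ≤ 1 := avg_le_const fun a => ind_le_one _
  have h2 : (avg fun b => ind (q b)) ≤ 1 := avg_le_const fun a => ind_le_one _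
  have h3 : 0 ≤ (avg fun a => ind (p a)) := avg_nonneg fun a => ind_nonneg _
  have h4 : 0 ≤ (avg fun b => ind (q b)) := avg_nonneg fun a => ind_nonneg _
  rw [abs_le]
  constructor <;> linarith

theorem avg_fst [Nonempty B] (g : A → ℝ) : avg (fun x : A × B => g x.1) = avg g := by
  rw [avg_prod]
  simp only [avg_const]

theorem avg_snd [Nonempty A] (g : B → ℝ) : avg (fun x : A × B => g x.2) = avg g := by
  rw [avg_prod]
  simp only [avg_const]

end

/-- Restriction of a uniformly random function along an injective map. -/
theorem avg_comp_injective {I J X : Type} [Fintype I] [Fintype X] [Nonempty X] [Fintype (I → X)]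
    [Fintype (J → X)] (e : J → I) (he : Function.Injective e) (g : (J → X) → ℝ) :
    avg (fun x : I → X => g (fun j => x (e j))) = avg g := by
  classical
  let e1 : (I → X) ≃ (({i // i ∈ Set.range e} → X) × ({i // i ∉ Set.range e} → X)) :=
    Equiv.piEquivPiSubtypeProd (fun i => i ∈ Set.range e) (fun _ => X)
  let e2 : ({i // i ∈ Set.range e} → X) ≃ (J → X) :=
    Equiv.arrowCongr (Equiv.ofInjective e he).symm (Equiv.refl X)
  have h := avg_equiv (e1.trans (e2.prodCongr (Equiv.refl _))) (fun y => g y.1)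
  rw [avg_fst] at h
  rw [← h]
  rfl

/-- Resampling one coordinate. -/
theorem avg_update {J X : Type} [DecidableEq J] [Fintype J] [Fintype X] [Nonempty X]
    [Fintype (J → X)] (j : J) (g : (J → X) → ℝ) :
    (avg fun x : J → X => avg fun y : X => g (Function.update x j y)) = avg g := by
  rw [← avg_prod (fun z : (J → X) × X => g (Function.update z.1 j z.2))]
  -- Exchanging the coordinate with the fresh value is an involution of the sample space.
  let e : (J → X) × X ≃ (J → X) × X :=
    { toFun := fun z => (Function.update z.1 j z.2, z.1 j)
      invFun := fun z => (Function.update z.1 j z.2, z.1 j)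
      left_inv := fun z => by simp
      right_inv := fun z => by simp }
  have h := avg_equiv e (fun z => g z.1)
  rw [avg_fst] at h
  exact h

/-- Adaptive change of variables in a sequential experiment. -/
theorem avg_foldl_bijective {n : ℕ} {X S : Type} [Fintype X] (step : Fin n → S → X → S)
    (φ : Fin n → S → X → X) (hφ : ∀ k s, Function.Bijective (φ k s)) (g : S → ℝ) (s : S) :
    (avg fun x : Fin n → X =>
      g ((List.finRange n).foldl (fun s k => step k s (φ k s (x k))) s)) =
      avg fun x : Fin n → X => g ((List.finRange n).foldl (fun s k => step k s (x k)) s) := by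
  induction n generalizing s with
  | zero => simp
  | succ n ih =>
    have h : ∀ st : Fin (n + 1) → S → X → S,
        (avg fun x : Fin (n + 1) → X =>
          g ((List.finRange (n + 1)).foldl (fun s k => st k s (x k)) s)) =
        avg fun y : X => avg fun x : Fin n → X =>
          g ((List.finRange n).foldl (fun s k => st k.succ s (x k)) (st 0 s y)) := by
      intro st
      have he := avg_equiv (Fin.consEquiv fun _ : Fin (n + 1) => X) (fun x : Fin (n + 1) → X =>
        g ((List.finRange (n + 1)).foldl (fun s k => st k s (x k)) s))
      rw [← he, avg_prod]
      refine congrArg avg (funext fun y => congrArg avg (funext fun x => ?_))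
      rw [List.finRange_succ, List.foldl_cons, List.foldl_map]
      rfl
    -- Only the first coordinate is treated here: at a given state, `φ 0 s` permutes its values. The
    -- later permutations depend on the state reached and are removed by the induction hypothesis at
    -- that state.
    refine (h (fun k s y => step k s (φ k s y))).trans (Eq.trans ?_ (h step).symm)
    refine Eq.trans (congrArg avg (funext fun y => ih (fun k => step k.succ)
      (fun k => φ k.succ) (fun k => hφ k.succ) (step 0 s (φ 0 s y)))) ?_
    have h0 : Function.Bijective (φ 0 s) := hφ 0 s
    generalize φ 0 s = ψ at h0
    let G : X → ℝ := fun y => avg fun x : Fin n → X =>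
      g ((List.finRange n).foldl (fun s k => step k.succ s (x k)) (step 0 s y))
    have h4 : avg (fun y => G (ψ y)) = avg G := avg_equiv (Equiv.ofBijective ψ h0) G
    exact h4

/-! ## Negligible functions -/

theorem Negligible.mono {f g : ℕ → ℝ} (hg : Negligible g)
    (h : ∀ᶠ κ in Filter.atTop, |f κ| ≤ |g κ|) : Negligible f :=
  Asymptotics.SuperpolynomialDecay.trans_eventually_abs_le hg h

theorem Negligible.add {f g : ℕ → ℝ} (hf : Negligible f) (hg : Negligible g) :
    Negligible fun κ => f κ + g κ :=
  Asymptotics.SuperpolynomialDecay.add hf hg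

theorem Negligible.const_mul {f : ℕ → ℝ} (hf : Negligible f) (c : ℝ) :
    Negligible fun κ => c * f κ :=
  Asymptotics.SuperpolynomialDecay.const_mul hf c

theorem Negligible.poly_mul {f : ℕ → ℝ} (hf : Negligible f) {s : ℕ → ℕ} (hs : PolyBounded s) :
    Negligible fun κ => (s κ : ℝ) * f κ := by
  obtain ⟨p, hp⟩ := hs
  have h := Asymptotics.SuperpolynomialDecay.polynomial_mul hf (p.map (Nat.castRingHom ℝ))
  refine Negligible.mono h (Filter.Eventually.of_forall fun κ => ?_)
  rw [abs_mul, abs_mul]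
  refine mul_le_mul_of_nonneg_right ?_ (abs_nonneg _)
  have : Polynomial.eval (κ : ℝ) (p.map (Nat.castRingHom ℝ)) = ((p.eval κ : ℕ) : ℝ) := by
    rw [Polynomial.eval_natCast_map]
    rfl
  rw [this, Nat.abs_cast, Nat.abs_cast]
  exact_mod_cast hp κ

/-- If every choice of advice gives a negligible value, then the values are bounded by one
negligible function. -/
theorem exists_negligible_bound {Adv : ℕ → Type} {f : ∀ κ, Adv κ → ℝ}
    (h0 : ∀ κ a, 0 ≤ f κ a) (h1 : ∀ κ a, f κ a ≤ 1)
    (H : ∀ a : ∀ κ, Option (Adv κ), Negligible fun κ => (a κ).elim 0 (f κ)) :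
    ∃ ν : ℕ → ℝ, Negligible ν ∧ (∀ κ, 0 ≤ ν κ) ∧ ∀ κ a, f κ a ≤ ν κ := by
  -- The supremum over the advice need not be attained, so an advice that reaches half of it is
  -- chosen; this is the origin of the factor 2. The value `none` stands for the case that there is
  -- no advice at all.
  have key : ∀ κ, ∃ a : Option (Adv κ), ∀ a', f κ a' ≤ 2 * a.elim 0 (f κ) := by
    intro κ
    rcases isEmpty_or_nonempty (Adv κ) with he | he
    · exact ⟨none, fun a' => he.elim a'⟩
    · have hbdd : BddAbove (Set.range (f κ)) := ⟨1, by rintro _ ⟨a, rfl⟩; exact h1 κ a⟩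
      by_cases hs : (⨆ a, f κ a) ≤ 0
      · refine ⟨some he.some, fun a' => ?_⟩
        have := (le_ciSup hbdd a').trans hs
        have := h0 κ he.some
        simp only [Option.elim_some]
        linarith
      · obtain ⟨a, ha⟩ := exists_lt_of_lt_ciSup (f := f κ) (b := (⨆ a, f κ a) / 2) (by
          push Not at hs
          linarith)
        refine ⟨some a, fun a' => ?_⟩
        have := le_ciSup hbdd a'
        simp only [Option.elim_some]
        linarith
  choose a ha using key
  refine ⟨fun κ => 2 * (a κ).elim 0 (f κ), (H a).const_mul 2, fun κ => ?_, ha⟩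
  refine mul_nonneg zero_le_two ?_
  cases a κ with
  | none => exact le_rfl
  | some x => exact h0 κ x

/-- The members of an indexed family that are chosen by an advice. -/
theorem PolyCirc.ofOption {Adv : ℕ → Type} {A B : ℕ → Type} [∀ κ, BitEnc (A κ)]
    [∀ κ, BitEnc (B κ)] {D : ∀ x : Σ κ, Adv κ, A x.1 → B x.1} {d : ∀ κ, A κ → B κ}
    (hD : PolyCirc (fun x : Σ κ, Adv κ => x.1) (A := fun x => A x.1) (B := fun x => B x.1) D)
    (hd : PolyCirc (fun κ => κ) d) (a : ∀ κ, Option (Adv κ)) :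
    PolyTime fun κ => (a κ).elim (d κ) fun x => D ⟨κ, x⟩ := by
  obtain ⟨p, hp⟩ := hD.hasCircuit
  obtain ⟨q, hq⟩ := hd.hasCircuit
  refine ⟨p + q, fun κ => ?_⟩
  have hmono : ∀ {s t : ℕ} {f : A κ → B κ}, HasCircuit s f → s ≤ t → HasCircuit t f :=
    fun ⟨C, h1, h2⟩ hst => ⟨C, h1.trans hst, h2⟩
  rw [Polynomial.eval_add]
  change HasCircuit _ ((a κ).elim (d κ) fun x => D ⟨κ, x⟩)
  cases a κ with
  | none => exact hmono (hq κ) (Nat.le_add_left _ _)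
  | some x => exact hmono (hp ⟨κ, x⟩) (Nat.le_add_right _ _)

/-! ## Uniform versions of the security notions -/

section
variable {P : ℕ → Params} {V : ∀ κ, VDPF (P κ)}

/-- The key and the proof that one evaluator gets from an honest dealer and the other evaluator. -/
def VDPF.view {P : Params} (V : VDPF P) (pp : V.PP) (b : Fin 2) (α : P.Idx) (x : V.Coins) :
    V.Key × V.Proof :=
  (V.gen pp α 1 x b, V.proof pp (1 - b) (V.gen pp α 1 x (1 - b)))

theorem vdpf_correct_bound (hV : VDPFCorrect V) : ∃ ν : ℕ → ℝ, Negligible ν ∧ (∀ κ, 0 ≤ ν κ) ∧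
    ∀ κ α, (avg fun pp : (V κ).PP => avg fun x : (V κ).Coins =>
      open Classical in ind (decide (¬ ((V κ).Shares pp ((V κ).gen pp α 1 x) α 1 ∧
        (V κ).Accepts pp ((V κ).gen pp α 1 x))))) ≤ ν κ := by
  classical
  obtain ⟨ν, h1, h2, h3⟩ := exists_negligible_bound (Adv := fun κ => (P κ).Idx)
    (f := fun κ α => avg fun pp : (V κ).PP => avg fun x : (V κ).Coins =>
      ind (decide (¬ ((V κ).Shares pp ((V κ).gen pp α 1 x) α 1 ∧
        (V κ).Accepts pp ((V κ).gen pp α 1 x)))))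
    (fun κ α => avg_nonneg fun _ => avg_nonneg fun _ => ind_nonneg _)
    (fun κ α => avg_le_const fun _ => avg_le_const fun _ => ind_le_one _) (fun a => by
      have h := hV (fun κ => (a κ).getD 0) (fun κ => 1)
      refine h.mono (Filter.Eventually.of_forall fun κ => ?_)
      cases ha : a κ with
      | none => simp
      | some α =>
        refine le_of_eq ?_
        rw [prob_eq_avg, avg_prod]
        congr 1)
  refine ⟨ν, h1, h2, fun κ α => ?_⟩
  exact h3 κ α

/-- Privacy is assumed for one sequence of points and one distinguisher. Both may depend on the
advice here, because a non-uniform distinguisher can have the worst advice built in. -/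
theorem vdpf_private_bound {b : Fin 2} {r : ℕ → ℕ}
    {sim : ∀ κ, (V κ).PP × Bits (r κ) → (V κ).Key × (V κ).Proof}
    (hsim : ∀ (α : ∀ κ, (P κ).Idx) (β : ∀ κ, (P κ).K)
      (D : ∀ κ, (V κ).PP × (V κ).Key × (V κ).Proof → Bool), PolyTime D →
      Negligible fun κ =>
        |prob (fun ω : (V κ).PP × (V κ).Coins =>
            D κ (ω.1, (V κ).gen ω.1 (α κ) (β κ) ω.2 b,
              (V κ).proof ω.1 (1 - b) ((V κ).gen ω.1 (α κ) (β κ) ω.2 (1 - b)))) -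
          prob (fun ω : (V κ).PP × Bits (r κ) => D κ (ω.1, sim κ ω))|)
    {Adv : ℕ → Type} (α : ∀ κ, Adv κ → (P κ).Idx)
    (D : ∀ x : Σ κ, Adv κ, (V x.1).PP × (V x.1).Key × (V x.1).Proof → Bool)
    (hD : PolyCirc (fun x : Σ κ, Adv κ => x.1)
      (A := fun x => (V x.1).PP × (V x.1).Key × (V x.1).Proof) (B := fun _ => Bool) D)
    (hw : PolyWires (fun κ => κ) fun κ => (V κ).PP × (V κ).Key × (V κ).Proof) :
    ∃ ν : ℕ → ℝ, Negligible ν ∧ (∀ κ, 0 ≤ ν κ) ∧ ∀ κ a,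
      |(avg fun pp : (V κ).PP => avg fun x : (V κ).Coins =>
          ind (D ⟨κ, a⟩ (pp, (V κ).view pp b (α κ a) x))) -
        avg fun pp : (V κ).PP => avg fun x : Bits (r κ) => ind (D ⟨κ, a⟩ (pp, sim κ (pp, x)))|
        ≤ ν κ := by
  refine exists_negligible_bound (fun κ a => abs_nonneg _) (fun κ a => ?_) (fun a => ?_)
  · rw [← avg_prod (fun z : (V κ).PP × (V κ).Coins =>
      ind (D ⟨κ, a⟩ (z.1, (V κ).view z.1 b (α κ a) z.2))),
      ← avg_prod (fun z : (V κ).PP × Bits (r κ) => ind (D ⟨κ, a⟩ (z.1, sim κ (z.1, z.2))))]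
    exact abs_avg_ind_sub_le_one _ _
  · have h := hsim (fun κ => (a κ).elim 0 (α κ)) (fun κ => 1)
      (fun κ => (a κ).elim (fun _ => false) fun x => D ⟨κ, x⟩)
      (hD.ofOption (PolyCirc.const (n := fun κ => κ)
        (A := fun κ => (V κ).PP × (V κ).Key × (V κ).Proof) fun _ => false) a)
    refine h.mono (Filter.Eventually.of_forall fun κ => ?_)
    cases ha : a κ with
    | none => simp
    | some x =>
      refine le_of_eq ?_
      rw [prob_eq_avg, prob_eq_avg, avg_prod, avg_prod, abs_abs]
      simp only [Option.elim_some, abs_abs]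
      rfl

/-- The key maker may depend on any advice as long as the public string remains its only random
input. -/
theorem vdpf_verifiable_bound (hV : VDPFVerifiable V) {Adv : ℕ → Type}
    (A : ∀ x : Σ κ, Adv κ, (V x.1).PP → Fin 2 → (V x.1).Key)
    (hA : PolyCirc (fun x : Σ κ, Adv κ => x.1) (A := fun x => (V x.1).PP)
      (B := fun x => Fin 2 → (V x.1).Key) A)
    (hw : PolyWires (fun κ => κ) fun κ => (V κ).PP)
    (hw' : PolyWires (fun κ => κ) fun κ => (V κ).Key) :
    ∃ ν : ℕ → ℝ, Negligible ν ∧ (∀ κ, 0 ≤ ν κ) ∧ ∀ κ a,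
      (avg fun pp : (V κ).PP => open Classical in
        ind (decide ((V κ).Accepts pp (A ⟨κ, a⟩ pp) ∧
          ¬ ∃ α β, (V κ).Shares pp (A ⟨κ, a⟩ pp) α β))) ≤ ν κ := by
  classical
  refine exists_negligible_bound (fun κ a => avg_nonneg fun _ => ind_nonneg _)
    (fun κ a => avg_le_const fun _ => ind_le_one _) (fun a => ?_)
  have h := hV (fun κ => (a κ).elim (fun _ _ _ => false) fun x => A ⟨κ, x⟩)
    (hA.ofOption (PolyCirc.const (n := fun κ => κ) (A := fun κ => (V κ).PP)
      (B := fun κ => Fin 2 → (V κ).Key) fun _ _ _ => false) a)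
  refine h.mono (Filter.Eventually.of_forall fun κ => ?_)
  cases ha : a κ with
  | none => simp
  | some x =>
    refine le_of_eq ?_
    rw [prob_eq_avg]
    simp only [Option.elim_some]
    congr!

end

/-- The experiment with a sequence of steps that may abort, where each step gets a value. -/
def oracleRun {m : ℕ} {S Y : Type} (step : Fin m → S × Y → S × Bool) (dec : S × Bool → Bool)
    (s : S) (y : Fin m → Y) : Bool :=
  dec (runSteps m (fun k st => step k (st, y k)) s)

/-- The oracle adversary keeps the state of the experiment together with its abort flag and asks for
the value at `sid k` in round `k`. Injectivity of the session identifiers makes the answers of a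
random function independent and uniform. It is a premise at each `κ`, since it is available only for
large `κ`. -/
theorem prf_bound {Y : ℕ → Type} [∀ κ, BitEnc (Y κ)] [∀ κ, Fintype (Y κ)] [∀ κ, Nonempty (Y κ)]
    {F : ∀ κ, Bits κ → Bits κ → Y κ} (hF : IsSecurePRF F)
    {m : ℕ → ℕ} (hm : PolyBounded m) (sid : ∀ κ, Fin (m κ) → Bits κ)
    {Adv : ℕ → Type} {len : (Σ κ, Adv κ) → ℕ}
    {step : ∀ x : Σ κ, Adv κ, Fin (m x.1) → Bits (len x) × Y x.1 → Bits (len x) × Bool}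
    {dec : ∀ x : Σ κ, Adv κ, Bits (len x) × Bool → Bool}
    (start : ∀ x : Σ κ, Adv κ, Bits (len x))
    (hstep : PolyCirc (fun z : Σ x : (Σ κ, Adv κ), Fin (m x.1) => z.1.1)
      (A := fun z => Bits (len z.1) × Y z.1.1) (B := fun z => Bits (len z.1) × Bool)
      (fun z => step z.1 z.2))
    (hdec : PolyCirc (fun x : Σ κ, Adv κ => x.1) (A := fun x => Bits (len x) × Bool)
      (B := fun _ => Bool) dec) :
    ∃ ν : ℕ → ℝ, Negligible ν ∧ (∀ κ, 0 ≤ ν κ) ∧ ∀ κ a, Function.Injective (sid κ) →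
      |(avg fun key : Bits κ => ind (oracleRun (step ⟨κ, a⟩) (dec ⟨κ, a⟩) (start ⟨κ, a⟩)
          fun k => F κ key (sid κ k))) -
        avg fun y : Fin (m κ) → Y κ => ind (oracleRun (step ⟨κ, a⟩) (dec ⟨κ, a⟩) (start ⟨κ, a⟩) y)|
        ≤ ν κ := by
  have hY : PolyWires (fun κ => κ) Y := by
    have h := (PolyCirc.of_hasCircuit (n := fun κ => κ) hF.1).right
    exact h
  have hbits : PolyWires (fun κ => κ) Bits := PolyWires.bits PolyBd.self
  let SB : (Σ κ, Adv κ) → Type := fun x => Bits (len x) × Bool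
  let adv : ∀ x : Σ κ, Adv κ, OracleAdversary (Bits x.1) (Y x.1) := fun x =>
    { queries := m x.1
      stateLen := wires (SB x)
      start := toBits (SB x) (start x, true)
      query := fun k _ => sid x.1 k
      update := fun k st => toBits (SB x)
        (if ((toBits (SB x)).symm st.1).2 = true
          then step x k (((toBits (SB x)).symm st.1).1, st.2) else (toBits (SB x)).symm st.1)
      guess := fun st => dec x ((toBits (SB x)).symm st) }
  have hrun : ∀ x (f : Bits x.1 → Y x.1), (adv x).run f =
      oracleRun (step x) (dec x) (start x) fun k => f (sid x.1 k) := by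
    intro x f
    have key : ∀ (l : List (Fin (m x.1))) (st : SB x),
        l.foldl (fun st k => (adv x).update k (st, f ((adv x).query k st))) (toBits (SB x) st) =
        toBits (SB x) (l.foldl (fun a k => if a.2 = true then step x k (a.1, f (sid x.1 k)) else a)
          st) := by
      intro l
      induction l with
      | nil => intro st; rfl
      | cons k l ih =>
        intro st
        rw [List.foldl_cons, List.foldl_cons, ← ih]
        congr 1
        simp only [adv, Equiv.symm_apply_apply]
    simp only [OracleAdversary.run, oracleRun, runSteps]
    have := key (List.finRange (m x.1)) (start x, true)
    simp only [adv] at this ⊢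
    rw [this, Equiv.symm_apply_apply]
  have hb1 : PolyWires (fun x : Σ κ, Adv κ => x.1) SB := hdec.left
  have hb2 : PolyCirc (fun z : Σ x : (Σ κ, Adv κ), Fin (m x.1) => z.1.1)
      (A := fun z => Bits (adv z.1).stateLen) (B := fun z => Bits z.1.1)
      (fun z => (adv z.1).query z.2) := by
    have h1 : PolyWires (fun z : Σ x : (Σ κ, Adv κ), Fin (m x.1) => z.1.1)
        (fun z => Bits (wires (SB z.1))) := PolyWires.bits (hb1.bd.reindex Sigma.fst)
    have h2 : PolyWires (fun z : Σ x : (Σ κ, Adv κ), Fin (m x.1) => z.1.1)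
        (fun z => Bits z.1.1) := PolyWires.bits PolyBd.self
    exact PolyCirc.const (A := fun z : Σ x : (Σ κ, Adv κ), Fin (m x.1) => Bits (wires (SB z.1)))
      (B := fun z => Bits z.1.1) _
  have hb3 : PolyCirc (fun z : Σ x : (Σ κ, Adv κ), Fin (m x.1) => z.1.1)
      (A := fun z => Bits (adv z.1).stateLen × Y z.1.1) (B := fun z => Bits (adv z.1).stateLen)
      (fun z => (adv z.1).update z.2) := by
    have h1 : PolyWires (fun z : Σ x : (Σ κ, Adv κ), Fin (m x.1) => z.1.1)
        (fun z => SB z.1) := ⟨hb1.bd.reindex Sigma.fst⟩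
    have h3 : PolyWires (fun z : Σ x : (Σ κ, Adv κ), Fin (m x.1) => z.1.1)
        (fun z => Y z.1.1) := hY.reindex fun z : Σ x : (Σ κ, Adv κ), Fin (m x.1) => z.1.1
    have h2 := PolyCirc.ofBits (B := fun z : Σ x : (Σ κ, Adv κ), Fin (m x.1) => SB z.1)
      (PolyCirc.curryFst (n := fun z : Σ x : (Σ κ, Adv κ), Fin (m x.1) => z.1.1)
        (A := fun z => Bits (wires (SB z.1))) (B := fun z => Y z.1.1))
    exact (PolyCirc.ite h2.snd (hstep.comp (h2.fst.pair PolyCirc.currySnd)) h2).toBits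
  have hb4 : PolyCirc (fun x : Σ κ, Adv κ => x.1)
      (A := fun x => Bits (adv x).stateLen) (B := fun _ => Bool) (fun x => (adv x).guess) :=
    hdec.comp (PolyCirc.ofBits (B := SB) (PolyCirc.id (A := fun x => Bits (wires (SB x)))))
  obtain ⟨p0, hp0⟩ := hm
  obtain ⟨p1, hp1⟩ := hb2.hasCircuit
  obtain ⟨p2, hp2⟩ := hb3.hasCircuit
  obtain ⟨p3, hp3⟩ := hb4.hasCircuit
  have hmono : ∀ {α β : Type} [BitEnc α] [BitEnc β] {s t : ℕ} {f : α → β}, HasCircuit s f →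
      s ≤ t → HasCircuit t f := fun ⟨C, h1, h2⟩ hst => ⟨C, h1.trans hst, h2⟩
  have hbound : ∀ x, (adv x).Bounded ((p0 + p1 + p2 + p3).eval x.1) := by
    intro x
    simp only [Polynomial.eval_add]
    exact ⟨(hp0 x.1).trans (by omega), fun k => hmono (hp1 ⟨x, k⟩) (by simp only; omega),
      fun k => hmono (hp2 ⟨x, k⟩) (by simp only; omega), hmono (hp3 x) (by omega)⟩
  have h := exists_negligible_bound (Adv := Adv) (f := fun κ a =>
      |(avg fun key : Bits κ => ind ((adv ⟨κ, a⟩).run (F κ key))) -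
        avg fun f : Bits κ → Y κ => ind ((adv ⟨κ, a⟩).run f)|)
    (fun κ a => abs_nonneg _) (fun κ a => abs_avg_ind_sub_le_one _ _) (fun a => by
      -- Stands in where no advice is chosen. Its guess is a constant, computed with two gates and
      -- one output wire, hence the size 3.
      let trivialAdv : ∀ κ, OracleAdversary (Bits κ) (Y κ) := fun κ =>
        ⟨0, 0, fun i => i.elim0, fun k => k.elim0, fun k => k.elim0, fun _ => false⟩
      have htriv : HasCircuit 3 (fun _ : Bits 0 => false) := by
        refine HasGates.hasCircuit (s := 2) (Gates.wiring fun o => Or.inr ⟨false, fun _ => rfl⟩) ?_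
        rw [wires_bits, wires_bool]
      have h := hF.2 (fun κ => (a κ).elim (trivialAdv κ) fun x => adv ⟨κ, x⟩)
        ⟨p0 + p1 + p2 + p3 + Polynomial.C 3, fun κ => ?_⟩
      · refine h.mono (Filter.Eventually.of_forall fun κ => ?_)
        cases ha : a κ with
        | none => simp
        | some x =>
          refine le_of_eq ?_
          rw [prob_eq_avg, prob_eq_avg]
          simp only [Option.elim_some, abs_abs]
      · rw [Polynomial.eval_add, Polynomial.eval_C]
        cases a κ with
        | none =>
          exact ⟨Nat.zero_le _, fun k => k.elim0, fun k => k.elim0,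
            hmono htriv (Nat.le_add_left _ _)⟩
        | some x =>
          obtain ⟨h1, h2, h3, h4⟩ := hbound ⟨κ, x⟩
          exact ⟨h1.trans (Nat.le_add_right _ _), fun k => hmono (h2 k) (Nat.le_add_right _ _),
            fun k => hmono (h3 k) (Nat.le_add_right _ _), hmono h4 (Nat.le_add_right _ _)⟩)
  obtain ⟨ν, h1, h2, h3⟩ := h
  refine ⟨ν, h1, h2, fun κ a hinj => ?_⟩
  have h4 := h3 κ a
  simp only [hrun] at h4
  rwa [avg_comp_injective (sid κ) hinj (fun y => ind (oracleRun (step ⟨κ, a⟩) (dec ⟨κ, a⟩)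
    (start ⟨κ, a⟩) y))] at h4

/-! ## Identities for the three pairs -/

/-- The three pairs as seen from the corrupted party: the two in which it is an evaluator with role
0 or 1, and the pair `c + 1` for which it is the dealer. -/
theorem forall_pairs (c : Fin 3) (Q : Fin 3 → Prop) :
    (∀ i, Q i) ↔ Q (pairOf c 0) ∧ Q (pairOf c 1) ∧ Q (c + 1) := by
  rw [Fin.forall_fin_succ, Fin.forall_fin_two]
  fin_cases c <;> simp [pairOf] <;> tauto

theorem sum_parties {G : Type} [AddCommMonoid G] (c : Fin 3) (f : Fin 3 → G) :
    ∑ p, f p = f c + f (c + 1) + f (c - 1) := by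
  rw [Fin.sum_univ_three]
  fin_cases c
  · rfl
  · change f 0 + f 1 + f 2 = f 1 + f 2 + f 0
    abel
  · change f 0 + f 1 + f 2 = f 2 + f 0 + f 1
    abel

theorem evaluator_pairOf (c : Fin 3) (b b' : Fin 2) : evaluator (pairOf c b) b' = c ↔ b' = b := by
  revert c b b'
  decide

theorem evaluator_succ_ne (c : Fin 3) (b : Fin 2) : evaluator (c + 1) b ≠ c := by
  revert c b
  decide

theorem pairOf_ne (c : Fin 3) (b : Fin 2) : pairOf c b ≠ c + 1 := by
  revert c b
  decide

theorem pred_party (c : Fin 3) : c + 2 = c - 1 := by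
  revert c
  decide

theorem pred_party_ne (c : Fin 3) : c - 1 ≠ c := by
  revert c
  decide

theorem succ_party_ne (c : Fin 3) : c + 1 ≠ c := by
  revert c
  decide

theorem succ_party_ne_pred (c : Fin 3) : c + 1 ≠ c - 1 := by
  revert c
  decide

theorem succ_pred_party (c : Fin 3) : c + 1 - 1 = c := by
  revert c
  decide

theorem pred_pred_party (c : Fin 3) : c - 1 - 1 = c + 1 := by
  revert c
  decide

theorem pairOf_zero (c : Fin 3) : pairOf c 0 = c := by
  revert c
  decide

theorem pairOf_one (c : Fin 3) : pairOf c 1 = c - 1 := by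
  revert c
  decide

theorem pairOf_injective (c : Fin 3) : Function.Injective (pairOf c) := by
  revert c
  decide

theorem idx_add_self {P : Params} (x : P.Idx) : x + x = 0 := by
  funext i
  exact CharTwo.add_self_eq_zero (x i)

section
variable {κ : ℕ} {P : Params} {V : VDPF P}

/-- Two parties hold all three shares of a replicated sharing, so the result does not depend on
which party is left out. -/
theorem reconstruct_deltaRSS (c i : Fin 3) (d : Fin 2 → V.Deal) (idx : Fin 3 → P.Idx) :
    reconstruct c (deltaRSS V i d idx) = (d 0).2 + (d 1).2 + ∑ p, idx p := by
  have h1 : idx c + idx (c + 1) + idx (c + 2) = ∑ p, idx p := by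
    rw [sum_parties c, ← pred_party]
  have h2 : (dealtRSS i (fun b => (d b).2) (c + 1)).2 + (dealtRSS i (fun b => (d b).2) (c + 1)).1 +
      (dealtRSS i (fun b => (d b).2) (c + 2)).1 = (d 0).2 + (d 1).2 := by
    fin_cases c <;> fin_cases i <;> simp [dealtRSS, add_comm]
  rw [← h1, ← h2]
  simp only [reconstruct, deltaRSS, rssPair, Prod.fst_add, Prod.snd_add, succ_pred_party]
  abel

/-- The dealt keys share the unit point function at the index whose shares were dealt. -/
def VDPF.GoodPair (V : VDPF P) (pp : V.PP) (d : Fin 2 → V.Deal) : Prop :=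
  V.Shares pp (fun b => (d b).1) ((d 0).2 + (d 1).2) 1

/-- The unit vector at `rdx`, read at `j + (rdx + s)`, is nonzero exactly at `j = s`, because every
index is its own negative. -/
theorem VDPF.GoodPair.selectShare_add {pp : V.PP} {d : Fin 2 → V.Deal} (h : V.GoodPair pp d)
    (T : P.Idx → P.K) (s : P.Idx) :
    V.selectShare pp 0 (d 0).1 T ((d 0).2 + (d 1).2 + s) +
      V.selectShare pp 1 (d 1).1 T ((d 0).2 + (d 1).2 + s) = T s := by
  simp only [VDPF.selectShare]
  rw [← Finset.sum_add_distrib]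
  have key : ∀ j, T j * V.eval pp 0 (d 0).1 (j + ((d 0).2 + (d 1).2 + s)) +
      T j * V.eval pp 1 (d 1).1 (j + ((d 0).2 + (d 1).2 + s)) = if j = s then T j else 0 := by
    intro j
    have h1 : V.eval pp 0 (d 0).1 (j + ((d 0).2 + (d 1).2 + s)) +
      V.eval pp 1 (d 1).1 (j + ((d 0).2 + (d 1).2 + s)) =
      if j + ((d 0).2 + (d 1).2 + s) = (d 0).2 + (d 1).2 then 1 else 0 := h _
    have h2 : j + ((d 0).2 + (d 1).2 + s) = (d 0).2 + (d 1).2 ↔ j = s := by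
      generalize (d 0).2 + (d 1).2 = ρ
      constructor
      · intro h
        have h3 : j + s + ρ = 0 + ρ := by
          rw [zero_add]
          refine Eq.trans ?_ h
          abel
        have h4 : j + s = 0 := add_right_cancel h3
        calc j = j + (s + s) := by rw [idx_add_self, add_zero]
          _ = (j + s) + s := by abel
          _ = s := by rw [h4, zero_add]
      · rintro rfl
        calc j + (ρ + j) = ρ + (j + j) := by abel
          _ = ρ := by rw [idx_add_self, add_zero]
    rw [← mul_add, h1]
    simp only [h2, mul_ite, mul_one, mul_zero]
  simp only [key, Finset.sum_ite_eq', Finset.mem_univ, if_true]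

/-- Each mask occurs once with each sign and cancels; what remains are the two evaluations of each
pair. -/
theorem reshareMsg_sum {pp : V.PP} {d : Fin 3 → Fin 2 → V.Deal} (h : ∀ i, V.GoodPair pp (d i))
    (T : Fin 3 → P.Idx → P.K) (s : P.Idx) (mask : Fin 3 → P.K) :
    ∑ p, V.reshareMsg pp d T (fun i => (d i 0).2 + (d i 1).2 + s) mask p = ∑ i, T i s := by
  rw [← Finset.sum_congr rfl fun i _ => (h i).selectShare_add (T i) s]
  simp only [Fin.sum_univ_three, VDPF.reshareMsg]
  have h1 : (0 : Fin 3) - 1 = 2 := rfl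
  have h2 : (1 : Fin 3) - 1 = 0 := rfl
  have h3 : (2 : Fin 3) - 1 = 1 := rfl
  rw [h1, h2, h3]
  ring

theorem checkShares_add {pp : V.PP} {d : Fin 2 → V.Deal} {α : P.Idx} {β : P.K}
    (h : V.Shares pp (fun b => (d b).1) α β) :
    V.checkShares pp 0 (d 0) + V.checkShares pp 1 (d 1) =
      (β, P.emb ((d 0).2 + (d 1).2) - P.emb α * β) := by
  have h' : ∀ x, V.eval pp 0 (d 0).1 x + V.eval pp 1 (d 1).1 x = if x = α then β else 0 := h
  refine Prod.ext ?_ ?_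
  · simp only [VDPF.checkShares, Prod.fst_add, ← Finset.sum_add_distrib, h',
      Finset.sum_ite_eq', Finset.mem_univ, if_true]
  · simp only [VDPF.checkShares, Prod.snd_add, P.emb_add]
    rw [sub_add_sub_comm, ← Finset.sum_add_distrib]
    simp only [← mul_add, h', mul_ite, mul_zero, Finset.sum_ite_eq', Finset.mem_univ, if_true]

/-- For a point function with value `β` at `α` the opened sums are `β` and `emb rdx - emb α * β`.
The first check gives `β = 1`, and the second then gives `rdx = α` by `P.emb_injective`.
Verifiability alone would leave both `α` and `β` free. -/
theorem goodPair_of_checks {pp : V.PP} {d : Fin 2 → V.Deal}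
    (h : ∃ α β, V.Shares pp (fun b => (d b).1) α β)
    (hc : V.checkShares pp 0 (d 0) + V.checkShares pp 1 (d 1) = (1, 0)) : V.GoodPair pp d := by
  obtain ⟨α, β, h⟩ := h
  rw [checkShares_add h, Prod.mk.injEq] at hc
  obtain ⟨rfl, h2⟩ := hc
  rw [mul_one, sub_eq_zero] at h2
  rw [VDPF.GoodPair, P.emb_injective h2]
  exact h

theorem GoodPair_checks {pp : V.PP} {d : Fin 2 → V.Deal} (h : V.GoodPair pp d) :
    V.checkShares pp 0 (d 0) + V.checkShares pp 1 (d 1) = (1, 0) := by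
  rw [checkShares_add h, mul_one, sub_self]

theorem honestDeal_goodPair {pp : V.PP} {ω : P.Idx × P.Idx × V.Coins}
    (h : V.Shares pp (V.gen pp ω.1 1 ω.2.2) ω.1 1) : V.GoodPair pp (V.honestDeal pp ω) := by
  have : (V.honestDeal pp ω 0).2 + (V.honestDeal pp ω 1).2 = ω.1 := by
    simp [VDPF.honestDeal]
  rw [VDPF.GoodPair, this]
  exact h

/-! ## The execution in terms of the view of the corrupted party -/

/-- The check of the proofs, given what the corrupted party received in its roles (`kp`), what it
dealt (`d`), and the proofs that it sent. -/
def VDPF.proofCheck (V : VDPF P) (pp : V.PP) (kp : Fin 2 → V.Key × V.Proof) (d : Fin 2 → V.Deal)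
    (π : Fin 2 → V.Proof) : Bool :=
  V.verify pp (π 0) (kp 0).2 && (V.verify pp (kp 1).2 (π 1) &&
    V.verify pp (V.proof pp 0 (d 0).1) (V.proof pp 1 (d 1).1))

/-- The shares of the opened values that the corrupted party should send. -/
def VDPF.ownShares (V : VDPF P) (pp : V.PP) (kp : Fin 2 → V.Key × V.Proof) (rb : Fin 2 → P.Idx)
    (b : Fin 2) : P.K × P.K :=
  V.checkShares pp b ((kp b).1, rb b)

/-- The shares of the opened values of the other evaluators. -/
def VDPF.otherShares (V : VDPF P) (pp : V.PP) (kp : Fin 2 → V.Key × V.Proof) (rb : Fin 2 → P.Idx)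
    (b : Fin 2) : P.K × P.K :=
  (1 - (V.ownShares pp kp rb b).1, 0 - (V.ownShares pp kp rb b).2)

-- In the two pairs with an honest dealer the checks pass exactly if the corrupted party sends its
-- correct shares, since the partner's shares complete them to `(1, 0)`. In the pair that it dealt,
-- both evaluators are honest and the sums are computed from `d`.
open Classical in
def VDPF.openCheck (V : VDPF P) (pp : V.PP) (kp : Fin 2 → V.Key × V.Proof) (rb : Fin 2 → P.Idx)
    (d : Fin 2 → V.Deal) (o : Fin 2 → P.K × P.K) : Bool :=
  decide (o = V.ownShares pp kp rb) &&
    decide ((((V.checkShares pp 0 (d 0)).1 + (V.checkShares pp 1 (d 1)).1,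
      (V.checkShares pp 0 (d 0)).2 + (V.checkShares pp 1 (d 1)).2) : P.K × P.K) = (1, 0))

/-- The preprocessing for one selection. -/
def hybPre (E : Environment κ V) (pp : V.PP) (kp : Fin P.runs → Fin 2 → V.Key × V.Proof)
    (rb : Fin P.runs → Fin 2 → P.Idx) (k : Fin P.runs) (st : Bits E.stateLen) :
    Bits E.stateLen × Bool :=
  (E.deal k (st, fun b => ((kp k b).1, rb k b))).2.elim
    ((E.deal k (st, fun b => ((kp k b).1, rb k b))).1, false) fun d =>
  (E.prove k ((E.deal k (st, fun b => ((kp k b).1, rb k b))).1, fun b => (kp k b).2)).2.elim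
    ((E.prove k ((E.deal k (st, fun b => ((kp k b).1, rb k b))).1, fun b => (kp k b).2)).1,
      false) fun π =>
  if V.proofCheck pp (kp k) d π = true then
    (E.opening k ((E.prove k ((E.deal k (st, fun b => ((kp k b).1, rb k b))).1,
      fun b => (kp k b).2)).1, V.otherShares pp (kp k) (rb k))).2.elim
    ((E.opening k ((E.prove k ((E.deal k (st, fun b => ((kp k b).1, rb k b))).1,
      fun b => (kp k b).2)).1, V.otherShares pp (kp k) (rb k))).1, false) fun o =>
    ((E.opening k ((E.prove k ((E.deal k (st, fun b => ((kp k b).1, rb k b))).1,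
      fun b => (kp k b).2)).1, V.otherShares pp (kp k) (rb k))).1,
      V.openCheck pp (kp k) (rb k) d o)
  else ((E.prove k ((E.deal k (st, fun b => ((kp k b).1, rb k b))).1, fun b => (kp k b).2)).1,
    false)

/-- The resharing message that the corrupted party should send. -/
def VDPF.ownMsg (V : VDPF P) (pp : V.PP) (kp : Fin 2 → V.Key × V.Proof) (mk : P.K)
    (T : Fin 2 → P.Idx → P.K) (Δ : Fin 2 → P.Idx) : P.K :=
  V.selectShare pp 0 (kp 0).1 (T 0) (Δ 0) + V.selectShare pp 1 (kp 1).1 (T 1) (Δ 1) + mk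

/-- The end of a selection. -/
def finishSelect (E : Environment κ V) (c : Fin 3) (k : Fin P.runs) (T : Fin 3 → P.Idx → P.K)
    (idx : Fin 3 → P.Idx) (own r : P.K) (w : Bits E.stateLen × P.K × (Fin 2 → Bool)) :
    Bits E.stateLen × Bool :=
  (E.output k (w.1, ![
      if w.2.2 0 = true then
        some (rssPair (osShares c T idx r (w.2.1 - own) w.2.1) (c + 1)) else none,
      if w.2.2 1 = true then
        some (rssPair (osShares c T idx r (w.2.1 - own) w.2.1) (c + 2)) else none]),
    w.2.2 0 && w.2.2 1)

/-- One selection, where `src` makes the reconstructed values from the index and `r` is the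
message from party `c - 1`. -/
def hybSelect (E : Environment κ V) (c : Fin 3) (pp : V.PP)
    (kp : Fin P.runs → Fin 2 → V.Key × V.Proof) (mk : Fin P.runs → P.K)
    (src : P.Idx → Fin 2 → P.Idx) (r : P.K) (k : Fin P.runs)
    (st : Bits E.stateLen) : Bits E.stateLen × Bool :=
  let x := E.input k st
  let Δ := src (∑ p, x.2.2 p)
  let y := E.recon k (x.1, Δ)
  if y.2 = true then
    finishSelect E c k x.2.1 x.2.2
      (V.ownMsg pp (kp k) (mk k) (fun b => x.2.1 (pairOf c b)) Δ) r (E.reshare k (y.1, r))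
  else (y.1, false)

/-- The common form of the intermediate experiments. The honest parties' secrets enter only through
what the corrupted party receives, through `src`, and through the final shares. In the real case
`src` adds a dealt index to the selected one; in the simulated case it ignores the latter. -/
def hybRun (E : Environment κ V) (c : Fin 3) (pp : V.PP) (key key' : Bits κ)
    (kp : Fin P.runs → Fin 2 → V.Key × V.Proof) (rb : Fin P.runs → Fin 2 → P.Idx)
    (mk : Fin P.runs → P.K) (src : Fin P.runs → P.Idx → Fin 2 → P.Idx)
    (r : Fin P.runs → P.K) (ec : Bits E.coinLen) : Bool :=
  if (runSteps P.runs (hybPre E pp kp rb) (E.setup (ec, pp, key, key'))).2 = true then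
    E.decision (runSteps P.runs (fun k => hybSelect E c pp kp mk (src k) (r k) k)
      (runSteps P.runs (hybPre E pp kp rb) (E.setup (ec, pp, key, key'))).1)
  else E.decision ((runSteps P.runs (hybPre E pp kp rb) (E.setup (ec, pp, key, key'))).1, false)

/-! ## The real execution -/

/-- The messages of the honest parties in a selection, as a function of the masks. -/
def reshareOf (E : Environment κ V) (pp : V.PP) (d : Fin 3 → Fin 2 → V.Deal)
    (mask : Fin 3 → P.K) (k : Fin P.runs) (st : Bits E.stateLen) (p : Fin 3) : P.K :=
  V.reshareMsg pp d (E.input k st).2.1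
    (fun i => (d i 0).2 + (d i 1).2 + ∑ p, (E.input k st).2.2 p) mask p

/-- A selection of the real execution with arbitrary masks. -/
def maskedSelect (E : Environment κ V) (c : Fin 3) (pp : V.PP) (d : Fin 3 → Fin 2 → V.Deal)
    (mask : Fin 3 → P.K) (k : Fin P.runs) (st : Bits E.stateLen) : Bits E.stateLen × Bool :=
  let x := E.input k st
  let y := E.recon k (x.1, fun b => (d (pairOf c b) 0).2 + (d (pairOf c b) 1).2 + ∑ p, x.2.2 p)
  let z := reshareOf E pp d mask k st
  if y.2 = true then
    let w := E.reshare k (y.1, z (c - 1))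
    (E.output k (w.1, ![
        if w.2.2 0 = true then some (z (c + 1), w.2.1) else none,
        if w.2.2 1 = true then some (z (c + 2), z (c + 1)) else none]),
      w.2.2 0 && w.2.2 1)
  else (y.1, false)

theorem realSelect_eq (F : Bits κ → Bits κ → P.K) (sid : Fin P.runs → Bits κ)
    (E : Environment κ V) (c : Fin 3) (ω : RealCoins κ V) (store : Store V) (k : Fin P.runs)
    (st : Bits E.stateLen) : realSelect F sid E c ω store k st =
      maskedSelect E c ω.1 (store k) (fun p => F (ω.2.1 p) (sid k)) k st := by
  unfold realSelect maskedSelect reshareOf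
  rcases E.input k st with ⟨st1, T, idx⟩
  simp only [reconstruct_deltaRSS]
  rcases E.recon k (st1, fun b => (store k (pairOf c b) 0).2 + (store k (pairOf c b) 1).2 +
    ∑ p, idx p) with ⟨st2, _ | _⟩
  · rfl
  · rfl

/-- As all pairs are good, the three messages add up to the selected entry, so `z (c + 1)` is
determined by `z c` and `z (c - 1)`. The functionality produces the same shares when `z (c - 1)` is
its random share and the error is the sent message minus the correct message `z c`. -/
theorem maskedSelect_eq_hybSelect {E : Environment κ V} {c : Fin 3} {pp : V.PP}
    {d : Fin 3 → Fin 2 → V.Deal} {mask : Fin 3 → P.K} {k : Fin P.runs} {st : Bits E.stateLen}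
    {kp : Fin P.runs → Fin 2 → V.Key × V.Proof} {mk : Fin P.runs → P.K}
    {src : P.Idx → Fin 2 → P.Idx} (hd : ∀ i, V.GoodPair pp (d i))
    (hkp : ∀ b, (kp k b).1 = (d (pairOf c b) b).1) (hmk : mk k = mask c - mask (c - 1))
    (hsrc : ∀ s b, src s b = (d (pairOf c b) 0).2 + (d (pairOf c b) 1).2 + s) :
    maskedSelect E c pp d mask k st =
      hybSelect E c pp kp mk src (reshareOf E pp d mask k st (c - 1)) k st := by
  have hsrc' : src (∑ p, (E.input k st).2.2 p) = fun b =>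
      (d (pairOf c b) 0).2 + (d (pairOf c b) 1).2 + ∑ p, (E.input k st).2.2 p :=
    funext fun b => hsrc _ b
  have hsum : reshareOf E pp d mask k st (c + 1) =
      selected (E.input k st).2.1 (E.input k st).2.2 - reshareOf E pp d mask k st c -
        reshareOf E pp d mask k st (c - 1) := by
    have h1 := reshareMsg_sum hd (E.input k st).2.1 (∑ p, (E.input k st).2.2 p) mask
    have h2 := sum_parties c (reshareOf E pp d mask k st)
    rw [selected, ← h1]
    change _ = ∑ p, reshareOf E pp d mask k st p - _ - _
    rw [h2]
    ring
  have hown : V.ownMsg pp (kp k) (mk k) (fun b => (E.input k st).2.1 (pairOf c b))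
      (src (∑ p, (E.input k st).2.2 p)) = reshareOf E pp d mask k st c := by
    rw [hsrc', VDPF.ownMsg, hkp, hkp, hmk, reshareOf, VDPF.reshareMsg]
    rw [pairOf_zero, pairOf_one]
    ring
  have hc2 := pred_party c
  have hne := pred_party_ne c
  have hne1 := succ_party_ne c
  have hne2 := succ_party_ne_pred c
  have hc3 := succ_pred_party c
  have hc4 := pred_pred_party c
  -- The sent message `x` cancels: it enters the error with a plus and the remaining share with a
  -- minus, so the share of the honest party `c + 1` is unaffected.
  have he : ∀ x : P.K, selected (E.input k st).2.1 (E.input k st).2.2 +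
      (x - reshareOf E pp d mask k st c) - x - reshareOf E pp d mask k st (c - 1) =
      reshareOf E pp d mask k st (c + 1) := by
    intro x
    rw [hsum]
    ring
  simp only [maskedSelect, hybSelect, hown]
  rw [hsrc']
  refine if_congr Iff.rfl ?_ rfl
  simp only [finishSelect, rssPair, osShares, hc2, hc3, hc4, hne, hne1, hne2, if_true, if_false, he]

set_option maxHeartbeats 800000 in
open Classical in
theorem realPreprocess_eq {E : Environment κ V} {c : Fin 3} {ω : RealCoins κ V} {k : Fin P.runs}
    {kp : Fin P.runs → Fin 2 → V.Key × V.Proof} {rb : Fin P.runs → Fin 2 → P.Idx}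
    (hkp : ∀ b, kp k b = V.view ω.1 b (ω.2.2 k (pairOf c b)).1 (ω.2.2 k (pairOf c b)).2.2)
    (hrb : ∀ b, rb k b = (V.honestDeal ω.1 (ω.2.2 k (pairOf c b)) b).2)
    (hgood : ∀ b, V.Shares ω.1 (V.gen ω.1 (ω.2.2 k (pairOf c b)).1 1 (ω.2.2 k (pairOf c b)).2.2)
      (ω.2.2 k (pairOf c b)).1 1)
    (st : Bits E.stateLen) (store : Store V)
    (hver : ∀ d, (E.deal k (st, fun b => ((kp k b).1, rb k b))).2 = some d →
      V.Accepts ω.1 (fun b => (d b).1) → ∃ α β, V.Shares ω.1 (fun b => (d b).1) α β) :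
    ∃ d : Fin 3 → Fin 2 → V.Deal,
      ((hybPre E ω.1 kp rb k st).2 = true → ∀ i, V.GoodPair ω.1 (d i)) ∧
      (∀ i, i ≠ c + 1 → d i = V.honestDeal ω.1 (ω.2.2 k i)) ∧
      realPreprocess E c ω k (st, store) = (((hybPre E ω.1 kp rb k st).1,
        if (hybPre E ω.1 kp rb k st).2 = true then Function.update store k d else store),
        (hybPre E ω.1 kp rb k st).2) := by
  obtain ⟨pp, keys, dc⟩ := ω
  simp only at hkp hrb hgood hver ⊢
  have hmsg : (fun b => ((kp k b).1, rb k b)) =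
      fun b => V.honestDeal pp (dc k (pairOf c b)) b := by
    funext b
    rw [hkp, hrb]
    rfl
  have hpg : ∀ b, V.GoodPair pp (V.honestDeal pp (dc k (pairOf c b))) :=
    fun b => honestDeal_goodPair (hgood b)
  unfold realPreprocess hybPre
  simp only [hmsg] at hver ⊢
  rcases hdeal : E.deal k (st, fun b => V.honestDeal pp (dc k (pairOf c b)) b) with ⟨st1, _ | bad⟩
  -- The corrupted party dealt nothing, so its pair may be filled arbitrarily; the store is not
  -- updated.
  · refine ⟨fun i => V.honestDeal pp (dc k i), ?_, fun i _ => rfl, ?_⟩ <;> simp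
  rw [hdeal] at hver
  simp only [Option.elim_some]
  set d : Fin 3 → Fin 2 → V.Deal := fun i => if i = c + 1 then bad else V.honestDeal pp (dc k i)
    with hd
  have hdp : ∀ b, d (pairOf c b) = V.honestDeal pp (dc k (pairOf c b)) := fun b => by
    simp [hd, pairOf_ne]
  have hdc : d (c + 1) = bad := by simp [hd]
  have hprove : (fun b => (kp k b).2) =
      fun b => V.proof pp (1 - b) (d (pairOf c b) (1 - b)).1 := by
    funext b
    rw [hkp, hdp]
    rfl
  simp only [hprove]
  have hchk : ∀ π : Fin 2 → V.Proof, V.proofsOk pp (fun i b =>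
      if evaluator i b = c then π b else V.proof pp b (d i b).1) ↔
      V.proofCheck pp (kp k) bad π = true := by
    intro π
    rw [VDPF.proofsOk, forall_pairs c]
    simp only [evaluator_pairOf, evaluator_succ_ne, VDPF.proofCheck, Bool.and_eq_true, if_true,
      if_false, hdc]
    rw [show (kp k 0).2 = V.proof pp 1 (d (pairOf c 0) 1).1 from congrFun hprove 0,
      show (kp k 1).2 = V.proof pp 0 (d (pairOf c 1) 0).1 from congrFun hprove 1]
    simp
  have hown : ∀ b, V.ownShares pp (kp k) (rb k) b =
      V.checkShares pp b (d (pairOf c b) b) := by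
    intro b
    rw [VDPF.ownShares, hdp, ← congrFun hmsg b]
  have hsum0 := GoodPair_checks (hpg 0)
  have hsum1 := GoodPair_checks (hpg 1)
  rw [← hdp] at hsum0 hsum1
  have hother : V.otherShares pp (kp k) (rb k) =
      fun b => V.checkShares pp (1 - b) (d (pairOf c b) (1 - b)) := by
    funext b
    rw [VDPF.otherShares, hown]
    rw [Prod.ext_iff] at hsum0 hsum1
    simp only [Prod.fst_add, Prod.snd_add] at hsum0 hsum1
    fin_cases b
    · exact Prod.ext (sub_eq_of_eq_add' hsum0.1.symm) (sub_eq_of_eq_add' hsum0.2.symm)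
    · exact Prod.ext (sub_eq_of_eq_add hsum1.1.symm) (sub_eq_of_eq_add hsum1.2.symm)
  have hopen : ∀ o : Fin 2 → P.K × P.K, openingsOk (fun i b =>
      if evaluator i b = c then o b else V.checkShares pp b (d i b)) ↔
      V.openCheck pp (kp k) (rb k) bad o = true := by
    intro o
    rw [openingsOk, forall_pairs c]
    simp only [evaluator_pairOf, evaluator_succ_ne, VDPF.openCheck, Bool.and_eq_true, if_true,
      if_false, hdc, decide_eq_true_eq, funext_iff, Fin.forall_fin_two, hown, Prod.ext_iff]
    rw [Prod.ext_iff] at hsum0 hsum1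
    simp only [Prod.fst_add, Prod.snd_add] at hsum0 hsum1
    obtain ⟨h1, h2⟩ := hsum0
    obtain ⟨h3, h4⟩ := hsum1
    simp only [show ¬ ((1 : Fin 2) = 0) by decide, show ¬ ((0 : Fin 2) = 1) by decide, if_false]
    -- Writing the targets 1 and 0 as sums of the two correct shares and cancelling the partner's
    -- share turns each check into an equation for a single share.
    have e1 : (o 0).1 + (V.checkShares pp 1 (d (pairOf c 0) 1)).1 = 1 ↔
        (o 0).1 = (V.checkShares pp 0 (d (pairOf c 0) 0)).1 := by rw [← h1, add_left_inj]
    have e2 : (o 0).2 + (V.checkShares pp 1 (d (pairOf c 0) 1)).2 = 0 ↔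
        (o 0).2 = (V.checkShares pp 0 (d (pairOf c 0) 0)).2 := by rw [← h2, add_left_inj]
    have e3 : (V.checkShares pp 0 (d (pairOf c 1) 0)).1 + (o 1).1 = 1 ↔
        (o 1).1 = (V.checkShares pp 1 (d (pairOf c 1) 1)).1 := by rw [← h3, add_right_inj]
    have e4 : (V.checkShares pp 0 (d (pairOf c 1) 0)).2 + (o 1).2 = 0 ↔
        (o 1).2 = (V.checkShares pp 1 (d (pairOf c 1) 1)).2 := by rw [← h4, add_right_inj]
    rw [e1, e2, e3, e4]
    tauto
  have hnice : ∀ (π : Fin 2 → V.Proof) (o : Fin 2 → P.K × P.K),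
      V.proofCheck pp (kp k) bad π = true → V.openCheck pp (kp k) (rb k) bad o = true →
      ∀ i, V.GoodPair pp (d i) := by
    intro π o hπ ho
    rw [forall_pairs c, hdp, hdp, hdc]
    refine ⟨hpg 0, hpg 1, goodPair_of_checks (hver bad rfl ?_) ?_⟩
    · simp only [VDPF.proofCheck, Bool.and_eq_true] at hπ
      exact hπ.2.2
    · simp only [VDPF.openCheck, Bool.and_eq_true, decide_eq_true_eq] at ho
      exact ho.2
  refine ⟨d, ?_, fun i hi => by simp [hd, hi], ?_⟩
  · rcases E.prove k (st1, fun b => V.proof pp (1 - b) (d (pairOf c b) (1 - b)).1) with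
      ⟨st2, _ | π⟩
    · simp
    simp only [Option.elim_some]
    split_ifs with hπ
    · rcases E.opening k (st2, V.otherShares pp (kp k) (rb k)) with ⟨st3, _ | o⟩
      · simp
      · exact hnice π o hπ
    · simp
  · rcases E.prove k (st1, fun b => V.proof pp (1 - b) (d (pairOf c b) (1 - b)).1) with
      ⟨st2, _ | π⟩
    · simp
    simp only [Option.elim_some]
    by_cases hπ : V.proofCheck pp (kp k) bad π = true
    · refine (if_pos ((hchk π).2 hπ)).trans ?_
      change (match E.opening k
          (st2, fun b => V.checkShares pp (1 - b) (d (pairOf c b) (1 - b))) with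
        | (st, none) => ((st, store), false)
        | (st, some o) =>
          if openingsOk (fun i b => if evaluator i b = c then o b else V.checkShares pp b (d i b))
            then ((st, Function.update store k d), true) else ((st, store), false)) = _
      rw [if_pos hπ, hother]
      rcases E.opening k (st2, fun b => V.checkShares pp (1 - b) (d (pairOf c b) (1 - b))) with
        ⟨st3, _ | o⟩
      · rfl
      · simp only [Option.elim_some]
        by_cases ho : V.openCheck pp (kp k) (rb k) bad o = true
        · refine (if_pos ((hopen o).2 ho)).trans ?_
          simp [ho]
        · refine (if_neg fun h => ho ((hopen o).1 h)).trans ?_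
          simp [ho]
    · refine (if_neg fun h => hπ ((hchk π).1 h)).trans ?_
      rw [if_neg hπ]
      rfl

end

section
variable {κ : ℕ} {P : Params} {V : VDPF P}

/-! ## From the real execution to the view of the corrupted party -/

/-- Run the steps in the list one after the other until one of them aborts. -/
def runList {J σ : Type} (l : List J) (step : J → σ → σ × Bool) (s : σ) : σ × Bool :=
  l.foldl (fun a k => if a.2 = true then step k a.1 else a) (s, true)

theorem runSteps_eq {n : ℕ} {σ : Type} (step : Fin n → σ → σ × Bool) (s : σ) :
    runSteps n step s = runList (List.finRange n) step s := rfl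

theorem runList_append {J σ : Type} (l : List J) (k : J) (step : J → σ → σ × Bool) (s : σ) :
    runList (l ++ [k]) step s =
      if (runList l step s).2 = true then step k (runList l step s).1 else runList l step s := by
  simp only [runList, List.foldl_append, List.foldl_cons, List.foldl_nil]
  rfl

/-- The keys that the corrupted party deals for selection `k`. -/
def dealtKeys (E : Environment κ V) (pp : V.PP) (kp : Fin P.runs → Fin 2 → V.Key × V.Proof)
    (rb : Fin P.runs → Fin 2 → P.Idx) (st : Bits E.stateLen) (k : Fin P.runs) (b : Fin 2) :
    V.Key :=
  (optionVal (E.deal k ((runList ((List.finRange P.runs).take k) (hybPre E pp kp rb) st).1,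
    fun b => ((kp k b).1, rb k b))).2 b).1

theorem eq_take_of_prefix {n : ℕ} {l : List (Fin n)} {k : Fin n}
    (h : l ++ [k] <+: List.finRange n) : l = (List.finRange n).take k := by
  obtain ⟨t, ht⟩ := h
  have h1 : (List.finRange n)[l.length]? = some k := by
    rw [← ht]
    simp
  have h2 : l.length = k := by
    obtain ⟨h3, h4⟩ := List.getElem?_eq_some_iff.1 h1
    rw [← h4]
    simp
  rw [← h2, ← ht]
  simp

/-- Induction over prefixes of the list of selections, because `dealtKeys` for selection `k` refers
to the state after the selections before `k`. All keys dealt before an abort are covered, and the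
store matters only if there is none. -/
theorem preprocess_eq {E : Environment κ V} {c : Fin 3} {ω : RealCoins κ V}
    {kp : Fin P.runs → Fin 2 → V.Key × V.Proof} {rb : Fin P.runs → Fin 2 → P.Idx}
    (hkp : ∀ k b, kp k b = V.view ω.1 b (ω.2.2 k (pairOf c b)).1 (ω.2.2 k (pairOf c b)).2.2)
    (hrb : ∀ k b, rb k b = (V.honestDeal ω.1 (ω.2.2 k (pairOf c b)) b).2)
    (hgood : ∀ k b, V.Shares ω.1
      (V.gen ω.1 (ω.2.2 k (pairOf c b)).1 1 (ω.2.2 k (pairOf c b)).2.2)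
      (ω.2.2 k (pairOf c b)).1 1)
    (st : Bits E.stateLen)
    (hver : ∀ k, V.Accepts ω.1 (dealtKeys E ω.1 kp rb st k) →
      ∃ α β, V.Shares ω.1 (dealtKeys E ω.1 kp rb st k) α β)
    (store₀ : Store V) (l : List (Fin P.runs)) (hl : l <+: List.finRange P.runs) :
    ∃ store : Store V, runList l (realPreprocess E c ω) (st, store₀) =
        (((runList l (hybPre E ω.1 kp rb) st).1, store),
          (runList l (hybPre E ω.1 kp rb) st).2) ∧
      ((runList l (hybPre E ω.1 kp rb) st).2 = true → ∀ k ∈ l,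
        (∀ i, V.GoodPair ω.1 (store k i)) ∧
        ∀ i, i ≠ c + 1 → store k i = V.honestDeal ω.1 (ω.2.2 k i)) := by
  induction l using List.reverseRecOn with
  | nil => exact ⟨store₀, rfl, fun _ k hk => by simp at hk⟩
  | append_singleton l k ih =>
    obtain ⟨store, h1, h2⟩ := ih ((List.prefix_append l [k]).trans hl)
    rw [runList_append, runList_append, h1]
    by_cases hf : (runList l (hybPre E ω.1 kp rb) st).2 = true
    · simp only [hf, if_true]
      obtain ⟨d, hd1, hd2, hd3⟩ := realPreprocess_eq (hkp k) (hrb k) (hgood k)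
        (runList l (hybPre E ω.1 kp rb) st).1 store (fun d hd hacc => by
          have hkeys : dealtKeys E ω.1 kp rb st k = fun b => (d b).1 := by
            funext b
            rw [dealtKeys, ← eq_take_of_prefix hl, hd]
            rfl
          have := hver k
          rw [hkeys] at this
          exact this hacc)
      refine ⟨_, hd3, fun hf' k' hk' => ?_⟩
      rw [if_pos hf']
      by_cases hkk : k' = k
      · subst hkk
        rw [Function.update_self]
        exact ⟨hd1 hf', hd2⟩
      · rw [Function.update_of_ne hkk]
        refine h2 hf k' ?_
        simpa [hkk] using hk'
    · simp only [hf, Bool.false_eq_true, if_false]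
      exact ⟨store, rfl, fun hf' => hf'.elim⟩

/-- The real execution with arbitrary masks. -/
def maskedRun (E : Environment κ V) (c : Fin 3) (ω : RealCoins κ V)
    (mask : Fin P.runs → Fin 3 → P.K) (ec : Bits E.coinLen) : Bool :=
  let x := runSteps P.runs (realPreprocess E c ω)
    (E.setup (ec, ω.1, ω.2.1 c, ω.2.1 (c - 1)), fun _ _ _ => 0)
  if x.2 = true then
    E.decision (runSteps P.runs (fun k => maskedSelect E c ω.1 (x.1.2 k) (mask k) k) x.1.1)
  else E.decision (x.1.1, false)

theorem realRun_eq (F : Bits κ → Bits κ → P.K) (sid : Fin P.runs → Bits κ)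
    (E : Environment κ V) (c : Fin 3) (ω : RealCoins κ V) (ec : Bits E.coinLen) :
    realRun F sid E c (ω, ec) = maskedRun E c ω (fun k p => F (ω.2.1 p) (sid k)) ec := by
  have h : ∀ store : Store V, realSelect F sid E c ω store = fun k =>
      maskedSelect E c ω.1 (store k) (fun p => F (ω.2.1 p) (sid k)) k :=
    fun store => funext fun k => funext fun st => realSelect_eq F sid E c ω store k st
  simp only [realRun, maskedRun, h]
  rcases runSteps P.runs (realPreprocess E c ω)
    (E.setup (ec, ω.1, ω.2.1 c, ω.2.1 (c - 1)), fun _ _ _ => 0) with ⟨σ, _ | _⟩ <;> rfl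

/-- What the corrupted party gets from honest dealers and the other evaluators. -/
def honestView (V : VDPF P) (pp : V.PP) (x : Fin P.runs → Fin 2 → P.Idx × P.Idx × V.Coins)
    (k : Fin P.runs) (b : Fin 2) : V.Key × V.Proof :=
  V.view pp b (x k b).1 (x k b).2.2

/-- The index shares that the corrupted party gets from honest dealers. -/
def honestShares (x : Fin P.runs → Fin 2 → P.Idx × P.Idx × V.Coins)
    (k : Fin P.runs) (b : Fin 2) : P.Idx :=
  if b = 0 then (x k b).2.1 else (x k b).1 - (x k b).2.1

/-- The mask number `c + 1` occurs in the message of party `c - 1` with a minus sign. For a fixed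
state a uniform mask therefore makes this message uniform, and the mask's other occurrence, in the
message of party `c + 1`, is absorbed by the relation for the sum. -/
theorem avg_maskedRun {E : Environment κ V} {c : Fin 3} {ω : RealCoins κ V}
    {ec : Bits E.coinLen} {x : Fin P.runs → Fin 2 → P.Idx × P.Idx × V.Coins}
    (hx : ∀ k b, x k b = ω.2.2 k (pairOf c b))
    (hgood : ∀ k b, V.Shares ω.1 (V.gen ω.1 (x k b).1 1 (x k b).2.2) (x k b).1 1)
    (hver : ∀ k, V.Accepts ω.1 (dealtKeys E ω.1 (honestView V ω.1 x) (honestShares x)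
        (E.setup (ec, ω.1, ω.2.1 c, ω.2.1 (c - 1))) k) →
      ∃ α β, V.Shares ω.1 (dealtKeys E ω.1 (honestView V ω.1 x) (honestShares x)
        (E.setup (ec, ω.1, ω.2.1 c, ω.2.1 (c - 1))) k) α β)
    (m : Fin P.runs → Fin 3 → P.K) :
    (avg fun y : Fin P.runs → P.K =>
      ind (maskedRun E c ω (fun k p => if p = c + 1 then y k else m k p) ec)) =
    avg fun r : Fin P.runs → P.K => ind (hybRun E c ω.1 (ω.2.1 c) (ω.2.1 (c - 1))
      (honestView V ω.1 x) (honestShares x) (fun k => m k c - m k (c - 1))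
      (fun k s b => (x k b).1 + s) r ec) := by
  obtain ⟨store, h1, h2⟩ := preprocess_eq (E := E) (c := c) (ω := ω)
    (kp := honestView V ω.1 x) (rb := honestShares x)
    (fun k b => by rw [honestView, hx]) (fun k b => by rw [honestShares, hx]; rfl)
    (fun k b => by rw [← hx]; exact hgood k b) _ hver (fun _ _ _ => 0) _ List.prefix_rfl
  simp only [maskedRun, hybRun, runSteps_eq, h1]
  by_cases hf : (runList (List.finRange P.runs) (hybPre E ω.1 (honestView V ω.1 x)
      (honestShares x)) (E.setup (ec, ω.1, ω.2.1 c, ω.2.1 (c - 1)))).2 = true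
  swap
  · simp only [hf, Bool.false_eq_true, if_false]
  simp only [hf, if_true]
  generalize (runList (List.finRange P.runs) (hybPre E ω.1 (honestView V ω.1 x)
      (honestShares x)) (E.setup (ec, ω.1, ω.2.1 c, ω.2.1 (c - 1)))).1 = st
  have h3 := fun k => h2 hf k (List.mem_finRange k)
  have hρ : ∀ k b, (store k (pairOf c b) 0).2 + (store k (pairOf c b) 1).2 = (x k b).1 := by
    intro k b
    rw [(h3 k).2 _ (pairOf_ne c b), ← hx]
    simp [VDPF.honestDeal]
  -- After an abort the value is not used; the identity keeps the map bijective at every state.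
  let φ : Fin P.runs → Bits E.stateLen × Bool → P.K → P.K := fun k a y =>
    if a.2 = true then reshareOf E ω.1 (store k) (fun p => if p = c + 1 then y else m k p) k a.1
      (c - 1) else y
  have hφ : ∀ k a, Function.Bijective (φ k a) := by
    intro k a
    by_cases ha : a.2 = true
    · have : φ k a = fun y => (reshareOf E ω.1 (store k)
          (fun p => if p = c + 1 then 0 else m k p) k a.1 (c - 1)) - y := by
        funext y
        simp only [φ, ha, if_true, reshareOf, VDPF.reshareMsg, pred_pred_party,
          (succ_party_ne_pred c).symm, if_false, sub_zero]
      rw [this]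
      exact (Equiv.subLeft _).bijective
    · have : φ k a = fun y => y := by
        funext y
        simp only [φ, ha, if_false, Bool.false_eq_true]
      rw [this]
      exact Function.bijective_id
  have h4 := avg_foldl_bijective
    (fun k (a : Bits E.stateLen × Bool) (y : P.K) => if a.2 = true then
      hybSelect E c ω.1 (honestView V ω.1 x) (fun k => m k c - m k (c - 1))
        (fun s b => (x k b).1 + s) y k a.1 else a) φ hφ (fun a => ind (E.decision a)) (st, true)
  refine Eq.trans ?_ h4
  refine congrArg avg (funext fun y => ?_)
  simp only [runList]
  congr 3
  funext a k
  by_cases ha : a.2 = true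
  · simp only [ha, if_true, φ]
    rw [maskedSelect_eq_hybSelect (kp := honestView V ω.1 x)
      (mk := fun k => m k c - m k (c - 1)) (src := fun s b => (x k b).1 + s) (h3 k).1]
    · intro b
      rw [(h3 k).2 _ (pairOf_ne c b), ← hx]
      rfl
    · simp only [(succ_party_ne c).symm, (succ_party_ne_pred c).symm, if_false]
    · intro s b
      rw [hρ]
  · simp only [ha, if_false, Bool.false_eq_true]

/-- The reconstructed values are uniformly random when the dealt indices are not otherwise used. -/
theorem avg_hybRun_shift (E : Environment κ V) (c : Fin 3) (pp : V.PP) (key key' : Bits κ)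
    (kp : Fin P.runs → Fin 2 → V.Key × V.Proof) (rb : Fin P.runs → Fin 2 → P.Idx)
    (mk : Fin P.runs → P.K) (r : Fin P.runs → P.K) (ec : Bits E.coinLen) :
    (avg fun x : Fin P.runs → Fin 2 → P.Idx =>
      ind (hybRun E c pp key key' kp rb mk (fun k s b => x k b + s) r ec)) =
    avg fun x : Fin P.runs → Fin 2 → P.Idx =>
      ind (hybRun E c pp key key' kp rb mk (fun k _ => x k) r ec) := by
  simp only [hybRun]
  by_cases hf : (runSteps P.runs (hybPre E pp kp rb) (E.setup (ec, pp, key, key'))).2 = true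
  swap
  · simp only [hf, Bool.false_eq_true, if_false]
  simp only [hf, if_true]
  generalize (runSteps P.runs (hybPre E pp kp rb) (E.setup (ec, pp, key, key'))).1 = st
  refine Eq.trans ?_ (avg_foldl_bijective
    (fun k (a : Bits E.stateLen × Bool) (x : Fin 2 → P.Idx) => if a.2 = true then
      hybSelect E c pp kp mk (fun _ => x) (r k) k a.1 else a)
    (fun k a x b => x b + ∑ p, (E.input k a.1).2.2 p) (fun k a =>
      (Equiv.addRight (fun _ : Fin 2 => ∑ p, (E.input k a.1).2.2 p)).bijective)
    (fun a => ind (E.decision a)) (st, true))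
  rfl

end

/-! ## Circuits for the steps of the protocol -/

section
variable {I : Type} {n : I → ℕ} {A B : I → Type} [∀ i, BitEnc (A i)] [∀ i, BitEnc (B i)]

theorem PolyCirc.lift {C : I → Type} [∀ i, BitEnc (C i)] [PolyWires n B] {f : ∀ i, A i → C i}
    (hf : PolyCirc n f) : PolyCirc n (fun i (x : A i × B i) => f i x.1) := by
  have := hf.left
  exact hf.comp PolyCirc.curryFst

theorem PolyCirc.sumFin {J : Type} [Fintype J] [∀ i, AddCommMonoid (B i)] [∀ i, XorEnc (B i)]
    [PolyWires n A] [PolyWires n B] {f : ∀ i, A i → J → B i}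
    (h : ∀ j, PolyCirc n (fun i a => f i a j)) : PolyCirc n (fun i a => ∑ j, f i a j) :=
  PolyCirc.sum (J := fun _ => J) (PolyBd.const _)
    (PolyCirc.of_forall (f := fun i j a => f i a j) h)

theorem PolyCirc.someIf [PolyWires n B] {c : ∀ i, A i → Bool} {f : ∀ i, A i → B i}
    (hc : PolyCirc n c) (hf : PolyCirc n f) :
    PolyCirc n (fun i a => if c i a = true then Option.some (f i a) else none) := by
  have := hc.left
  exact hc.ite hf.some (PolyCirc.const _)

theorem PolyCirc.vec2 {f g : ∀ i, A i → B i} (hf : PolyCirc n f) (hg : PolyCirc n g) :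
    PolyCirc n (fun i a => ![f i a, g i a]) := by
  have := hf.left
  refine PolyCirc.piFinite fun j => ?_
  fin_cases j
  · exact hf
  · exact hg

/-- The functions of a family of function distribution schemes, in parameters of polynomial size,
have circuits of polynomial size. -/
structure EffVDPF {I : Type} (n : I → ℕ) {P : I → Params} (V : ∀ i, VDPF (P i)) : Prop where
  ell : PolyBd n fun i => (P i).ell
  size : PolyBd n fun i => 2 ^ (P i).ellm
  runs : PolyBd n fun i => (P i).runs
  gen : PolyCirc n (fun i (a : (V i).PP × (P i).Idx × (P i).K × (V i).Coins) =>
    (V i).gen a.1 a.2.1 a.2.2.1 a.2.2.2)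
  eval : ∀ b, PolyCirc n (fun i (a : (V i).PP × (V i).Key) => (V i).eval a.1 b a.2)
  proof : ∀ b, PolyCirc n (fun i (a : (V i).PP × (V i).Key) => (V i).proof a.1 b a.2)
  verify : PolyCirc n (fun i (a : (V i).PP × (V i).Proof × (V i).Proof) =>
    (V i).verify a.1 a.2.1 a.2.2)

/-- The algorithms of the environments have circuits of polynomial size. -/
structure EffEnv {I : Type} (n : I → ℕ) {P : I → Params} {V : ∀ i, VDPF (P i)} {κ : I → ℕ}
    (E : ∀ i, Environment (κ i) (V i)) : Prop where
  setup : PolyCirc n (fun i => (E i).setup)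
  deal : PolyCirc (fun x : Σ i, Fin (P i).runs => n x.1)
    (A := fun x => Bits (E x.1).stateLen × (Fin 2 → (V x.1).Deal))
    (B := fun x => Bits (E x.1).stateLen × Option (Fin 2 → (V x.1).Deal))
    (fun x => (E x.1).deal x.2)
  prove : PolyCirc (fun x : Σ i, Fin (P i).runs => n x.1)
    (A := fun x => Bits (E x.1).stateLen × (Fin 2 → (V x.1).Proof))
    (B := fun x => Bits (E x.1).stateLen × Option (Fin 2 → (V x.1).Proof))
    (fun x => (E x.1).prove x.2)
  opening : PolyCirc (fun x : Σ i, Fin (P i).runs => n x.1)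
    (A := fun x => Bits (E x.1).stateLen × (Fin 2 → (P x.1).K × (P x.1).K))
    (B := fun x => Bits (E x.1).stateLen × Option (Fin 2 → (P x.1).K × (P x.1).K))
    (fun x => (E x.1).opening x.2)
  input : PolyCirc (fun x : Σ i, Fin (P i).runs => n x.1)
    (A := fun x => Bits (E x.1).stateLen)
    (B := fun x => Bits (E x.1).stateLen × (Fin 3 → (P x.1).Idx → (P x.1).K) ×
      (Fin 3 → (P x.1).Idx))
    (fun x => (E x.1).input x.2)
  recon : PolyCirc (fun x : Σ i, Fin (P i).runs => n x.1)
    (A := fun x => Bits (E x.1).stateLen × (Fin 2 → (P x.1).Idx))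
    (B := fun x => Bits (E x.1).stateLen × Bool)
    (fun x => (E x.1).recon x.2)
  reshare : PolyCirc (fun x : Σ i, Fin (P i).runs => n x.1)
    (A := fun x => Bits (E x.1).stateLen × (P x.1).K)
    (B := fun x => Bits (E x.1).stateLen × (P x.1).K × (Fin 2 → Bool))
    (fun x => (E x.1).reshare x.2)
  output : PolyCirc (fun x : Σ i, Fin (P i).runs => n x.1)
    (A := fun x => Bits (E x.1).stateLen × (Fin 2 → Option ((P x.1).K × (P x.1).K)))
    (B := fun x => Bits (E x.1).stateLen)
    (fun x => (E x.1).output x.2)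
  decision : PolyCirc n (fun i => (E i).decision)

end

/-! ### Circuits for the checks, the selections and the hybrid execution -/

section
variable {I I' : Type} {n : I → ℕ} {A : I → Type} [∀ i, BitEnc (A i)] {P : I → Params}
  {V : ∀ i, VDPF (P i)} {κ : I → ℕ} {E : ∀ i, Environment (κ i) (V i)}

theorem EffVDPF.reindex (h : EffVDPF n V) (φ : I' → I) :
    EffVDPF (fun j => n (φ j)) (fun j => V (φ j)) where
  ell := h.ell.reindex φ
  size := h.size.reindex φ
  runs := h.runs.reindex φ
  gen := h.gen.reindex φ
  eval b := (h.eval b).reindex φ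
  proof b := (h.proof b).reindex φ
  verify := h.verify.reindex φ

theorem EffEnv.reindex (h : EffEnv n E) (φ : I' → I) :
    EffEnv (fun j => n (φ j)) (fun j => E (φ j)) where
  setup := h.setup.reindex φ
  deal := h.deal.reindex (fun x : Σ j, Fin (P (φ j)).runs => (⟨φ x.1, x.2⟩ : Σ i, Fin (P i).runs))
  prove := h.prove.reindex
    (fun x : Σ j, Fin (P (φ j)).runs => (⟨φ x.1, x.2⟩ : Σ i, Fin (P i).runs))
  opening := h.opening.reindex
    (fun x : Σ j, Fin (P (φ j)).runs => (⟨φ x.1, x.2⟩ : Σ i, Fin (P i).runs))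
  input := h.input.reindex
    (fun x : Σ j, Fin (P (φ j)).runs => (⟨φ x.1, x.2⟩ : Σ i, Fin (P i).runs))
  recon := h.recon.reindex
    (fun x : Σ j, Fin (P (φ j)).runs => (⟨φ x.1, x.2⟩ : Σ i, Fin (P i).runs))
  reshare := h.reshare.reindex
    (fun x : Σ j, Fin (P (φ j)).runs => (⟨φ x.1, x.2⟩ : Σ i, Fin (P i).runs))
  output := h.output.reindex
    (fun x : Σ j, Fin (P (φ j)).runs => (⟨φ x.1, x.2⟩ : Σ i, Fin (P i).runs))
  decision := h.decision.reindex φ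

theorem EffVDPF.pp (h : EffVDPF n V) : PolyWires n fun i => (V i).PP :=
  have := (h.eval 0).left
  PolyWires.of_prod_left (B := fun i => (V i).Key)

theorem EffVDPF.key (h : EffVDPF n V) : PolyWires n fun i => (V i).Key :=
  have := (h.eval 0).left
  PolyWires.of_prod_right (A := fun i => (V i).PP)

theorem EffVDPF.proofWires (h : EffVDPF n V) : PolyWires n fun i => (V i).Proof :=
  (h.proof 0).right

theorem EffVDPF.field (h : EffVDPF n V) : PolyWires n fun i => (P i).K :=
  PolyWires.field h.ell

theorem EffVDPF.idx (h : EffVDPF n V) : PolyWires n fun i => (P i).Idx :=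
  PolyWires.idx h.ell

theorem EffVDPF.coins (h : EffVDPF n V) : PolyWires n fun i => (V i).Coins :=
  have := h.gen.left
  have : PolyWires n (fun i => (P i).Idx × (P i).K × (V i).Coins) :=
    PolyWires.of_prod_right (A := fun i => (V i).PP)
  have : PolyWires n (fun i => (P i).K × (V i).Coins) :=
    PolyWires.of_prod_right (A := fun i => (P i).Idx)
  PolyWires.of_prod_right (A := fun i => (P i).K)

theorem EffVDPF.checkShares (h : EffVDPF n V) (b : Fin 2) {pp : ∀ i, A i → (V i).PP}
    {d : ∀ i, A i → (V i).Deal} (hpp : PolyCirc n pp) (hd : PolyCirc n d) :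
    PolyCirc n (fun i a => (V i).checkShares (pp i a) b (d i a)) := by
  have := hpp.left
  have := h.field
  have := this.reindex (Sigma.fst : (Σ i, (P i).Idx) → I)
  have hcard : PolyBd n fun i => Fintype.card (P i).Idx := h.size.mono fun i => (P i).card_idx.le
  have he := (h.eval b).comp (hpp.pair hd.fst)
  have he' : PolyCirc (fun x : Σ i, (P i).Idx => n x.1) (A := fun x => A x.1)
      (B := fun x => (P x.1).K)
      (fun x a => (V x.1).eval (pp x.1 a) b (d x.1 a).1 x.2) :=
    (he.reindex Sigma.fst).apply (fun x : Σ i, (P i).Idx => x.2)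
  refine (PolyCirc.sum hcard he').pair ((PolyCirc.emb h.ell hd.snd).sub (PolyCirc.sum hcard ?_))
  exact PolyCirc.mul (h.ell.reindex Sigma.fst)
    (PolyCirc.const (A := fun x : Σ i, (P i).Idx => A x.1) (B := fun x => (P x.1).K)
      fun x => (P x.1).emb x.2) he'

theorem EffVDPF.selectShare (h : EffVDPF n V) (b : Fin 2) {pp : ∀ i, A i → (V i).PP}
    {key : ∀ i, A i → (V i).Key} {T : ∀ i, A i → (P i).Idx → (P i).K} {x : ∀ i, A i → (P i).Idx}
    (hpp : PolyCirc n pp) (hkey : PolyCirc n key) (hT : PolyCirc n T) (hx : PolyCirc n x) :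
    PolyCirc n (fun i a => (V i).selectShare (pp i a) b (key i a) (T i a) (x i a)) :=
  PolyCirc.shiftedSum h.ell h.size hT ((h.eval b).comp (hpp.pair hkey)) hx

theorem EffVDPF.proofCheck (h : EffVDPF n V) {pp : ∀ i, A i → (V i).PP}
    {kp : ∀ i, A i → Fin 2 → (V i).Key × (V i).Proof} {d : ∀ i, A i → Fin 2 → (V i).Deal}
    {π : ∀ i, A i → Fin 2 → (V i).Proof} (hpp : PolyCirc n pp) (hkp : PolyCirc n kp)
    (hd : PolyCirc n d) (hπ : PolyCirc n π) :
    PolyCirc n (fun i a => (V i).proofCheck (pp i a) (kp i a) (d i a) (π i a)) := by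
  have h0 := h.verify.comp (hpp.pair ((hπ.apply fun _ => 0).pair (hkp.apply fun _ => 0).snd))
  have h1 := h.verify.comp (hpp.pair ((hkp.apply fun _ => 1).snd.pair (hπ.apply fun _ => 1)))
  have h2 := h.verify.comp (hpp.pair
    (((h.proof 0).comp (hpp.pair (hd.apply fun _ => 0).fst)).pair
      ((h.proof 1).comp (hpp.pair (hd.apply fun _ => 1).fst))))
  exact h0.and (h1.and h2)

theorem EffVDPF.ownShares (h : EffVDPF n V) {pp : ∀ i, A i → (V i).PP}
    {kp : ∀ i, A i → Fin 2 → (V i).Key × (V i).Proof} {rb : ∀ i, A i → Fin 2 → (P i).Idx}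
    (hpp : PolyCirc n pp) (hkp : PolyCirc n kp) (hrb : PolyCirc n rb) :
    PolyCirc n (fun i a => (V i).ownShares (pp i a) (kp i a) (rb i a)) := by
  have := hpp.left
  exact PolyCirc.piFinite fun b =>
    h.checkShares b hpp ((hkp.apply fun _ => b).fst.pair (hrb.apply fun _ => b))

theorem EffVDPF.otherShares (h : EffVDPF n V) {pp : ∀ i, A i → (V i).PP}
    {kp : ∀ i, A i → Fin 2 → (V i).Key × (V i).Proof} {rb : ∀ i, A i → Fin 2 → (P i).Idx}
    (hpp : PolyCirc n pp) (hkp : PolyCirc n kp) (hrb : PolyCirc n rb) :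
    PolyCirc n (fun i a => (V i).otherShares (pp i a) (kp i a) (rb i a)) := by
  have := hpp.left
  have := h.field
  refine PolyCirc.piFinite fun b => ?_
  have h0 := (h.ownShares hpp hkp hrb).apply fun _ => b
  exact ((PolyCirc.const _).sub h0.fst).pair ((PolyCirc.const _).sub h0.snd)

theorem EffVDPF.openCheck (h : EffVDPF n V) {pp : ∀ i, A i → (V i).PP}
    {kp : ∀ i, A i → Fin 2 → (V i).Key × (V i).Proof} {rb : ∀ i, A i → Fin 2 → (P i).Idx}
    {d : ∀ i, A i → Fin 2 → (V i).Deal} {o : ∀ i, A i → Fin 2 → (P i).K × (P i).K}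
    (hpp : PolyCirc n pp) (hkp : PolyCirc n kp) (hrb : PolyCirc n rb)
    (hd : PolyCirc n d) (ho : PolyCirc n o) :
    PolyCirc n (fun i a => (V i).openCheck (pp i a) (kp i a) (rb i a) (d i a) (o i a)) := by
  have := hpp.left
  have := h.field
  have h0 := h.checkShares 0 hpp (hd.apply fun _ => 0)
  have h1 := h.checkShares 1 hpp (hd.apply fun _ => 1)
  exact (PolyCirc.decideEq _ ho (h.ownShares hpp hkp hrb)).and
    (PolyCirc.decideEq _ ((h0.fst.add h1.fst).pair (h0.snd.add h1.snd))
      (PolyCirc.const fun _ => (1, 0)))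

theorem EffEnv.state (hE : EffEnv n E) : PolyWires n fun i => Bits (E i).stateLen :=
  hE.setup.right

theorem EffEnv.hybPre (hE : EffEnv n E) (hV : EffVDPF n V) (k : ∀ i, Fin (P i).runs)
    {pp : ∀ i, A i → (V i).PP}
    {kp : ∀ i, A i → Fin (P i).runs → Fin 2 → (V i).Key × (V i).Proof}
    {rb : ∀ i, A i → Fin (P i).runs → Fin 2 → (P i).Idx} {st : ∀ i, A i → Bits (E i).stateLen}
    (hpp : PolyCirc n pp) (hkp : PolyCirc n kp) (hrb : PolyCirc n rb) (hst : PolyCirc n st) :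
    PolyCirc n (fun i a => hybPre (E i) (pp i a) (kp i a) (rb i a) (k i) (st i a)) := by
  have := hpp.left
  have := hV.key
  have := hV.idx
  have := hV.field
  have := hV.proofWires
  have hk := hkp.apply k
  have hr := hrb.apply k
  have hmsg : PolyCirc n (fun i a b => ((kp i a (k i) b).1, rb i a (k i) b)) :=
    PolyCirc.piFinite fun b => (hk.apply fun _ => b).fst.pair (hr.apply fun _ => b)
  have hprf : PolyCirc n (fun i a b => (kp i a (k i) b).2) :=
    PolyCirc.piFinite fun b => (hk.apply fun _ => b).snd
  have hdeal := (hE.deal.reindex fun i => (⟨i, k i⟩ : Σ i, Fin (P i).runs)).comp (hst.pair hmsg)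
  have hprove := (hE.prove.reindex fun i => (⟨i, k i⟩ : Σ i, Fin (P i).runs)).comp
    (hdeal.fst.pair hprf)
  have hother := hV.otherShares hpp hk hr
  have hopen := (hE.opening.reindex fun i => (⟨i, k i⟩ : Σ i, Fin (P i).runs)).comp
    (hprove.fst.pair hother)
  have hfalse : PolyCirc n (fun i (_ : A i) => false) := PolyCirc.const _
  refine PolyCirc.optionElim hdeal.snd (hdeal.fst.pair hfalse) ?_
  refine PolyCirc.optionElim hprove.snd.lift (hprove.fst.pair hfalse).lift ?_
  refine PolyCirc.ite (hV.proofCheck hpp.lift.lift hk.lift.lift PolyCirc.id.fst.snd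
    PolyCirc.id.snd) ?_ (hprove.fst.pair hfalse).lift.lift
  refine PolyCirc.optionElim hopen.snd.lift.lift (hopen.fst.pair hfalse).lift.lift ?_
  exact hopen.fst.lift.lift.lift.pair (hV.openCheck hpp.lift.lift.lift hk.lift.lift.lift
    hr.lift.lift.lift PolyCirc.id.fst.fst.snd PolyCirc.id.snd)

theorem EffEnv.runPre (hE : EffEnv n E) (hV : EffVDPF n V) {l : ∀ i, List (Fin (P i).runs)}
    (hl : PolyBd n fun i => (l i).length) {pp : ∀ i, A i → (V i).PP}
    {kp : ∀ i, A i → Fin (P i).runs → Fin 2 → (V i).Key × (V i).Proof}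
    {rb : ∀ i, A i → Fin (P i).runs → Fin 2 → (P i).Idx} {st : ∀ i, A i → Bits (E i).stateLen}
    (hpp : PolyCirc n pp) (hkp : PolyCirc n kp) (hrb : PolyCirc n rb) (hst : PolyCirc n st) :
    PolyCirc n (fun i a => runList (l i) (ObliviousSelection.hybPre (E i) (pp i a) (kp i a)
      (rb i a)) (st i a)) := by
  have := hpp.left
  refine PolyCirc.foldl hl (B := fun i => Bits (E i).stateLen × Bool)
    (step := fun i k x => if x.1.2 = true then
      ObliviousSelection.hybPre (E i) (pp i x.2) (kp i x.2) (rb i x.2) k x.1.1 else x.1)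
    ?_ (hst.pair (PolyCirc.const _))
  have hw : PolyWires (fun x : Σ i, Fin (P i).runs => n x.1)
      (fun x => (Bits (E x.1).stateLen × Bool) × A x.1) := by
    have := hE.state
    exact PolyWires.reindex (A := fun i => (Bits (E i).stateLen × Bool) × A i) inferInstance _
  have hid : PolyCirc (fun x : Σ i, Fin (P i).runs => n x.1)
      (A := fun x => (Bits (E x.1).stateLen × Bool) × A x.1)
      (B := fun x => (Bits (E x.1).stateLen × Bool) × A x.1) (fun x a => a) := PolyCirc.id
  refine PolyCirc.ite hid.fst.snd ?_ hid.fst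
  exact (hE.reindex Sigma.fst).hybPre (hV.reindex Sigma.fst) (fun x => x.2)
    ((hpp.reindex Sigma.fst).comp hid.snd) ((hkp.reindex Sigma.fst).comp hid.snd)
    ((hrb.reindex Sigma.fst).comp hid.snd) hid.fst.fst

theorem EffVDPF.selected (h : EffVDPF n V) {T : ∀ i, A i → Fin 3 → (P i).Idx → (P i).K}
    {s : ∀ i, A i → (P i).Idx} (hT : PolyCirc n T) (hs : PolyCirc n s) :
    PolyCirc n (fun i a => ∑ p, T i a p (s i a)) := by
  have := hT.left
  have := h.field
  refine PolyCirc.sumFin fun p => ?_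
  refine PolyCirc.lookup h.ell h.size (f := fun i a => T i a p) hs ?_
  exact ((hT.apply fun _ => p).reindex Sigma.fst).apply (fun x : Σ i, (P i).Idx => x.2)

/-- The form that is turned into a circuit; the sent message has cancelled from the honest share. -/
theorem finishSelect_eq {κ : ℕ} {P : Params} {V : VDPF P} (E : Environment κ V) (c : Fin 3)
    (k : Fin P.runs) (T : Fin 3 → P.Idx → P.K) (idx : Fin 3 → P.Idx) (own r : P.K)
    (w : Bits E.stateLen × P.K × (Fin 2 → Bool)) :
    finishSelect E c k T idx own r w = (E.output k (w.1, ![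
        if w.2.2 0 = true then some (∑ i, T i (∑ p, idx p) - own - r, w.2.1) else none,
        if w.2.2 1 = true then some (r, ∑ i, T i (∑ p, idx p) - own - r) else none]),
      w.2.2 0 && w.2.2 1) := by
  have he : ∑ i, T i (∑ p, idx p) + (w.2.1 - own) - w.2.1 - r =
    ∑ i, T i (∑ p, idx p) - own - r := by ring
  simp only [finishSelect, rssPair, osShares, pred_party, succ_pred_party, pred_pred_party,
    pred_party_ne, succ_party_ne, succ_party_ne_pred, if_true, if_false, selected, he]

theorem EffEnv.hybSelect (hE : EffEnv n E) (hV : EffVDPF n V) (c : Fin 3)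
    (k : ∀ i, Fin (P i).runs) {pp : ∀ i, A i → (V i).PP}
    {kp : ∀ i, A i → Fin (P i).runs → Fin 2 → (V i).Key × (V i).Proof}
    {mk : ∀ i, Fin (P i).runs → (P i).K} {src : ∀ i, (P i).Idx → Fin 2 → (P i).Idx}
    {r : ∀ i, (P i).K} {st : ∀ i, A i → Bits (E i).stateLen} (hpp : PolyCirc n pp)
    (hkp : PolyCirc n kp) (hsrc : PolyCirc n src) (hst : PolyCirc n st) :
    PolyCirc n (fun i a => hybSelect (E i) c (pp i a) (kp i a) (mk i) (src i) (r i) (k i)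
      (st i a)) := by
  have := hpp.left
  have := hV.key
  have := hV.idx
  have := hV.field
  have hk := hkp.apply k
  have hin := (hE.input.reindex fun i => (⟨i, k i⟩ : Σ i, Fin (P i).runs)).comp hst
  have hs : PolyCirc n (fun i a => ∑ p, ((E i).input (k i) (st i a)).2.2 p) :=
    PolyCirc.sumFin fun p => hin.snd.snd.apply fun _ => p
  have hΔ := hsrc.comp hs
  have hrec := (hE.recon.reindex fun i => (⟨i, k i⟩ : Σ i, Fin (P i).runs)).comp
    (hin.fst.pair hΔ)
  have hr : PolyCirc n (fun i (_ : A i) => r i) := PolyCirc.const _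
  have hw := (hE.reshare.reindex fun i => (⟨i, k i⟩ : Σ i, Fin (P i).runs)).comp
    (hrec.fst.pair hr)
  have hown : PolyCirc n (fun i a => (V i).ownMsg (pp i a) (kp i a (k i)) (mk i (k i))
      (fun b => ((E i).input (k i) (st i a)).2.1 (pairOf c b))
      (src i (∑ p, ((E i).input (k i) (st i a)).2.2 p))) :=
    ((hV.selectShare 0 hpp (hk.apply fun _ => 0).fst (hin.snd.fst.apply fun _ => pairOf c 0)
      (hΔ.apply fun _ => 0)).add (hV.selectShare 1 hpp (hk.apply fun _ => 1).fst
      (hin.snd.fst.apply fun _ => pairOf c 1) (hΔ.apply fun _ => 1))).add (PolyCirc.const _)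
  have hz := ((hV.selected hin.snd.fst hs).sub hown).sub hr
  have h0 := hw.snd.snd.apply fun _ => 0
  have h1 := hw.snd.snd.apply fun _ => 1
  have hout := (hE.output.reindex fun i => (⟨i, k i⟩ : Σ i, Fin (P i).runs)).comp
    (hw.fst.pair ((h0.someIf (hz.pair hw.snd.fst)).vec2 (h1.someIf (hr.pair hz))))
  refine (hrec.snd.ite (hout.pair (h0.and h1)) (hrec.fst.pair (PolyCirc.const fun _ => false))).congr
    fun i a => ?_
  simp only [ObliviousSelection.hybSelect, finishSelect_eq]

/-- Only the public string and the view `kp` are inputs. All other random values, the points `ρ`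
included, are advice wired into the circuit, as the reduction to privacy requires. -/
theorem EffEnv.hybRun (hE : EffEnv n E) (hV : EffVDPF n V) (c : Fin 3)
    {pp : ∀ i, A i → (V i).PP} {key key' : ∀ i, Bits (κ i)}
    {kp : ∀ i, A i → Fin (P i).runs → Fin 2 → (V i).Key × (V i).Proof}
    {rb : ∀ i, Fin (P i).runs → Fin 2 → (P i).Idx}
    {mk : ∀ i, Fin (P i).runs → (P i).K} {ρ : ∀ i, Fin (P i).runs → Fin 2 → (P i).Idx}
    {r : ∀ i, Fin (P i).runs → (P i).K} {ec : ∀ i, Bits (E i).coinLen} (hpp : PolyCirc n pp)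
    (hkp : PolyCirc n kp) :
    PolyCirc n (fun i a => hybRun (E i) c (pp i a) (key i) (key' i) (kp i a) (rb i) (mk i)
      (fun k s b => ρ i k b + s) (r i) (ec i)) := by
  have := hpp.left
  have := hV.idx
  have hlen : PolyBd n fun i => (List.finRange (P i).runs).length := hV.runs.mono fun i => by simp
  have hwe := hE.setup.left
  have := PolyWires.of_prod_left (n := n) (A := fun i => Bits (E i).coinLen)
    (B := fun i => (V i).PP × Bits (κ i) × Bits (κ i))
  have := PolyWires.of_prod_right (n := n) (A := fun i => Bits (E i).coinLen)
    (B := fun i => (V i).PP × Bits (κ i) × Bits (κ i))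
  have := PolyWires.of_prod_right (n := n) (A := fun i => (V i).PP)
    (B := fun i => Bits (κ i) × Bits (κ i))
  have : PolyWires n fun i => Bits (κ i) := PolyWires.of_prod_right (A := fun i => Bits (κ i))
  have hrunsW : PolyWires n fun i => Fin (P i).runs → Fin 2 → (P i).Idx :=
    PolyWires.pi (A := fun i => Fin 2 → (P i).Idx) (hV.runs.mono fun i => by simp)
  have hset := hE.setup.comp ((PolyCirc.const ec).pair (hpp.pair
    ((PolyCirc.const key).pair (PolyCirc.const key'))))
  have hpre := hE.runPre hV hlen hpp hkp (PolyCirc.const rb) hset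
  refine PolyCirc.ite hpre.snd (hE.decision.comp ?_)
    (hE.decision.comp (hpre.fst.pair (PolyCirc.const fun _ => false)))
  refine PolyCirc.foldl hlen (B := fun i => Bits (E i).stateLen × Bool)
    (step := fun i k x => if x.1.2 = true then
      ObliviousSelection.hybSelect (E i) c (pp i x.2) (kp i x.2) (mk i) (fun s b => ρ i k b + s)
        (r i k) k x.1.1 else x.1)
    ?_ (hpre.fst.pair (PolyCirc.const _))
  have hw : PolyWires (fun x : Σ i, Fin (P i).runs => n x.1)
      (fun x => (Bits (E x.1).stateLen × Bool) × A x.1) := by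
    have := hE.state
    exact PolyWires.reindex (A := fun i => (Bits (E i).stateLen × Bool) × A i) inferInstance _
  have hid : PolyCirc (fun x : Σ i, Fin (P i).runs => n x.1)
      (A := fun x => (Bits (E x.1).stateLen × Bool) × A x.1)
      (B := fun x => (Bits (E x.1).stateLen × Bool) × A x.1) (fun x a => a) := PolyCirc.id
  have hidx : PolyWires (fun x : Σ i, Fin (P i).runs => n x.1) (fun x => (P x.1).Idx) :=
    hV.idx.reindex Sigma.fst
  refine PolyCirc.ite hid.fst.snd ?_ hid.fst
  refine (hE.reindex Sigma.fst).hybSelect (hV.reindex Sigma.fst) c (fun x => x.2)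
    ((hpp.reindex Sigma.fst).comp hid.snd) ((hkp.reindex Sigma.fst).comp hid.snd) ?_ hid.fst.fst
  exact PolyCirc.piFinite fun b => (PolyCirc.const (A := fun x : Σ i, Fin (P i).runs => (P x.1).Idx)
    (B := fun x => (P x.1).Idx) fun x => ρ x.1 x.2 b).add PolyCirc.id

theorem EffVDPF.reshareMsg (h : EffVDPF n V) {pp : ∀ i, (V i).PP}
    {d : ∀ i, Fin 3 → Fin 2 → (V i).Deal} {T : ∀ i, A i → Fin 3 → (P i).Idx → (P i).K}
    {s : ∀ i, A i → (P i).Idx} {mask : ∀ i, A i → Fin 3 → (P i).K}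
    (hT : PolyCirc n T) (hs : PolyCirc n s) (hmask : PolyCirc n mask) (p : Fin 3) :
    PolyCirc n (fun i a => (V i).reshareMsg (pp i) (d i) (T i a)
      (fun j => (d i j 0).2 + (d i j 1).2 + s i a) (mask i a) p) := by
  have := hT.left
  have := h.pp
  have := h.key
  have := h.idx
  have hsel : ∀ (q : Fin 3) (b : Fin 2), PolyCirc n (fun i a => (V i).selectShare (pp i) b
      (d i q b).1 (T i a q) ((d i q 0).2 + (d i q 1).2 + s i a)) := fun q b =>
    h.selectShare b (PolyCirc.const _) (PolyCirc.const _) (hT.apply fun _ => q)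
      ((PolyCirc.const _).add hs)
  exact (((hsel p 0).add (hsel (p - 1) 1)).add (hmask.apply fun _ => p)).sub
    (hmask.apply fun _ => p - 1)

theorem EffEnv.maskedSelect (hE : EffEnv n E) (hV : EffVDPF n V) (c : Fin 3)
    (k : ∀ i, Fin (P i).runs) {pp : ∀ i, (V i).PP} {d : ∀ i, Fin 3 → Fin 2 → (V i).Deal}
    {mask : ∀ i, A i → Fin 3 → (P i).K} {st : ∀ i, A i → Bits (E i).stateLen}
    (hmask : PolyCirc n mask) (hst : PolyCirc n st) :
    PolyCirc n (fun i a => maskedSelect (E i) c (pp i) (d i) (mask i a) (k i) (st i a)) := by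
  have := hst.left
  have := hV.idx
  have := hV.field
  have hin := (hE.input.reindex fun i => (⟨i, k i⟩ : Σ i, Fin (P i).runs)).comp hst
  have hs : PolyCirc n (fun i a => ∑ p, ((E i).input (k i) (st i a)).2.2 p) :=
    PolyCirc.sumFin fun p => hin.snd.snd.apply fun _ => p
  have hΔ : PolyCirc n (fun i a (b : Fin 2) => (d i (pairOf c b) 0).2 + (d i (pairOf c b) 1).2 +
      ∑ p, ((E i).input (k i) (st i a)).2.2 p) :=
    PolyCirc.piFinite fun b => (PolyCirc.const _).add hs
  have hrec := (hE.recon.reindex fun i => (⟨i, k i⟩ : Σ i, Fin (P i).runs)).comp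
    (hin.fst.pair hΔ)
  have hz : ∀ p, PolyCirc n (fun i a => reshareOf (E i) (pp i) (d i) (mask i a) (k i) (st i a) p) :=
    fun p => hV.reshareMsg hin.snd.fst hs hmask p
  have hw := (hE.reshare.reindex fun i => (⟨i, k i⟩ : Σ i, Fin (P i).runs)).comp
    (hrec.fst.pair (hz (c - 1)))
  have h0 := hw.snd.snd.apply fun _ => 0
  have h1 := hw.snd.snd.apply fun _ => 1
  have hout := (hE.output.reindex fun i => (⟨i, k i⟩ : Σ i, Fin (P i).runs)).comp
    (hw.fst.pair ((h0.someIf ((hz (c + 1)).pair hw.snd.fst)).vec2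
      (h1.someIf ((hz (c + 2)).pair (hz (c + 1))))))
  exact hrec.snd.ite (hout.pair (h0.and h1)) (hrec.fst.pair (PolyCirc.const fun _ => false))

end

/-! ## The simulator -/

theorem HasCircuit.mono {α β : Type} [BitEnc α] [BitEnc β] {s t : ℕ} {f : α → β}
    (h : HasCircuit s f) (hst : s ≤ t) : HasCircuit t f := by
  obtain ⟨C, h1, h2⟩ := h
  exact ⟨C, h1.trans hst, h2⟩

/-- For dropping the simulator's state from the ideal execution: the component `t` does not affect
the first component as long as it satisfies the invariant. -/
theorem runList_lift {J σ τ : Type} (Inv : τ → Prop) {step : J → σ × τ → (σ × τ) × Bool}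
    {step' : J → σ → σ × Bool}
    (h : ∀ k s t, Inv t → ∃ t', Inv t' ∧ step k (s, t) = (((step' k s).1, t'), (step' k s).2))
    (l : List J) (s : σ) (t : τ) (ht : Inv t) :
    ∃ t', Inv t' ∧ runList l step (s, t) =
      (((runList l step' s).1, t'), (runList l step' s).2) := by
  induction l using List.reverseRecOn with
  | nil => exact ⟨t, ht, rfl⟩
  | append_singleton l k ih =>
    obtain ⟨t', h1, h2⟩ := ih
    rw [runList_append, runList_append, h2]
    by_cases hf : (runList l step' s).2 = true
    · simp only [hf, if_true]
      exact h k _ t' h1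
    · simp only [hf, Bool.false_eq_true, if_false]
      exact ⟨t', h1, rfl⟩

section
variable {κ : ℕ} {P : Params} {V : VDPF P} {Y : Type}

/-- The random choices of the simulator: the PRF keys, and for every selection and every role of
the corrupted party the coins of the simulator of the distributed point function, a share of the
index and a reconstructed value. -/
abbrev SimCoins (κ : ℕ) (P : Params) (Y : Type) : Type :=
  (Bits κ × Bits κ) × (Fin P.runs → Fin 2 → Y × P.Idx × P.Idx)

/-- The simulator keeps its coins, the public string, what the corrupted party dealt, and the
resharing message that the corrupted party should send. -/
abbrev SimState (κ : ℕ) {P : Params} (V : VDPF P) (Y : Type) : Type :=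
  SimCoins κ P Y × V.PP × (Fin 2 → V.Deal) × P.K

def simView (sim : Fin 2 → V.PP × Y → V.Key × V.Proof) (pp : V.PP)
    (x : Fin P.runs → Fin 2 → Y × P.Idx × P.Idx) (k : Fin P.runs) (b : Fin 2) : V.Key × V.Proof :=
  sim b (pp, (x k b).1)

def simShares (x : Fin P.runs → Fin 2 → Y × P.Idx × P.Idx) (k : Fin P.runs) (b : Fin 2) : P.Idx :=
  (x k b).2.1

def simDelta (x : Fin P.runs → Fin 2 → Y × P.Idx × P.Idx) (k : Fin P.runs) (b : Fin 2) : P.Idx :=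
  (x k b).2.2

def simMask (F : Bits κ → Bits κ → P.K) (sid : Fin P.runs → Bits κ) (key : Bits κ × Bits κ)
    (k : Fin P.runs) : P.K :=
  F key.1 (sid k) - F key.2 (sid k)

/-- The simulator without the encoding of its state: what it sends, and its new state. -/
def simDeal (sim : Fin 2 → V.PP × Y → V.Key × V.Proof) (k : Fin P.runs) (z : SimState κ V Y) :
    Fin 2 → V.Deal :=
  fun b => ((simView sim z.2.1 z.1.2 k b).1, simShares z.1.2 k b)

/-- The keys dealt by the corrupted party are stored, because their proofs and check shares are
tested in the following rounds. -/
def simProve (sim : Fin 2 → V.PP × Y → V.Key × V.Proof) (k : Fin P.runs)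
    (z : SimState κ V Y × (Fin 2 → V.Deal)) : SimState κ V Y × (Fin 2 → V.Proof) :=
  ((z.1.1, z.1.2.1, z.2, 0), fun b => (simView sim z.1.2.1 z.1.1.2 k b).2)

def simOpening (sim : Fin 2 → V.PP × Y → V.Key × V.Proof) (k : Fin P.runs)
    (z : SimState κ V Y × (Fin 2 → V.Proof)) : Option (Fin 2 → P.K × P.K) :=
  if V.proofCheck z.1.2.1 (simView sim z.1.2.1 z.1.1.2 k) z.1.2.2.1 z.2 = true then
    some (V.otherShares z.1.2.1 (simView sim z.1.2.1 z.1.1.2 k) (simShares z.1.1.2 k))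
  else none

def simFinish (sim : Fin 2 → V.PP × Y → V.Key × V.Proof) (k : Fin P.runs)
    (z : SimState κ V Y × (Fin 2 → P.K × P.K)) : Bool :=
  V.openCheck z.1.2.1 (simView sim z.1.2.1 z.1.1.2 k) (simShares z.1.1.2 k) z.1.2.2.1 z.2

/-- The array shares of the corrupted party, its simulated keys, the reconstructed values and the
two PRF keys determine its correct resharing message, which is stored. The stored deals are no
longer needed and are overwritten. -/
def simRecon (sim : Fin 2 → V.PP × Y → V.Key × V.Proof) (F : Bits κ → Bits κ → P.K)
    (sid : Fin P.runs → Bits κ) (k : Fin P.runs)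
    (z : SimState κ V Y × (Fin 2 → P.Idx → P.K)) : SimState κ V Y × (Fin 2 → P.Idx) :=
  ((z.1.1, z.1.2.1, fun _ => (fun _ => false, 0), V.ownMsg z.1.2.1 (simView sim z.1.2.1 z.1.1.2 k)
    (simMask F sid z.1.1.1 k) z.2 (simDelta z.1.1.2 k)), simDelta z.1.1.2 k)

variable [BitEnc Y] [BitEncBij Y]

/-- Coins and state are encoded by bijections with bit strings, so uniform bits give uniform coins.
In `inject` the error is the sent message minus the correct one stored by `simRecon`; the sent
message itself becomes the share number `c`. -/
def simulator (sim : Fin 2 → V.PP × Y → V.Key × V.Proof) (F : Bits κ → Bits κ → P.K)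
    (sid : Fin P.runs → Bits κ) : Simulator κ V where
  coinLen := wires (SimCoins κ P Y)
  stateLen := wires (SimState κ V Y)
  setup a := (toBits (SimState κ V Y) ((toBits (SimCoins κ P Y)).symm a.1, a.2,
    fun _ => (fun _ => false, 0), 0), ((toBits (SimCoins κ P Y)).symm a.1).1)
  deal k s := (s, simDeal sim k ((toBits (SimState κ V Y)).symm s))
  prove k a :=
    (toBits (SimState κ V Y) (simProve sim k ((toBits (SimState κ V Y)).symm a.1, a.2)).1,
      (simProve sim k ((toBits (SimState κ V Y)).symm a.1, a.2)).2)
  opening k a := (a.1, simOpening sim k ((toBits (SimState κ V Y)).symm a.1, a.2))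
  finish k a := (a.1, simFinish sim k ((toBits (SimState κ V Y)).symm a.1, a.2))
  recon k a := (toBits (SimState κ V Y)
      (simRecon sim F sid k ((toBits (SimState κ V Y)).symm a.1, a.2.1)).1,
    (simRecon sim F sid k ((toBits (SimState κ V Y)).symm a.1, a.2.1)).2)
  reshare _ a := a
  inject _ a := (a.1, a.2 - ((toBits (SimState κ V Y)).symm a.1).2.2.2, a.2)

theorem idealRun_def (E : Environment κ V) (S : Simulator κ V) (c : Fin 3)
    (ω : IdealCoins S × Bits E.coinLen) : idealRun E S c ω =
      if (runSteps P.runs (idealPreprocess E S)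
          (E.setup (ω.2, ω.1.1, (S.setup (ω.1.2.1, ω.1.1)).2), (S.setup (ω.1.2.1, ω.1.1)).1)).2 = true
      then E.decision ((runSteps P.runs (idealSelect E S c ω.1.2.2) (runSteps P.runs
          (idealPreprocess E S) (E.setup (ω.2, ω.1.1, (S.setup (ω.1.2.1, ω.1.1)).2),
            (S.setup (ω.1.2.1, ω.1.1)).1)).1).1.1,
        (runSteps P.runs (idealSelect E S c ω.1.2.2) (runSteps P.runs
          (idealPreprocess E S) (E.setup (ω.2, ω.1.1, (S.setup (ω.1.2.1, ω.1.1)).2),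
            (S.setup (ω.1.2.1, ω.1.1)).1)).1).2)
      else E.decision ((runSteps P.runs (idealPreprocess E S)
          (E.setup (ω.2, ω.1.1, (S.setup (ω.1.2.1, ω.1.1)).2),
            (S.setup (ω.1.2.1, ω.1.1)).1)).1.1, false) := by
  unfold idealRun
  rcases S.setup (ω.1.2.1, ω.1.1) with ⟨ss, key, key'⟩
  simp only
  rcases runSteps P.runs (idealPreprocess E S) (E.setup (ω.2, ω.1.1, key, key'), ss) with
    ⟨σ, _ | _⟩ <;> rfl

/-- The invariant is that the simulator's state contains its coins and the public string. From these
it answers as `hybRun` does with the simulated view, and its reconstructed values do not depend on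
the selected index. -/
theorem idealRun_eq (sim : Fin 2 → V.PP × Y → V.Key × V.Proof) (F : Bits κ → Bits κ → P.K)
    (sid : Fin P.runs → Bits κ) (E : Environment κ V) (c : Fin 3) (pp : V.PP)
    (x : SimCoins κ P Y) (r : Fin P.runs → P.K) (ec : Bits E.coinLen) :
    idealRun E (simulator sim F sid) c ((pp, toBits (SimCoins κ P Y) x, r), ec) =
      hybRun E c pp x.1.1 x.1.2 (simView sim pp x.2) (simShares x.2) (simMask F sid x.1)
        (fun k _ => simDelta x.2 k) r ec := by
  let Inv : Bits (simulator sim F sid).stateLen → Prop := fun ss =>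
    ∃ d w, ss = toBits (SimState κ V Y) (x, pp, d, w)
  have hpre : ∀ k st ss, Inv ss → ∃ ss', Inv ss' ∧
      idealPreprocess E (simulator sim F sid) k (st, ss) =
        (((hybPre E pp (simView sim pp x.2) (simShares x.2) k st).1, ss'),
          (hybPre E pp (simView sim pp x.2) (simShares x.2) k st).2) := by
    rintro k st ss ⟨d, w, rfl⟩
    simp only [idealPreprocess, hybPre, simulator, simProve, simOpening, simFinish,
      Equiv.symm_apply_apply]
    rw [show simDeal sim k (x, pp, d, w) =
      fun b => ((simView sim pp x.2 k b).1, simShares x.2 k b) from rfl]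
    rcases E.deal k (st, fun b => ((simView sim pp x.2 k b).1, simShares x.2 k b)) with
      ⟨st1, _ | bad⟩
    · exact ⟨_, ⟨d, w, rfl⟩, rfl⟩
    simp only [Option.elim_some]
    rcases E.prove k (st1, fun b => (simView sim pp x.2 k b).2) with ⟨st2, _ | π⟩
    · exact ⟨_, ⟨bad, 0, rfl⟩, rfl⟩
    simp only [Option.elim_some]
    refine ⟨_, ⟨bad, 0, rfl⟩, ?_⟩
    by_cases hπ : V.proofCheck pp (simView sim pp x.2 k) bad π = true
    · simp only [hπ, if_true]
      rcases E.opening k (st2, V.otherShares pp (simView sim pp x.2 k) (simShares x.2 k)) with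
        ⟨st3, _ | o⟩
      · rfl
      · simp
    · simp only [hπ, if_false, Bool.false_eq_true]
  have hsel : ∀ k st ss, Inv ss → ∃ ss', Inv ss' ∧
      idealSelect E (simulator sim F sid) c r k (st, ss) =
        (((hybSelect E c pp (simView sim pp x.2) (simMask F sid x.1) (fun _ => simDelta x.2 k)
          (r k) k st).1, ss'),
          (hybSelect E c pp (simView sim pp x.2) (simMask F sid x.1) (fun _ => simDelta x.2 k)
          (r k) k st).2) := by
    rintro k st ss ⟨d, w, rfl⟩
    refine ⟨_, ⟨fun _ => (fun _ => false, 0), V.ownMsg pp (simView sim pp x.2 k)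
      (simMask F sid x.1 k) (fun b => (E.input k st).2.1 (pairOf c b)) (simDelta x.2 k), rfl⟩, ?_⟩
    unfold idealSelect hybSelect
    rcases E.input k st with ⟨st1, T, idx⟩
    simp only [simulator, simRecon, Equiv.symm_apply_apply]
    rcases E.recon k (st1, simDelta x.2 k) with ⟨st2, _ | _⟩ <;> rfl
  have hset : (simulator sim F sid).setup (toBits (SimCoins κ P Y) x, pp) =
      (toBits (SimState κ V Y) (x, pp, fun _ => (fun _ => false, 0), 0), x.1) := by
    simp only [simulator, Equiv.symm_apply_apply]
  rw [idealRun_def, hset, hybRun]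
  simp only [runSteps_eq]
  obtain ⟨ss, h1, h2⟩ := runList_lift Inv hpre (List.finRange P.runs) (E.setup (ec, pp, x.1.1, x.1.2))
    (toBits (SimState κ V Y) (x, pp, fun _ => (fun _ => false, 0), 0)) ⟨_, _, rfl⟩
  obtain ⟨ss', h3, h4⟩ := runList_lift Inv hsel (List.finRange P.runs)
    (runList (List.finRange P.runs) (hybPre E pp (simView sim pp x.2) (simShares x.2))
      (E.setup (ec, pp, x.1.1, x.1.2))).1 ss h1
  simp only [h2, h4]
  rfl

end

/-! ### Circuit size of the simulator -/

section
variable {I : Type} {n : I → ℕ} {P : I → Params} {V : ∀ i, VDPF (P i)} {κ : I → ℕ}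
  {Y : I → Type} [∀ i, BitEnc (Y i)]

theorem EffVDPF.simCoins (hV : EffVDPF n V) (hκ : PolyBd n κ) [PolyWires n Y] :
    PolyWires n fun i => SimCoins (κ i) (P i) (Y i) := by
  have := hV.idx
  have := PolyWires.bits hκ
  have : PolyWires n fun i => Fin (P i).runs → Fin 2 → Y i × (P i).Idx × (P i).Idx :=
    PolyWires.pi (A := fun i => Fin 2 → Y i × (P i).Idx × (P i).Idx) (hV.runs.mono fun i => by simp)
  infer_instance

theorem EffVDPF.simState (hV : EffVDPF n V) (hκ : PolyBd n κ) [PolyWires n Y] :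
    PolyWires n fun i => SimState (κ i) (V i) (Y i) := by
  have := hV.idx
  have := hV.pp
  have := hV.key
  have := hV.field
  have := hV.simCoins (κ := κ) (Y := Y) hκ
  infer_instance

variable {sim : ∀ i, Fin 2 → (V i).PP × Y i → (V i).Key × (V i).Proof}
  {F : ∀ i, Bits (κ i) → Bits (κ i) → (P i).K} {sid : ∀ i, Fin (P i).runs → Bits (κ i)}
  {A : I → Type} [∀ i, BitEnc (A i)] {z : ∀ i, A i → SimState (κ i) (V i) (Y i)}

theorem PolyCirc.simView (hsim : ∀ b, PolyCirc n fun i => sim i b) (k : ∀ i, Fin (P i).runs)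
    (hz : PolyCirc n z) : PolyCirc n fun i a => simView (sim i) (z i a).2.1 (z i a).1.2 (k i) :=
  have := hz.left
  PolyCirc.piFinite fun b => (hsim b).comp
    (hz.snd.fst.pair ((hz.fst.snd.apply k).apply fun _ => b).fst)

theorem PolyCirc.simShares (k : ∀ i, Fin (P i).runs) (hz : PolyCirc n z) :
    PolyCirc n fun i a => simShares (z i a).1.2 (k i) :=
  have := hz.left
  PolyCirc.piFinite fun b => ((hz.fst.snd.apply k).apply fun _ => b).snd.fst

theorem PolyCirc.simDelta (k : ∀ i, Fin (P i).runs) (hz : PolyCirc n z) :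
    PolyCirc n fun i a => simDelta (z i a).1.2 (k i) :=
  have := hz.left
  PolyCirc.piFinite fun b => ((hz.fst.snd.apply k).apply fun _ => b).snd.snd

theorem PolyCirc.simDeal (hsim : ∀ b, PolyCirc n fun i => sim i b)
    (k : ∀ i, Fin (P i).runs) (hz : PolyCirc n z) :
    PolyCirc n fun i a => simDeal (sim i) (k i) (z i a) :=
  have := hz.left
  PolyCirc.piFinite fun b => ((PolyCirc.simView hsim k hz).apply fun _ => b).fst.pair
    ((PolyCirc.simShares k hz).apply fun _ => b)

theorem EffVDPF.simProve (hV : EffVDPF n V) (hsim : ∀ b, PolyCirc n fun i => sim i b)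
    (k : ∀ i, Fin (P i).runs) (hz : PolyCirc n z) {d : ∀ i, A i → Fin 2 → (V i).Deal}
    (hd : PolyCirc n d) : PolyCirc n fun i a => simProve (sim i) (k i) (z i a, d i a) :=
  have := hz.left
  have := hV.field
  (hz.fst.pair (hz.snd.fst.pair (hd.pair (PolyCirc.const _)))).pair
    (PolyCirc.piFinite fun b => ((PolyCirc.simView hsim k hz).apply fun _ => b).snd)

theorem EffVDPF.simOpening (hV : EffVDPF n V) (hsim : ∀ b, PolyCirc n fun i => sim i b)
    (k : ∀ i, Fin (P i).runs) (hz : PolyCirc n z) {π : ∀ i, A i → Fin 2 → (V i).Proof}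
    (hπ : PolyCirc n π) : PolyCirc n fun i a => simOpening (sim i) (k i) (z i a, π i a) :=
  have := hV.field
  PolyCirc.someIf (hV.proofCheck hz.snd.fst (PolyCirc.simView hsim k hz) hz.snd.snd.fst hπ)
    (hV.otherShares hz.snd.fst (PolyCirc.simView hsim k hz) (PolyCirc.simShares k hz))

theorem EffVDPF.simFinish (hV : EffVDPF n V) (hsim : ∀ b, PolyCirc n fun i => sim i b)
    (k : ∀ i, Fin (P i).runs) (hz : PolyCirc n z) {o : ∀ i, A i → Fin 2 → (P i).K × (P i).K}
    (ho : PolyCirc n o) : PolyCirc n fun i a => simFinish (sim i) (k i) (z i a, o i a) :=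
  hV.openCheck hz.snd.fst (PolyCirc.simView hsim k hz) (PolyCirc.simShares k hz) hz.snd.snd.fst ho

theorem EffVDPF.simRecon (hV : EffVDPF n V) (hsim : ∀ b, PolyCirc n fun i => sim i b)
    (hκ : PolyBd n κ) (hF : PolyCirc n fun i (a : Bits (κ i) × Bits (κ i)) => F i a.1 a.2)
    (k : ∀ i, Fin (P i).runs) (hz : PolyCirc n z) {T : ∀ i, A i → Fin 2 → (P i).Idx → (P i).K}
    (hT : PolyCirc n T) :
    PolyCirc n fun i a => simRecon (sim i) (F i) (sid i) (k i) (z i a, T i a) := by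
  have := hz.left
  have := hV.key
  have := hV.idx
  have := PolyWires.bits hκ
  have hkp := PolyCirc.simView hsim k hz
  have hΔ := PolyCirc.simDelta k hz
  have hm : PolyCirc n (fun i a => simMask (F i) (sid i) (z i a).1.1 (k i)) :=
    (hF.comp (hz.fst.fst.fst.pair (PolyCirc.const _))).sub
      (hF.comp (hz.fst.fst.snd.pair (PolyCirc.const _)))
  refine (hz.fst.pair (hz.snd.fst.pair ((PolyCirc.const _).pair ?_))).pair hΔ
  exact ((hV.selectShare 0 hz.snd.fst (hkp.apply fun _ => 0).fst (hT.apply fun _ => 0)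
    (hΔ.apply fun _ => 0)).add (hV.selectShare 1 hz.snd.fst (hkp.apply fun _ => 1).fst
    (hT.apply fun _ => 1) (hΔ.apply fun _ => 1))).add hm

end

theorem simulator_bounded {P : ℕ → Params} {V : ∀ κ, VDPF (P κ)} {Y : ℕ → Type}
    [∀ κ, BitEnc (Y κ)] [∀ κ, BitEncBij (Y κ)]
    {sim : ∀ κ, Fin 2 → (V κ).PP × Y κ → (V κ).Key × (V κ).Proof}
    {F : ∀ κ, Bits κ → Bits κ → (P κ).K} {sid : ∀ κ, Fin (P κ).runs → Bits κ}
    (hV : EffVDPF (fun κ => κ) V) (hsim : ∀ b, PolyCirc (fun κ => κ) fun κ => sim κ b)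
    (hF : PolyTime fun κ (a : Bits κ × Bits κ) => F κ a.1 a.2) :
    ∃ p : Polynomial ℕ, ∀ κ, (simulator (sim κ) (F κ) (sid κ)).Bounded (p.eval κ) := by
  have := hV.idx
  have := hV.pp
  have := hV.key
  have := hV.field
  have hY : PolyWires (fun κ => κ) Y :=
    have := (hsim 0).left
    PolyWires.of_prod_right (A := fun κ => (V κ).PP)
  have := hV.simCoins (κ := fun κ => κ) (Y := Y) PolyBd.self
  have := hV.simState (κ := fun κ => κ) (Y := Y) PolyBd.self
  have := hV.proofWires
  have : PolyWires (fun κ => κ) fun κ => (P κ).Idx → (P κ).K := PolyWires.table hV.ell hV.size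
  let N : (Σ κ, Fin (P κ).runs) → ℕ := fun x => x.1
  let St : (Σ κ, Fin (P κ).runs) → Type := fun x => SimState x.1 (V x.1) (Y x.1)
  have hSt : PolyWires N St := PolyWires.reindex
    (n := fun κ => κ) (A := fun κ => SimState κ (V κ) (Y κ)) inferInstance Sigma.fst
  have hV' : EffVDPF N (fun x => V x.1) := hV.reindex Sigma.fst
  have hsim' : ∀ b, PolyCirc N fun x => sim x.1 b := fun b => (hsim b).reindex Sigma.fst
  have hF' : PolyCirc N fun x (a : Bits x.1 × Bits x.1) => F x.1 a.1 a.2 :=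
    (PolyCirc.of_hasCircuit (n := fun κ => κ) hF).reindex Sigma.fst
  have hin : ∀ {B : ∀ κ, Type} [∀ κ, BitEnc (B κ)] [PolyWires (fun κ => κ) B],
      PolyCirc N (A := fun x => Bits (wires (St x)) × B x.1) (B := fun x => Bits (wires (St x)))
        (fun x a => a.1) ∧
      PolyCirc N (A := fun x => Bits (wires (St x)) × B x.1) (B := St)
        (fun x a => (toBits (St x)).symm a.1) ∧
      PolyCirc N (A := fun x => Bits (wires (St x)) × B x.1) (B := fun x => B x.1)
        (fun x a => a.2) := fun {B} _ hB => by
    have : PolyWires N fun x => B x.1 := hB.reindex Sigma.fst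
    exact ⟨PolyCirc.curryFst, PolyCirc.ofBits (B := St) PolyCirc.curryFst, PolyCirc.currySnd⟩
  have h0 : PolyCirc (fun κ => κ) (A := fun κ => Bits (wires (SimCoins κ (P κ) (Y κ))) × (V κ).PP)
      (B := fun κ => Bits (wires (SimState κ (V κ) (Y κ))) × Bits κ × Bits κ)
      fun κ => (simulator (sim κ) (F κ) (sid κ)).setup := by
    have h : PolyCirc (fun κ => κ) (fun κ (a : Bits (wires (SimCoins κ (P κ) (Y κ))) × (V κ).PP) =>
        (toBits (SimCoins κ (P κ) (Y κ))).symm a.1) :=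
      PolyCirc.ofBits (B := fun κ => SimCoins κ (P κ) (Y κ)) PolyCirc.curryFst
    exact PolyCirc.pair (PolyCirc.toBits (B := fun κ => SimState κ (V κ) (Y κ))
      (h.pair (PolyCirc.currySnd.pair (PolyCirc.const _)))) h.fst
  have h1 : PolyCirc N (A := fun x => Bits (wires (St x)))
      (B := fun x => Bits (wires (St x)) × (Fin 2 → (V x.1).Deal))
      fun x => (simulator (sim x.1) (F x.1) (sid x.1)).deal x.2 :=
    PolyCirc.pair (B := fun x => Bits (wires (St x))) PolyCirc.id (PolyCirc.simDeal hsim' (fun x => x.2)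
      (PolyCirc.ofBits (B := St) PolyCirc.id))
  have h2 : PolyCirc N (A := fun x => Bits (wires (St x)) × (Fin 2 → (V x.1).Deal))
      (B := fun x => Bits (wires (St x)) × (Fin 2 → (V x.1).Proof))
      fun x => (simulator (sim x.1) (F x.1) (sid x.1)).prove x.2 := by
    obtain ⟨-, g2, g3⟩ := hin (B := fun κ => Fin 2 → (V κ).Deal)
    have g := hV'.simProve hsim' (fun x => x.2) g2 g3
    exact PolyCirc.pair (PolyCirc.toBits (B := St) g.fst) g.snd
  have h3 : PolyCirc N (A := fun x => Bits (wires (St x)) × (Fin 2 → (V x.1).Proof))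
      (B := fun x => Bits (wires (St x)) × Option (Fin 2 → (P x.1).K × (P x.1).K))
      fun x => (simulator (sim x.1) (F x.1) (sid x.1)).opening x.2 := by
    obtain ⟨g1, g2, g3⟩ := hin (B := fun κ => Fin 2 → (V κ).Proof)
    exact PolyCirc.pair g1 (hV'.simOpening hsim' (fun x => x.2) g2 g3)
  have h4 : PolyCirc N (A := fun x => Bits (wires (St x)) × (Fin 2 → (P x.1).K × (P x.1).K))
      (B := fun x => Bits (wires (St x)) × Bool)
      fun x => (simulator (sim x.1) (F x.1) (sid x.1)).finish x.2 := by
    obtain ⟨g1, g2, g3⟩ := hin (B := fun κ => Fin 2 → (P κ).K × (P κ).K)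
    exact PolyCirc.pair g1 (hV'.simFinish hsim' (fun x => x.2) g2 g3)
  have h5 : PolyCirc N
      (A := fun x => Bits (wires (St x)) × (Fin 2 → (P x.1).Idx → (P x.1).K) × (Fin 2 → (P x.1).Idx))
      (B := fun x => Bits (wires (St x)) × (Fin 2 → (P x.1).Idx))
      fun x => (simulator (sim x.1) (F x.1) (sid x.1)).recon x.2 := by
    obtain ⟨-, g2, g3⟩ := hin (B := fun κ => (Fin 2 → (P κ).Idx → (P κ).K) × (Fin 2 → (P κ).Idx))
    have g := hV'.simRecon (κ := fun x => x.1) (sid := fun x => sid x.1) hsim' PolyBd.self hF'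
      (fun x => x.2) g2 g3.fst
    exact PolyCirc.pair (PolyCirc.toBits (B := St) g.fst) g.snd
  have h6 : PolyCirc N (A := fun x => Bits (wires (St x)) × (P x.1).K)
      (B := fun x => Bits (wires (St x)) × (P x.1).K)
      fun x => (simulator (sim x.1) (F x.1) (sid x.1)).reshare x.2 := by
    obtain ⟨g1, g2, g3⟩ := hin (B := fun κ => (P κ).K)
    exact PolyCirc.pair g1 g3
  have h7 : PolyCirc N (A := fun x => Bits (wires (St x)) × (P x.1).K)
      (B := fun x => Bits (wires (St x)) × (P x.1).K × (P x.1).K)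
      fun x => (simulator (sim x.1) (F x.1) (sid x.1)).inject x.2 := by
    obtain ⟨g1, g2, g3⟩ := hin (B := fun κ => (P κ).K)
    exact PolyCirc.pair g1 ((g3.sub g2.snd.snd.snd).pair g3)
  obtain ⟨p0, q0⟩ := h0.hasCircuit
  obtain ⟨p1, q1⟩ := h1.hasCircuit
  obtain ⟨p2, q2⟩ := h2.hasCircuit
  obtain ⟨p3, q3⟩ := h3.hasCircuit
  obtain ⟨p4, q4⟩ := h4.hasCircuit
  obtain ⟨p5, q5⟩ := h5.hasCircuit
  obtain ⟨p6, q6⟩ := h6.hasCircuit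
  obtain ⟨p7, q7⟩ := h7.hasCircuit
  refine ⟨p0 + p1 + p2 + p3 + p4 + p5 + p6 + p7, fun κ => ?_⟩
  simp only [Polynomial.eval_add]
  exact ⟨(q0 κ).mono (by omega), fun k => (q1 ⟨κ, k⟩).mono (by simp only [N]; omega),
    fun k => (q2 ⟨κ, k⟩).mono (by simp only [N]; omega),
    fun k => (q3 ⟨κ, k⟩).mono (by simp only [N]; omega),
    fun k => (q4 ⟨κ, k⟩).mono (by simp only [N]; omega),
    fun k => (q5 ⟨κ, k⟩).mono (by simp only [N]; omega),
    fun k => (q6 ⟨κ, k⟩).mono (by simp only [N]; omega),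
    fun k => (q7 ⟨κ, k⟩).mono (by simp only [N]; omega)⟩

/-! ## Independent random choices -/

section
variable {J J' A B X Y : Type}

theorem avg_eval [DecidableEq J] [Fintype J] [Fintype X] [Nonempty X] (j : J) (g : X → ℝ) :
    avg (fun x : J → X => g (x j)) = avg g := by
  rw [← avg_update j (fun x : J → X => g (x j))]
  simp only [Function.update_self]
  exact avg_const _

theorem avg_uncurry [DecidableEq J] [Fintype J] [DecidableEq J'] [Fintype J'] [Fintype X]
    (g : (J → J' → X) → ℝ) : avg g = avg fun x : J × J' → X => g fun j j' => x (j, j') :=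
  (avg_equiv (Equiv.curry J J' X) g).symm

theorem avg_pi_prod [DecidableEq J] [Fintype J] [Fintype A] [Fintype B]
    (g : (J → A × B) → ℝ) :
    avg g = avg fun a : J → A => avg fun b : J → B => g fun j => (a j, b j) := by
  rw [← avg_prod fun x : (J → A) × (J → B) => g fun j => (x.1 j, x.2 j)]
  exact (avg_equiv (Equiv.arrowProdEquivProdArrow J (fun _ => A) (fun _ => B)).symm g).symm

/-- Componentwise change of variables. -/
theorem avg_pi_equiv [DecidableEq J] [Fintype J] [Fintype A] [Fintype B] (e : J → A ≃ B)
    (g : (J → B) → ℝ) : avg (fun a : J → A => g fun j => e j (a j)) = avg g :=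
  avg_equiv (Equiv.piCongrRight e) g

/-- A hybrid argument: the entries of a vector are replaced one after the other. -/
theorem avg_hybrid {Ω Z : Type} [Fintype Ω] [DecidableEq J] [Fintype J] [Fintype X] [Nonempty X]
    [Fintype Y] [Nonempty Y] (G : Ω → (J → Z) → ℝ) (u : Ω → J → X → Z) (w : Ω → J → Y → Z)
    (ν : J → ℝ)
    (h : ∀ (j : J) (e : J → Bool) (x : J → X) (y : J → Y),
      |(avg fun ω => avg fun x' : X => G ω fun i => if i = j then u ω j x' else
          if e i = true then w ω i (y i) else u ω i (x i)) -
        avg fun ω => avg fun y' : Y => G ω fun i => if i = j then w ω j y' else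
          if e i = true then w ω i (y i) else u ω i (x i)| ≤ ν j) :
    |(avg fun ω => avg fun x : J → X => G ω fun i => u ω i (x i)) -
      avg fun ω => avg fun y : J → Y => G ω fun i => w ω i (y i)| ≤ ∑ j, ν j := by
  -- The hybrid in which the entries in `S` are replaced. Both coordinate vectors are always sampled
  -- in full, so the other coordinates can be fixed while one entry is exchanged.
  let Φ : Finset J → ℝ := fun S => avg fun x : J → X => avg fun y : J → Y => avg fun ω =>
    G ω fun i => if decide (i ∈ S) = true then w ω i (y i) else u ω i (x i)
  have h0 : (avg fun ω => avg fun x : J → X => G ω fun i => u ω i (x i)) = Φ ∅ := by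
    simp only [Φ, Finset.notMem_empty, decide_false, Bool.false_eq_true, if_false, avg_const]
    exact avg_comm _
  have h1 : (avg fun ω => avg fun y : J → Y => G ω fun i => w ω i (y i)) = Φ Finset.univ := by
    simp only [Φ, Finset.mem_univ, decide_true, if_true, avg_const]
    exact avg_comm _
  rw [h0, h1]
  suffices H : ∀ S : Finset J, |Φ ∅ - Φ S| ≤ ∑ j ∈ S, ν j from H _
  intro S
  induction S using Finset.induction_on with
  | empty => simp
  | insert j S hj ih =>
    rw [Finset.sum_insert hj, add_comm]
    refine (abs_sub_le _ (Φ S) _).trans (add_le_add ih ?_)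
    have e1 : Φ S = avg fun x : J → X => avg fun y : J → Y => avg fun ω => avg fun x' : X =>
        G ω fun i => if i = j then u ω j x' else
          if decide (i ∈ S) = true then w ω i (y i) else u ω i (x i) := by
      simp only [Φ]
      -- Resampling coordinate `j` exposes the entry to be replaced as an independent fresh value.
      rw [← avg_update j]
      refine congrArg avg (funext fun x => ?_)
      rw [avg_comm]
      refine congrArg avg (funext fun y => ?_)
      rw [avg_comm]
      refine congrArg avg (funext fun ω => congrArg avg (funext fun x' => congrArg _
        (funext fun i => ?_)))
      by_cases hi : i = j
      · subst hi
        simp [hj]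
      · simp [hi]
    have e2 : Φ (insert j S) = avg fun x : J → X => avg fun y : J → Y => avg fun ω =>
        avg fun y' : Y => G ω fun i => if i = j then w ω j y' else
          if decide (i ∈ S) = true then w ω i (y i) else u ω i (x i) := by
      simp only [Φ]
      refine congrArg avg (funext fun x => ?_)
      rw [← avg_update j]
      refine congrArg avg (funext fun y => ?_)
      rw [avg_comm]
      refine congrArg avg (funext fun ω => congrArg avg (funext fun y' => congrArg _
        (funext fun i => ?_)))
      by_cases hi : i = j
      · subst hi
        simp
      · simp [hi]
    rw [e1, e2]
    exact abs_avg_sub_le_const fun x => abs_avg_sub_le_const fun y => h j _ x y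

end

/-- Two experiments that agree unless one of finitely many unlikely events happens. -/
theorem abs_avg_sub_le_sum {Ω J : Type} [Fintype Ω] [Fintype J] {f g : Ω → ℝ} {bad : J → Ω → Bool}
    {ν : J → ℝ} (hfg : ∀ ω, |f ω - g ω| ≤ 1) (h : ∀ ω, (∀ j, bad j ω = false) → f ω = g ω)
    (hbad : ∀ j, (avg fun ω => ind (bad j ω)) ≤ ν j) : |avg f - avg g| ≤ ∑ j, ν j := by
  refine (abs_avg_sub_le f g).trans ((avg_mono (g := fun ω => ∑ j, ind (bad j ω)) fun ω => ?_).trans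
    ((avg_sum Finset.univ fun j ω => ind (bad j ω)).le.trans (Finset.sum_le_sum fun j _ => hbad j)))
  by_cases hω : ∀ j, bad j ω = false
  · rw [h ω hω, sub_self, abs_zero]
    exact Finset.sum_nonneg fun j _ => ind_nonneg _
  · push Not at hω
    obtain ⟨j, hj⟩ := hω
    refine (hfg ω).trans (le_trans ?_ (Finset.single_le_sum (f := fun j => ind (bad j ω))
      (fun j _ => ind_nonneg _) (Finset.mem_univ j)))
    have : bad j ω = true := by simpa using hj
    simp [ind, this]

/-! ## One PRF key is replaced by random values -/

section
variable {P : ℕ → Params} {V : ∀ κ, VDPF (P κ)}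

theorem effVDPF_of_secure (hm : PolyBounded fun κ => 2 ^ (P κ).ellm)
    (hell : PolyBounded fun κ => (P κ).ell) (hruns : PolyBounded fun κ => (P κ).runs)
    (hV : VDPFEfficient V) : EffVDPF (fun κ => κ) V where
  ell := hell
  size := hm
  runs := hruns
  gen := PolyCirc.of_hasCircuit (n := fun κ => κ) hV.1
  eval b := PolyCirc.of_hasCircuit (n := fun κ => κ) (hV.2.1 b)
  proof b := PolyCirc.of_hasCircuit (n := fun κ => κ) (hV.2.2.1 b)
  verify := PolyCirc.of_hasCircuit (n := fun κ => κ) hV.2.2.2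

theorem effEnv_of_bounded {E : ∀ κ, Environment κ (V κ)}
    (hE : ∃ p : Polynomial ℕ, ∀ κ, (E κ).Bounded (p.eval κ)) : EffEnv (fun κ => κ) E := by
  obtain ⟨p, hp⟩ := hE
  exact
  { setup := PolyCirc.of_hasCircuit ⟨p, fun κ => (hp κ).1⟩
    deal := PolyCirc.of_hasCircuit ⟨p, fun x => (hp x.1).2.1 x.2⟩
    prove := PolyCirc.of_hasCircuit ⟨p, fun x => (hp x.1).2.2.1 x.2⟩
    opening := PolyCirc.of_hasCircuit ⟨p, fun x => (hp x.1).2.2.2.1 x.2⟩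
    input := PolyCirc.of_hasCircuit ⟨p, fun x => (hp x.1).2.2.2.2.1 x.2⟩
    recon := PolyCirc.of_hasCircuit ⟨p, fun x => (hp x.1).2.2.2.2.2.1 x.2⟩
    reshare := PolyCirc.of_hasCircuit ⟨p, fun x => (hp x.1).2.2.2.2.2.2.1 x.2⟩
    output := PolyCirc.of_hasCircuit ⟨p, fun x => (hp x.1).2.2.2.2.2.2.2.1 x.2⟩
    decision := PolyCirc.of_hasCircuit ⟨p, fun κ => (hp κ).2.2.2.2.2.2.2.2⟩ }

instance (P : Params) : Nonempty P.K := ⟨0⟩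

/-- The preprocessing does not use the masks, so its outcome is a function of the advice; the key `c
+ 1` is used only in the selections, one query in each. The masks under the other keys are also
advice. When the preprocessing aborts, the two experiments coincide. -/
theorem maskedRun_prf {F : ∀ κ, Bits κ → Bits κ → (P κ).K} (hF : IsSecurePRF F)
    {E : ∀ κ, Environment κ (V κ)} (hV : EffVDPF (fun κ => κ) V) (hE : EffEnv (fun κ => κ) E)
    (sid : ∀ κ, Fin (P κ).runs → Bits κ) (c : Fin 3) :
    ∃ ν : ℕ → ℝ, Negligible ν ∧ (∀ κ, 0 ≤ ν κ) ∧ ∀ κ (ω : RealCoins κ (V κ))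
      (ec : Bits (E κ).coinLen) (m : Fin (P κ).runs → Fin 3 → (P κ).K),
      Function.Injective (sid κ) →
      |(avg fun key : Bits κ => ind (maskedRun (E κ) c ω
          (fun k p => if p = c + 1 then F κ key (sid κ k) else m k p) ec)) -
        avg fun y : Fin (P κ).runs → (P κ).K => ind (maskedRun (E κ) c ω
          (fun k p => if p = c + 1 then y k else m k p) ec)| ≤ ν κ := by
  let Adv : ℕ → Type := fun κ =>
    RealCoins κ (V κ) × Bits (E κ).coinLen × (Fin (P κ).runs → Fin 3 → (P κ).K)
  let pre : ∀ x : Σ κ, Adv κ, (Bits (E x.1).stateLen × Store (V x.1)) × Bool := fun x =>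
    runSteps (P x.1).runs (realPreprocess (E x.1) c x.2.1)
      ((E x.1).setup (x.2.2.1, x.2.1.1, x.2.1.2.1 c, x.2.1.2.1 (c - 1)), fun _ _ _ => 0)
  let step : ∀ x : Σ κ, Adv κ, Fin (P x.1).runs → Bits (E x.1).stateLen × (P x.1).K →
      Bits (E x.1).stateLen × Bool := fun x k a =>
    maskedSelect (E x.1) c x.2.1.1 ((pre x).1.2 k)
      (fun p => if p = c + 1 then a.2 else x.2.2.2 k p) k a.1
  have hstep : PolyCirc (fun z : Σ x : (Σ κ, Adv κ), Fin (P x.1).runs => z.1.1)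
      (A := fun z => Bits (E z.1.1).stateLen × (P z.1.1).K)
      (B := fun z => Bits (E z.1.1).stateLen × Bool) (fun z => step z.1 z.2) := by
    have hw : PolyWires (fun z : Σ x : (Σ κ, Adv κ), Fin (P x.1).runs => z.1.1)
        (fun z => Bits (E z.1.1).stateLen × (P z.1.1).K) := by
      have := hE.state
      have := hV.field
      exact PolyWires.reindex (n := fun κ => κ) (A := fun κ => Bits (E κ).stateLen × (P κ).K)
        inferInstance (fun z : Σ x : (Σ κ, Adv κ), Fin (P x.1).runs => z.1.1)
    have hK : PolyWires (fun z : Σ x : (Σ κ, Adv κ), Fin (P x.1).runs => z.1.1)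
        (fun z => (P z.1.1).K) :=
      hV.field.reindex (fun z : Σ x : (Σ κ, Adv κ), Fin (P x.1).runs => z.1.1)
    have hid : PolyCirc (fun z : Σ x : (Σ κ, Adv κ), Fin (P x.1).runs => z.1.1)
        (A := fun z => Bits (E z.1.1).stateLen × (P z.1.1).K)
        (B := fun z => Bits (E z.1.1).stateLen × (P z.1.1).K) (fun _ a => a) := PolyCirc.id
    refine (hE.reindex fun z : Σ x : (Σ κ, Adv κ), Fin (P x.1).runs => z.1.1).maskedSelect
      (hV.reindex _) c (fun z => z.2) (PolyCirc.piFinite fun p => ?_) hid.fst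
    by_cases hp : p = c + 1
    · simp only [hp, if_true]
      exact hid.snd
    · simp only [hp, if_false]
      exact PolyCirc.const _
  obtain ⟨ν, h1, h2, h3⟩ := prf_bound hF (m := fun κ => (P κ).runs) hV.runs sid (Adv := Adv)
    (len := fun x => (E x.1).stateLen) (step := step) (dec := fun x => (E x.1).decision)
    (fun x => (pre x).1.1) hstep (hE.decision.reindex Sigma.fst)
  refine ⟨ν, h1, h2, fun κ ω ec m hinj => ?_⟩
  have h4 := h3 κ (ω, ec, m) hinj
  have key : ∀ y : Fin (P κ).runs → (P κ).K, maskedRun (E κ) c ω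
      (fun k p => if p = c + 1 then y k else m k p) ec =
      if (pre ⟨κ, ω, ec, m⟩).2 = true then oracleRun (step ⟨κ, ω, ec, m⟩) (E κ).decision
        (pre ⟨κ, ω, ec, m⟩).1.1 y else (E κ).decision ((pre ⟨κ, ω, ec, m⟩).1.1, false) :=
    fun y => rfl
  simp only [key]
  by_cases hf : (pre ⟨κ, ω, ec, m⟩).2 = true
  · simp only [hf, if_true]
    exact h4
  · simp only [hf, Bool.false_eq_true, if_false, avg_const, sub_self, abs_zero]
    exact h2 κ

end

/-! ## Unlikely events in the preprocessing -/

section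
variable {I : Type} {n : I → ℕ} {P : I → Params} {V : ∀ i, VDPF (P i)} {A : I → Type}
  [∀ i, BitEnc (A i)] {κ : I → ℕ} {E : ∀ i, Environment (κ i) (V i)}

theorem EffVDPF.view (h : EffVDPF n V) (b : Fin 2) {pp : ∀ i, A i → (V i).PP}
    (hpp : PolyCirc n pp) (α : ∀ i, (P i).Idx) (x : ∀ i, (V i).Coins) :
    PolyCirc n fun i a => (V i).view (pp i a) b (α i) (x i) := by
  have := hpp.left
  have := h.idx
  have := h.field
  have := h.coins
  have hg := h.gen.comp (hpp.pair ((PolyCirc.const α).pair ((PolyCirc.const fun _ => 1).pair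
    (PolyCirc.const x))))
  exact (hg.apply fun _ => b).pair ((h.proof (1 - b)).comp (hpp.pair (hg.apply fun _ => 1 - b)))

theorem PolyCirc.slots {B : I → Type} [∀ i, BitEnc (B i)] [PolyWires n A] (h : EffVDPF n V)
    {f : ∀ i, A i → Fin (P i).runs → Fin 2 → B i}
    (hf : ∀ b, PolyCirc (fun x : Σ i, Fin (P i).runs => n x.1) (A := fun x => A x.1)
      (B := fun x => B x.1) fun x a => f x.1 a x.2 b) : PolyCirc n f := by
  have : PolyWires (fun x : Σ i, Fin (P i).runs => n x.1) fun x => A x.1 :=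
    PolyWires.reindex (A := A) inferInstance Sigma.fst
  exact PolyCirc.pi (B := fun i => Fin 2 → B i) (h.runs.mono fun i => by simp)
    (PolyCirc.piFinite (B := fun x : Σ i, Fin (P i).runs => B x.1) hf)

theorem EffVDPF.honestView (h : EffVDPF n V) {pp : ∀ i, A i → (V i).PP} (hpp : PolyCirc n pp)
    (x : ∀ i, Fin (P i).runs → Fin 2 → (P i).Idx × (P i).Idx × (V i).Coins) :
    PolyCirc n fun i a => honestView (V i) (pp i a) (x i) := by
  have := hpp.left
  exact PolyCirc.slots h fun b => (h.reindex Sigma.fst).view b (hpp.reindex Sigma.fst)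
    (fun y : Σ i, Fin (P i).runs => (x y.1 y.2 b).1) (fun y => (x y.1 y.2 b).2.2)

theorem EffEnv.dealtKeys (hE : EffEnv n E) (hV : EffVDPF n V) (k : ∀ i, Fin (P i).runs)
    {pp : ∀ i, A i → (V i).PP} {kp : ∀ i, A i → Fin (P i).runs → Fin 2 → (V i).Key × (V i).Proof}
    {rb : ∀ i, A i → Fin (P i).runs → Fin 2 → (P i).Idx} {st : ∀ i, A i → Bits (E i).stateLen}
    (hpp : PolyCirc n pp) (hkp : PolyCirc n kp) (hrb : PolyCirc n rb) (hst : PolyCirc n st) :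
    PolyCirc n fun i a => dealtKeys (E i) (pp i a) (kp i a) (rb i a) (st i a) (k i) := by
  have := hpp.left
  have hl : PolyBd n fun i => ((List.finRange (P i).runs).take (k i)).length :=
    hV.runs.mono fun i => by
      rw [List.length_take, List.length_finRange]
      exact min_le_right _ _
  have hrun := (hE.runPre hV hl hpp hkp hrb hst).fst
  have hmsg : PolyCirc n (fun i a b => ((kp i a (k i) b).1, rb i a (k i) b)) :=
    PolyCirc.piFinite fun b => ((hkp.apply k).apply fun _ => b).fst.pair
      ((hrb.apply k).apply fun _ => b)
  have hd := ((hE.deal.reindex fun i => (⟨i, k i⟩ : Σ i, Fin (P i).runs)).comp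
    (hrun.pair hmsg)).snd.optionVal
  exact PolyCirc.piFinite fun b => (hd.apply fun _ => b).fst

end

/-! ### Bounds for the unlikely events, and the passage to the hybrid execution -/

section
variable {P : ℕ → Params} {V : ∀ κ, VDPF (P κ)}

theorem EffEnv.coins {E : ∀ κ, Environment κ (V κ)} (hE : EffEnv (fun κ => κ) E) :
    PolyWires (fun κ => κ) fun κ => Bits (E κ).coinLen :=
  have := hE.setup.left
  PolyWires.of_prod_left (B := fun κ => (V κ).PP × Bits κ × Bits κ)

/-- With all coins but the public string fixed, the environment together with the honest dealers is
a maker of keys that verifiability applies to: from the public string it computes the honest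
messages, runs the preprocessing up to selection `k` and outputs the dealt keys. -/
theorem dealtKeys_bound (hver : VDPFVerifiable V) {E : ∀ κ, Environment κ (V κ)}
    (hV : EffVDPF (fun κ => κ) V) (hE : EffEnv (fun κ => κ) E) :
    ∃ ν : ℕ → ℝ, Negligible ν ∧ (∀ κ, 0 ≤ ν κ) ∧ ∀ κ (key key' : Bits κ)
      (x : Fin (P κ).runs → Fin 2 → (P κ).Idx × (P κ).Idx × (V κ).Coins) (ec : Bits (E κ).coinLen)
      (k : Fin (P κ).runs),
      (avg fun pp : (V κ).PP => open Classical in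
        ind (decide ((V κ).Accepts pp (dealtKeys (E κ) pp (honestView (V κ) pp x) (honestShares x)
            ((E κ).setup (ec, pp, key, key')) k) ∧
          ¬ ∃ α β, (V κ).Shares pp (dealtKeys (E κ) pp (honestView (V κ) pp x) (honestShares x)
            ((E κ).setup (ec, pp, key, key')) k) α β))) ≤ ν κ := by
  let Adv : ℕ → Type := fun κ => Bits κ × Bits κ ×
    (Fin (P κ).runs → Fin 2 → (P κ).Idx × (P κ).Idx × (V κ).Coins) × Bits (E κ).coinLen ×
    Fin (P κ).runs
  have hpp := hV.pp
  have hkey := hV.key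
  have hidx := hV.idx
  have hpp' : PolyWires (fun x : Σ κ, Adv κ => x.1) fun x => (V x.1).PP := hpp.reindex Sigma.fst
  have hid : PolyCirc (fun x : Σ κ, Adv κ => x.1) (A := fun x => (V x.1).PP)
      (B := fun x => (V x.1).PP) fun x pp => pp := PolyCirc.id
  have hrbw : PolyWires (fun x : Σ κ, Adv κ => x.1) fun x =>
      Fin (P x.1).runs → Fin 2 → (P x.1).Idx := by
    have : PolyWires (fun x : Σ κ, Adv κ => x.1) fun x => (P x.1).Idx := hidx.reindex Sigma.fst
    exact PolyWires.pi (A := fun x : Σ κ, Adv κ => Fin 2 → (P x.1).Idx)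
      ((hV.runs.reindex Sigma.fst).mono fun i => by simp)
  have hcw : PolyWires (fun x : Σ κ, Adv κ => x.1) fun x => Bits (E x.1).coinLen :=
    hE.coins.reindex Sigma.fst
  have hkw : PolyWires (fun x : Σ κ, Adv κ => x.1) fun x => Bits x.1 := PolyWires.bits PolyBd.self
  have hset : PolyCirc (fun x : Σ κ, Adv κ => x.1) (A := fun x => (V x.1).PP)
      (B := fun x => Bits (E x.1).stateLen) fun x pp =>
      (E x.1).setup (x.2.2.2.2.1, pp, x.2.1, x.2.2.1) :=
    PolyCirc.comp (hE.setup.reindex Sigma.fst) ((PolyCirc.const fun x => x.2.2.2.2.1).pair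
      (hid.pair ((PolyCirc.const fun x => x.2.1).pair (PolyCirc.const fun x => x.2.2.1))))
  obtain ⟨ν, h1, h2, h3⟩ := vdpf_verifiable_bound hver (Adv := Adv)
    (fun x pp => dealtKeys (E x.1) pp (honestView (V x.1) pp x.2.2.2.1) (honestShares x.2.2.2.1)
      ((E x.1).setup (x.2.2.2.2.1, pp, x.2.1, x.2.2.1)) x.2.2.2.2.2)
    ((hE.reindex Sigma.fst).dealtKeys (hV.reindex Sigma.fst) (fun x => x.2.2.2.2.2) hid
      ((hV.reindex Sigma.fst).honestView hid fun x => x.2.2.2.1) (PolyCirc.const _) hset) hpp hkey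
  exact ⟨ν, h1, h2, fun κ key key' x ec k => h3 κ (key, key', x, ec, k)⟩

/-- Marginal distribution of the random choices of a dealer. -/
theorem avg_slot {κ : ℕ} {P : Params} {V : VDPF P} {Ω : Type} [Fintype Ω] [Nonempty Ω]
    (k : Fin P.runs) (i : Fin 3) (g : V.PP → P.Idx × P.Idx × V.Coins → ℝ) :
    (avg fun ω : RealCoins κ V × Ω => g ω.1.1 (ω.1.2.2 k i)) = avg fun pp => avg fun z => g pp z := by
  rw [avg_fst fun ω : RealCoins κ V => g ω.1 (ω.2.2 k i), avg_prod]
  refine congrArg avg (funext fun pp => ?_)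
  rw [avg_snd fun dc : Fin P.runs → Fin 3 → P.Idx × P.Idx × V.Coins => g pp (dc k i),
    avg_eval k fun z : Fin 3 → P.Idx × P.Idx × V.Coins => g pp (z i), avg_eval i (g pp)]

theorem honestDeal_bound (hcor : VDPFCorrect V) :
    ∃ ν : ℕ → ℝ, Negligible ν ∧ (∀ κ, 0 ≤ ν κ) ∧ ∀ κ,
      (avg fun pp : (V κ).PP => avg fun z : (P κ).Idx × (P κ).Idx × (V κ).Coins =>
        open Classical in ind (decide (¬ ((V κ).Shares pp ((V κ).gen pp z.1 1 z.2.2) z.1 1 ∧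
          (V κ).Accepts pp ((V κ).gen pp z.1 1 z.2.2))))) ≤ ν κ := by
  obtain ⟨ν, h1, h2, h3⟩ := vdpf_correct_bound hcor
  refine ⟨ν, h1, h2, fun κ => ?_⟩
  simp only [avg_prod]
  rw [avg_comm]
  refine avg_le_const fun α => ?_
  rw [avg_comm]
  exact avg_le_const fun _ => h3 κ α

/-- The execution with honest dealers and without PRF key `c + 1`. -/
theorem maskedRun_hyb (hcor : VDPFCorrect V) (hver : VDPFVerifiable V)
    {F : ∀ κ, Bits κ → Bits κ → (P κ).K} {E : ∀ κ, Environment κ (V κ)}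
    (hV : EffVDPF (fun κ => κ) V) (hE : EffEnv (fun κ => κ) E)
    (sid : ∀ κ, Fin (P κ).runs → Bits κ) (c : Fin 3) :
    ∃ ν : ℕ → ℝ, Negligible ν ∧ (∀ κ, 0 ≤ ν κ) ∧ ∀ κ,
      |(avg fun ω : RealCoins κ (V κ) × Bits (E κ).coinLen => avg fun y : Fin (P κ).runs → (P κ).K =>
          ind (maskedRun (E κ) c ω.1
            (fun k p => if p = c + 1 then y k else F κ (ω.1.2.1 p) (sid κ k)) ω.2)) -
        avg fun ω : RealCoins κ (V κ) × Bits (E κ).coinLen => avg fun r : Fin (P κ).runs → (P κ).K =>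
          ind (hybRun (E κ) c ω.1.1 (ω.1.2.1 c) (ω.1.2.1 (c - 1))
            (honestView (V κ) ω.1.1 fun k b => ω.1.2.2 k (pairOf c b))
            (honestShares (V := V κ) fun k b => ω.1.2.2 k (pairOf c b))
            (simMask (F κ) (sid κ) (ω.1.2.1 c, ω.1.2.1 (c - 1)))
            (fun k s b => (ω.1.2.2 k (pairOf c b)).1 + s) r ω.2)| ≤ ν κ := by
  classical
  obtain ⟨ν₁, h11, h12, h13⟩ := honestDeal_bound hcor
  obtain ⟨ν₂, h21, h22, h23⟩ := dealtKeys_bound hver hV hE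
  -- Per selection there are two honest deals that may be incorrect and one pair of keys dealt by
  -- the corrupted party that may defeat the verification. The latter event is defined for all
  -- coins, also after an abort, so the union bound applies.
  refine ⟨fun κ => ((P κ).runs : ℝ) * (2 * ν₁ κ + ν₂ κ),
    ((h11.const_mul 2).add h21).poly_mul hV.runs, fun κ => ?_, fun κ => ?_⟩
  · have := h12 κ
    have := h22 κ
    positivity
  let bad : (Fin (P κ).runs × Fin 2) ⊕ Fin (P κ).runs →
      RealCoins κ (V κ) × Bits (E κ).coinLen → Bool := Sum.elim
    (fun j ω => decide (¬ ((V κ).Shares ω.1.1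
      ((V κ).gen ω.1.1 (ω.1.2.2 j.1 (pairOf c j.2)).1 1 (ω.1.2.2 j.1 (pairOf c j.2)).2.2)
        (ω.1.2.2 j.1 (pairOf c j.2)).1 1 ∧ (V κ).Accepts ω.1.1
      ((V κ).gen ω.1.1 (ω.1.2.2 j.1 (pairOf c j.2)).1 1 (ω.1.2.2 j.1 (pairOf c j.2)).2.2))))
    (fun k ω => decide ((V κ).Accepts ω.1.1 (dealtKeys (E κ) ω.1.1
        (honestView (V κ) ω.1.1 fun k b => ω.1.2.2 k (pairOf c b))
        (honestShares (V := V κ) fun k b => ω.1.2.2 k (pairOf c b))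
        ((E κ).setup (ω.2, ω.1.1, ω.1.2.1 c, ω.1.2.1 (c - 1))) k) ∧
      ¬ ∃ α β, (V κ).Shares ω.1.1 (dealtKeys (E κ) ω.1.1
        (honestView (V κ) ω.1.1 fun k b => ω.1.2.2 k (pairOf c b))
        (honestShares (V := V κ) fun k b => ω.1.2.2 k (pairOf c b))
        ((E κ).setup (ω.2, ω.1.1, ω.1.2.1 c, ω.1.2.1 (c - 1))) k) α β))
  refine (abs_avg_sub_le_sum (bad := bad)
    (ν := Sum.elim (fun _ => ν₁ κ) (fun _ => ν₂ κ)) (fun ω => abs_avg_ind_sub_le_one _ _)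
    (fun ω hω => ?_) ?_).trans (le_of_eq ?_)
  · refine avg_maskedRun (fun k b => rfl) (fun k b => ?_) (fun k hacc => ?_)
      (fun k p => F κ (ω.1.2.1 p) (sid κ k))
    · have := hω (Sum.inl (k, b))
      simp only [bad, Sum.elim_inl, decide_eq_false_iff_not, not_not] at this
      exact this.1
    · have := hω (Sum.inr k)
      simp only [bad, Sum.elim_inr, decide_eq_false_iff_not, not_and, not_not] at this
      exact this hacc
  · rintro (⟨k, b⟩ | k)
    · simp only [bad, Sum.elim_inl]
      exact (avg_slot k (pairOf c b) fun pp z => ind (decide (¬ ((V κ).Shares pp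
        ((V κ).gen pp z.1 1 z.2.2) z.1 1 ∧ (V κ).Accepts pp ((V κ).gen pp z.1 1 z.2.2))))).trans_le
        (h13 κ)
    · simp only [bad, Sum.elim_inr]
      rw [avg_prod, avg_comm]
      refine avg_le_const fun ec => ?_
      rw [avg_prod, avg_comm]
      refine avg_le_const fun ω => ?_
      exact h23 κ (ω.1 c) (ω.1 (c - 1)) (fun k b => ω.2 k (pairOf c b)) ec k
  · simp [Fintype.sum_sum_type]
    ring

end

/-! ## The view of the corrupted party is simulated -/

section
variable {P : ℕ → Params} {V : ∀ κ, VDPF (P κ)}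

/-- The simulators for the two roles, with a common type of coins. -/
theorem exists_view_simulator (hpriv : VDPFPrivate V) (hV : EffVDPF (fun κ => κ) V) :
    ∃ (r r' : ℕ → ℕ) (sim : ∀ κ, Fin 2 → (V κ).PP × (Bits (r κ) × Bits (r' κ)) →
        (V κ).Key × (V κ).Proof),
      (∀ b, PolyCirc (fun κ => κ) fun κ => sim κ b) ∧
      ∀ (b : Fin 2) {Adv : ℕ → Type} (α : ∀ κ, Adv κ → (P κ).Idx)
        (D : ∀ x : Σ κ, Adv κ, (V x.1).PP × (V x.1).Key × (V x.1).Proof → Bool),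
        PolyCirc (fun x : Σ κ, Adv κ => x.1) (A := fun x => (V x.1).PP × (V x.1).Key × (V x.1).Proof)
          (B := fun _ => Bool) D →
        ∃ ν : ℕ → ℝ, Negligible ν ∧ (∀ κ, 0 ≤ ν κ) ∧ ∀ κ a,
          |(avg fun pp : (V κ).PP => avg fun x : (V κ).Coins =>
              ind (D ⟨κ, a⟩ (pp, (V κ).view pp b (α κ a) x))) -
            avg fun pp : (V κ).PP => avg fun y : Bits (r κ) × Bits (r' κ) =>
              ind (D ⟨κ, a⟩ (pp, sim κ b (pp, y)))| ≤ ν κ := by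
  have hpp := hV.pp
  have hkey := hV.key
  have hpf := hV.proofWires
  obtain ⟨r, sim, h1, h2⟩ := hpriv 0
  obtain ⟨r', sim', h1', h2'⟩ := hpriv 1
  have g1 : PolyCirc (fun κ => κ) sim := PolyCirc.of_hasCircuit h1
  have g1' : PolyCirc (fun κ => κ) sim' := PolyCirc.of_hasCircuit h1'
  have hr : PolyWires (fun κ => κ) fun κ => Bits (r κ) :=
    have := g1.left
    PolyWires.of_prod_right (A := fun κ => (V κ).PP)
  have hr' : PolyWires (fun κ => κ) fun κ => Bits (r' κ) :=
    have := g1'.left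
    PolyWires.of_prod_right (A := fun κ => (V κ).PP)
  -- Each role reads its own half of the coins; the unused half disappears from the average.
  refine ⟨r, r', fun κ => ![fun a => sim κ (a.1, a.2.1), fun a => sim' κ (a.1, a.2.2)], ?_, ?_⟩
  · have hid : PolyCirc (fun κ => κ) fun κ (a : (V κ).PP × (Bits (r κ) × Bits (r' κ))) => a :=
      PolyCirc.id
    intro b
    fin_cases b
    · exact g1.comp (hid.fst.pair hid.snd.fst)
    · exact g1'.comp (hid.fst.pair hid.snd.snd)
  · intro b Adv α D hD
    fin_cases b
    · obtain ⟨ν, h3, h4, h5⟩ := vdpf_private_bound h2 α D hD inferInstance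
      refine ⟨ν, h3, h4, fun κ a => ?_⟩
      have h6 : ∀ pp : (V κ).PP, (avg fun y : Bits (r κ) × Bits (r' κ) =>
          ind (D ⟨κ, a⟩ (pp, sim κ (pp, y.1)))) =
          avg fun y : Bits (r κ) => ind (D ⟨κ, a⟩ (pp, sim κ (pp, y))) :=
        fun pp => avg_fst (fun y : Bits (r κ) => ind (D ⟨κ, a⟩ (pp, sim κ (pp, y))))
      have h7 := h5 κ a
      simp only [← h6] at h7
      exact h7
    · obtain ⟨ν, h3, h4, h5⟩ := vdpf_private_bound h2' α D hD inferInstance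
      refine ⟨ν, h3, h4, fun κ a => ?_⟩
      have h6 : ∀ pp : (V κ).PP, (avg fun y : Bits (r κ) × Bits (r' κ) =>
          ind (D ⟨κ, a⟩ (pp, sim' κ (pp, y.2)))) =
          avg fun y : Bits (r' κ) => ind (D ⟨κ, a⟩ (pp, sim' κ (pp, y))) :=
        fun pp => avg_snd (fun y : Bits (r' κ) => ind (D ⟨κ, a⟩ (pp, sim' κ (pp, y))))
      have h7 := h5 κ a
      simp only [← h6] at h7
      exact h7

/-- All random choices of the hybrid execution except the public string and those for one slot:
`flag` tells for which of the other slots the view is simulated. -/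
structure HybridAdvice {κ : ℕ} {P : Params} {V : VDPF P} (E : Environment κ V) (Y : Type) where
  slot : Fin P.runs × Fin 2
  flag : Fin P.runs × Fin 2 → Bool
  coins : Fin P.runs × Fin 2 → V.Coins
  seeds : Fin P.runs × Fin 2 → Y
  point : Fin P.runs → Fin 2 → P.Idx
  shares : Fin P.runs → Fin 2 → P.Idx
  mask : Fin P.runs → P.K
  key : Bits κ
  key' : Bits κ
  r : Fin P.runs → P.K
  ec : Bits E.coinLen

/-- When everything except the public string and the coins of one slot is fixed, the hybrid
execution is an efficient test of a public string, a key and the partner's proof. The points remain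
in `src`, which is allowed because privacy holds for every fixed point; the partner's key is needed
nowhere. -/
theorem hybRun_private {Y : ℕ → Type} [∀ κ, BitEnc (Y κ)] [∀ κ, Fintype (Y κ)] [∀ κ, Nonempty (Y κ)]
    {sim : ∀ κ, Fin 2 → (V κ).PP × Y κ → (V κ).Key × (V κ).Proof}
    (hsim : ∀ b, PolyCirc (fun κ => κ) fun κ => sim κ b)
    (hpriv : ∀ (b : Fin 2) {Adv : ℕ → Type} (α : ∀ κ, Adv κ → (P κ).Idx)
        (D : ∀ x : Σ κ, Adv κ, (V x.1).PP × (V x.1).Key × (V x.1).Proof → Bool),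
        PolyCirc (fun x : Σ κ, Adv κ => x.1) (A := fun x => (V x.1).PP × (V x.1).Key × (V x.1).Proof)
          (B := fun _ => Bool) D →
        ∃ ν : ℕ → ℝ, Negligible ν ∧ (∀ κ, 0 ≤ ν κ) ∧ ∀ κ a,
          |(avg fun pp : (V κ).PP => avg fun x : (V κ).Coins =>
              ind (D ⟨κ, a⟩ (pp, (V κ).view pp b (α κ a) x))) -
            avg fun pp : (V κ).PP => avg fun y : Y κ =>
              ind (D ⟨κ, a⟩ (pp, sim κ b (pp, y)))| ≤ ν κ)
    {E : ∀ κ, Environment κ (V κ)} (hV : EffVDPF (fun κ => κ) V) (hE : EffEnv (fun κ => κ) E)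
    (c : Fin 3) :
    ∃ ν : ℕ → ℝ, Negligible ν ∧ (∀ κ, 0 ≤ ν κ) ∧ ∀ κ (α rb : Fin (P κ).runs → Fin 2 → (P κ).Idx)
      (mk : Fin (P κ).runs → (P κ).K) (key key' : Bits κ) (r : Fin (P κ).runs → (P κ).K)
      (ec : Bits (E κ).coinLen),
      |(avg fun pp : (V κ).PP => avg fun x : Fin (P κ).runs × Fin 2 → (V κ).Coins =>
          ind (hybRun (E κ) c pp key key' (fun k b => (V κ).view pp b (α k b) (x (k, b))) rb mk
            (fun k s b => α k b + s) r ec)) -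
        avg fun pp : (V κ).PP => avg fun y : Fin (P κ).runs × Fin 2 → Y κ =>
          ind (hybRun (E κ) c pp key key' (fun k b => sim κ b (pp, y (k, b))) rb mk
            (fun k s b => α k b + s) r ec)| ≤ ν κ := by
  let Adv : ℕ → Type := fun κ => HybridAdvice (E κ) (Y κ)
  have hpp := hV.pp
  have hkey := hV.key
  have hpf := hV.proofWires
  have hY : PolyWires (fun κ => κ) Y :=
    have := (hsim 0).left
    PolyWires.of_prod_right (A := fun κ => (V κ).PP)
  let A : (Σ κ, Adv κ) → Type := fun x => (V x.1).PP × (V x.1).Key × (V x.1).Proof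
  let kp : ∀ x : Σ κ, Adv κ, A x → Fin (P x.1).runs → Fin 2 → (V x.1).Key × (V x.1).Proof :=
    fun x a k b => if decide ((k, b) = x.2.slot) = true then a.2 else
      if x.2.flag (k, b) = true then sim x.1 b (a.1, x.2.seeds (k, b))
      else (V x.1).view a.1 b (x.2.point k b) (x.2.coins (k, b))
  have hA : PolyWires (fun x : Σ κ, Adv κ => x.1) A :=
    PolyWires.reindex (n := fun κ => κ) (A := fun κ => (V κ).PP × (V κ).Key × (V κ).Proof)
      inferInstance Sigma.fst
  have hid : PolyCirc (fun x : Σ κ, Adv κ => x.1) (A := A) (B := A) fun _ a => a := PolyCirc.id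
  have hkp : PolyCirc (fun x : Σ κ, Adv κ => x.1) (A := A)
      (B := fun x => Fin (P x.1).runs → Fin 2 → (V x.1).Key × (V x.1).Proof) kp := by
    refine PolyCirc.slots (B := fun x : Σ κ, Adv κ => (V x.1).Key × (V x.1).Proof)
      (hV.reindex Sigma.fst) fun b => ?_
    let N : (Σ x : (Σ κ, Adv κ), Fin (P x.1).runs) → ℕ := fun z => z.1.1
    have hA' : PolyWires N fun z => A z.1 := hA.reindex Sigma.fst
    have hY' : PolyWires N fun z => Y z.1.1 :=
      hY.reindex fun z : Σ x : (Σ κ, Adv κ), Fin (P x.1).runs => z.1.1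
    have hid' : PolyCirc N (A := fun z => A z.1) (B := fun z => A z.1) fun _ a => a := PolyCirc.id
    refine PolyCirc.ite (PolyCirc.const _) hid'.snd (PolyCirc.ite (PolyCirc.const _) ?_ ?_)
    · exact PolyCirc.comp ((hsim b).reindex
        fun z : Σ x : (Σ κ, Adv κ), Fin (P x.1).runs => z.1.1) (hid'.fst.pair (PolyCirc.const _))
    · exact (hV.reindex fun z : Σ x : (Σ κ, Adv κ), Fin (P x.1).runs => z.1.1).view b hid'.fst
        (fun z => z.1.2.point z.2 b) fun z => z.1.2.coins (z.2, b)
  have hD := (hE.reindex (Sigma.fst : (Σ κ, Adv κ) → ℕ)).hybRun (hV.reindex Sigma.fst) c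
    (key := fun x => x.2.key) (key' := fun x => x.2.key') (rb := fun x => x.2.shares)
    (mk := fun x => x.2.mask) (ρ := fun x => x.2.point) (r := fun x => x.2.r)
    (ec := fun x => x.2.ec) hid.fst hkp
  choose ν h1 h2 h3 using fun b => hpriv b (fun κ (a : Adv κ) => a.point a.slot.1 a.slot.2) _ hD
  -- One slot for each role in each selection.
  refine ⟨fun κ => ((P κ).runs : ℝ) * (ν 0 κ + ν 1 κ), ((h1 0).add (h1 1)).poly_mul hV.runs,
    fun κ => ?_, fun κ α rb mk key key' r ec => ?_⟩
  · have := h2 0 κ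
    have := h2 1 κ
    positivity
  · refine (avg_hybrid (fun pp v => ind (hybRun (E κ) c pp key key' (fun k b => v (k, b)) rb mk
      (fun k s b => α k b + s) r ec)) (fun pp j x => (V κ).view pp j.2 (α j.1 j.2) x)
      (fun pp j y => sim κ j.2 (pp, y)) (fun j => ν j.2 κ) fun j e x y => ?_).trans (le_of_eq ?_)
    · have h4 := h3 j.2 κ ⟨j, e, x, y, α, rb, mk, key, key', r, ec⟩
      simp only [kp, decide_eq_true_eq] at h4
      exact h4
    · rw [Fintype.sum_prod_type]
      simp only [Fin.sum_univ_two, Finset.sum_const, Finset.card_univ, Fintype.card_fin,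
        nsmul_eq_mul]

end

/-! ## Security when one party is corrupted -/

section
variable {A₁ A₂ A₃ A₄ A₅ A₆ A₇ A₈ : Type} [Fintype A₁] [Fintype A₂] [Fintype A₃] [Fintype A₄]
  [Fintype A₅] [Fintype A₆] [Fintype A₇] [Fintype A₈]

theorem avg_move_two (f : A₁ → A₂ → A₃ → A₄ → A₅ → A₆ → ℝ) :
    (avg fun a => avg fun b => avg fun c => avg fun d => avg fun e => avg fun g => f a b c d e g) =
      avg fun c => avg fun d => avg fun e => avg fun g => avg fun a => avg fun b =>
        f a b c d e g := by
  let e : A₃ × A₄ × A₅ × A₆ × A₁ × A₂ ≃ A₁ × A₂ × A₃ × A₄ × A₅ × A₆ :=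
    { toFun := fun ⟨c, d, e, g, a, b⟩ => ⟨a, b, c, d, e, g⟩
      invFun := fun ⟨a, b, c, d, e, g⟩ => ⟨c, d, e, g, a, b⟩
      left_inv := fun _ => rfl
      right_inv := fun _ => rfl }
  have h := avg_equiv e fun x => f x.1 x.2.1 x.2.2.1 x.2.2.2.1 x.2.2.2.2.1 x.2.2.2.2.2
  simp only [avg_prod] at h
  exact h.symm

theorem avg_ideal_order (f : A₁ → A₂ → A₃ → A₄ → A₅ → A₆ → A₇ → A₈ → ℝ) :
    (avg fun pp => avg fun key => avg fun key' => avg fun y => avg fun rb => avg fun α =>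
      avg fun r => avg fun ec => f pp key key' y rb α r ec) =
      avg fun key => avg fun key' => avg fun r => avg fun ec => avg fun pp => avg fun y =>
        avg fun rb => avg fun α => f pp key key' y rb α r ec := by
  let e : A₂ × A₃ × A₇ × A₈ × A₁ × A₄ × A₅ × A₆ ≃ A₁ × A₂ × A₃ × A₄ × A₅ × A₆ × A₇ × A₈ :=
    { toFun := fun ⟨key, key', r, ec, pp, y, rb, α⟩ => ⟨pp, key, key', y, rb, α, r, ec⟩
      invFun := fun ⟨pp, key, key', y, rb, α, r, ec⟩ => ⟨key, key', r, ec, pp, y, rb, α⟩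
      left_inv := fun _ => rfl
      right_inv := fun _ => rfl }
  have h := avg_equiv e fun x => f x.1 x.2.1 x.2.2.1 x.2.2.2.1 x.2.2.2.2.1 x.2.2.2.2.2.1
    x.2.2.2.2.2.2.1 x.2.2.2.2.2.2.2
  simp only [avg_prod] at h
  exact h.symm

end

/-! ### Matching the simulated view with the ideal execution -/

section
variable {κ : ℕ} {P : Params} {V : VDPF P}

theorem avg_update_key {Ω : Type} [Fintype Ω] (p : Fin 3) (g : RealCoins κ V × Ω → ℝ) :
    avg g = avg fun ω : RealCoins κ V × Ω => avg fun key : Bits κ =>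
      g ((ω.1.1, Function.update ω.1.2.1 p key, ω.1.2.2), ω.2) := by
  simp only [avg_prod]
  refine congrArg avg (funext fun pp => ?_)
  rw [← avg_update p]
  refine congrArg avg (funext fun keys => ?_)
  rw [avg_comm]
  refine congrArg avg (funext fun dc => ?_)
  rw [avg_comm]

/-- The environment is given only the keys `c` and `c - 1`, so the key `c + 1` affects nothing but
the masks. -/
theorem realRun_update_key (F : Bits κ → Bits κ → P.K) (sid : Fin P.runs → Bits κ)
    (E : Environment κ V) (c : Fin 3) (ω : RealCoins κ V) (ec : Bits E.coinLen) (key : Bits κ) :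
    realRun F sid E c ((ω.1, Function.update ω.2.1 (c + 1) key, ω.2.2), ec) =
      maskedRun E c ω (fun k p => if p = c + 1 then F key (sid k) else F (ω.2.1 p) (sid k)) ec := by
  rw [realRun_eq]
  have h : ∀ k, (fun p => F (Function.update ω.2.1 (c + 1) key p) (sid k)) =
      fun p => if p = c + 1 then F key (sid k) else F (ω.2.1 p) (sid k) := by
    intro k
    funext p
    by_cases hp : p = c + 1
    · subst hp
      simp
    · simp [hp]
  simp only [h, maskedRun, Function.update_of_ne (succ_party_ne c).symm,
    Function.update_of_ne (succ_party_ne_pred c).symm]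
  rfl

/-- The index shares of the corrupted party are independent of the dealt indices, which mask the
selected indices. -/
theorem avg_hybRun_points (E : Environment κ V) (c : Fin 3) (pp : V.PP) (key key' : Bits κ)
    (kp : Fin P.runs → Fin 2 → V.Key × V.Proof) (mk : Fin P.runs → P.K) (r : Fin P.runs → P.K)
    (ec : Bits E.coinLen) :
    (avg fun α : Fin P.runs × Fin 2 → P.Idx => avg fun α₀ : Fin P.runs × Fin 2 → P.Idx =>
      ind (hybRun E c pp key key' kp
        (fun k b => if b = 0 then α₀ (k, b) else α (k, b) - α₀ (k, b)) mk
        (fun k s b => α (k, b) + s) r ec)) =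
    avg fun rb : Fin P.runs × Fin 2 → P.Idx => avg fun α : Fin P.runs × Fin 2 → P.Idx =>
      ind (hybRun E c pp key key' kp (fun k b => rb (k, b)) mk (fun k _ b => α (k, b)) r ec) := by
  have h1 : ∀ α : Fin P.runs × Fin 2 → P.Idx,
      (avg fun α₀ : Fin P.runs × Fin 2 → P.Idx => ind (hybRun E c pp key key' kp
        (fun k b => if b = 0 then α₀ (k, b) else α (k, b) - α₀ (k, b)) mk
        (fun k s b => α (k, b) + s) r ec)) =
      avg fun rb : Fin P.runs × Fin 2 → P.Idx => ind (hybRun E c pp key key' kp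
        (fun k b => rb (k, b)) mk (fun k s b => α (k, b) + s) r ec) := by
    intro α
    -- For a fixed dealt index, `α₀` itself is the share for role 0, and the share for role 1 is its
    -- reflection; both are bijective images of a uniform value. Hence the share is independent of
    -- the dealt index, which remains free to mask the selected one.
    rw [← avg_pi_equiv fun j => if j.2 = 0 then Equiv.refl P.Idx else Equiv.subLeft (α j)]
    refine congrArg avg (funext fun α₀ => ?_)
    congr 2
    funext k b
    by_cases hb : b = 0 <;> simp [hb]
  simp only [h1]
  rw [avg_comm]
  refine congrArg avg (funext fun rb => ?_)
  have h2 := avg_hybRun_shift E c pp key key' kp (fun k b => rb (k, b)) mk r ec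
  rw [avg_uncurry, avg_uncurry fun x : Fin P.runs → Fin 2 → P.Idx => ind (hybRun E c pp key key' kp
    (fun k b => rb (k, b)) mk (fun k _ => x k) r ec)] at h2
  exact h2

/-- The execution with the simulated view, when the dealt indices mask the selected indices. -/
theorem prob_idealRun {Y : Type} [BitEnc Y] [BitEncBij Y] [Fintype Y]
    (sim : Fin 2 → V.PP × Y → V.Key × V.Proof) (F : Bits κ → Bits κ → P.K)
    (sid : Fin P.runs → Bits κ) (E : Environment κ V) (c : Fin 3) :
    prob (idealRun E (simulator sim F sid) c) =
      avg fun q : (Bits κ × Bits κ) × (Fin P.runs × Fin 2 → P.Idx) × (Fin P.runs × Fin 2 → P.Idx) ×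
          (Fin P.runs → P.K) × Bits E.coinLen =>
        avg fun pp : V.PP => avg fun y : Fin P.runs × Fin 2 → Y =>
          ind (hybRun E c pp q.1.1 q.1.2 (fun k b => sim b (pp, y (k, b)))
            (fun k b => if b = 0 then q.2.2.1 (k, b) else q.2.1 (k, b) - q.2.2.1 (k, b))
            (simMask F sid q.1) (fun k s b => q.2.1 (k, b) + s) q.2.2.2.1 q.2.2.2.2) := by
  have h1 : prob (idealRun E (simulator sim F sid) c) =
      avg fun ω : (V.PP × SimCoins κ P Y × (Fin P.runs → P.K)) × Bits E.coinLen =>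
        ind (hybRun E c ω.1.1 ω.1.2.1.1.1 ω.1.2.1.1.2 (simView sim ω.1.1 ω.1.2.1.2)
          (simShares ω.1.2.1.2) (simMask F sid ω.1.2.1.1) (fun k _ => simDelta ω.1.2.1.2 k)
          ω.1.2.2 ω.2) := by
    rw [prob_eq_avg]
    -- The coins of the simulator are bit strings; the bijection `toBits` replaces them by uniform
    -- structured coins.
    let e : (V.PP × SimCoins κ P Y × (Fin P.runs → P.K)) × Bits E.coinLen ≃
        IdealCoins (simulator sim F sid) × Bits E.coinLen :=
      ((Equiv.refl _).prodCongr ((toBits (SimCoins κ P Y)).prodCongr (Equiv.refl _))).prodCongr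
        (Equiv.refl _)
    rw [← avg_equiv e]
    refine congrArg avg (funext fun ω => ?_)
    rw [← idealRun_eq]
    rfl
  rw [h1]
  simp only [avg_prod]
  have h2 : ∀ key key' : Bits κ, (avg fun α : Fin P.runs × Fin 2 → P.Idx =>
      avg fun α₀ : Fin P.runs × Fin 2 → P.Idx => avg fun r : Fin P.runs → P.K =>
      avg fun ec : Bits E.coinLen => avg fun pp : V.PP => avg fun y : Fin P.runs × Fin 2 → Y =>
        ind (hybRun E c pp key key' (fun k b => sim b (pp, y (k, b)))
          (fun k b => if b = 0 then α₀ (k, b) else α (k, b) - α₀ (k, b))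
          (simMask F sid (key, key')) (fun k s b => α (k, b) + s) r ec)) =
      avg fun r : Fin P.runs → P.K => avg fun ec : Bits E.coinLen => avg fun pp : V.PP =>
      avg fun y : Fin P.runs × Fin 2 → Y => avg fun rb : Fin P.runs × Fin 2 → P.Idx =>
      avg fun α : Fin P.runs × Fin 2 → P.Idx =>
        ind (hybRun E c pp key key' (fun k b => sim b (pp, y (k, b))) (fun k b => rb (k, b))
          (simMask F sid (key, key')) (fun k _ b => α (k, b)) r ec) := by
    intro key key'
    rw [avg_move_two]
    simp only [avg_hybRun_points]
  simp only [h2]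
  rw [← avg_ideal_order]
  refine congrArg avg (funext fun pp => congrArg avg (funext fun key => congrArg avg
    (funext fun key' => ?_)))
  rw [avg_uncurry, avg_pi_prod]
  refine congrArg avg (funext fun y => ?_)
  rw [avg_pi_prod]
  rfl

end

section
variable {A₁ A₂ A₃ A₄ A₅ A₆ A₇ A₈ : Type} [Fintype A₁] [Fintype A₂] [Fintype A₃] [Fintype A₄]
  [Fintype A₅] [Fintype A₆] [Fintype A₇] [Fintype A₈]

theorem avg_real_order (f : A₁ → A₂ → A₃ → A₄ → A₅ → A₆ → A₇ → A₈ → ℝ) :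
    (avg fun pp => avg fun key => avg fun key' => avg fun α => avg fun α₀ => avg fun x =>
      avg fun ec => avg fun r => f pp key key' α α₀ x ec r) =
      avg fun key => avg fun key' => avg fun α => avg fun α₀ => avg fun r => avg fun ec =>
        avg fun pp => avg fun x => f pp key key' α α₀ x ec r := by
  let e : A₂ × A₃ × A₄ × A₅ × A₈ × A₇ × A₁ × A₆ ≃ A₁ × A₂ × A₃ × A₄ × A₅ × A₆ × A₇ × A₈ :=
    { toFun := fun ⟨key, key', α, α₀, r, ec, pp, x⟩ => ⟨pp, key, key', α, α₀, x, ec, r⟩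
      invFun := fun ⟨pp, key, key', α, α₀, x, ec, r⟩ => ⟨key, key', α, α₀, r, ec, pp, x⟩
      left_inv := fun _ => rfl
      right_inv := fun _ => rfl }
  have h := avg_equiv e fun x => f x.1 x.2.1 x.2.2.1 x.2.2.2.1 x.2.2.2.2.1 x.2.2.2.2.2.1
    x.2.2.2.2.2.2.1 x.2.2.2.2.2.2.2
  simp only [avg_prod] at h
  exact h.symm

/-- The two keys that the corrupted party knows. -/
theorem avg_keys {X : Type} [Fintype X] [Nonempty X] (c : Fin 3) (g : X → X → ℝ) :
    (avg fun keys : Fin 3 → X => g (keys c) (keys (c - 1))) =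
      avg fun key => avg fun key' => g key key' := by
  have h := avg_comp_injective (X := X) (pairOf c) (pairOf_injective c) fun y => g (y 0) (y 1)
  simp only [pairOf_zero, pairOf_one] at h
  rw [h, ← avg_equiv (finTwoArrowEquiv X).symm, avg_prod]
  rfl

/-- The random choices of the honest dealers for the corrupted party. -/
theorem avg_dealers {n : ℕ} {X : Type} [Fintype X] [Nonempty X] (c : Fin 3)
    (g : (Fin n → Fin 2 → X) → ℝ) :
    (avg fun dc : Fin n → Fin 3 → X => g fun k b => dc k (pairOf c b)) =
      avg fun x : Fin n × Fin 2 → X => g fun k b => x (k, b) := by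
  rw [avg_uncurry]
  refine avg_comp_injective (X := X) (fun j : Fin n × Fin 2 => (j.1, pairOf c j.2)) ?_
    fun x => g fun k b => x (k, b)
  rintro ⟨k, b⟩ ⟨k', b'⟩ h
  simp only [Prod.mk.injEq] at h
  exact Prod.ext h.1 (pairOf_injective c h.2)

end

/-- The coins that the hybrid execution does not read, namely the third PRF key and the honest
dealer's coins for pair `c + 1`, are averaged out. The public string and the VDPF coins are moved
innermost, where privacy acts on them. -/
theorem avg_hybRun_honest {κ : ℕ} {P : Params} {V : VDPF P} (F : Bits κ → Bits κ → P.K)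
    (sid : Fin P.runs → Bits κ) (E : Environment κ V) (c : Fin 3) :
    (avg fun ω : RealCoins κ V × Bits E.coinLen => avg fun r : Fin P.runs → P.K =>
      ind (hybRun E c ω.1.1 (ω.1.2.1 c) (ω.1.2.1 (c - 1))
        (honestView V ω.1.1 fun k b => ω.1.2.2 k (pairOf c b))
        (honestShares (V := V) fun k b => ω.1.2.2 k (pairOf c b))
        (simMask F sid (ω.1.2.1 c, ω.1.2.1 (c - 1)))
        (fun k s b => (ω.1.2.2 k (pairOf c b)).1 + s) r ω.2)) =
    avg fun q : (Bits κ × Bits κ) × (Fin P.runs × Fin 2 → P.Idx) × (Fin P.runs × Fin 2 → P.Idx) ×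
        (Fin P.runs → P.K) × Bits E.coinLen =>
      avg fun pp : V.PP => avg fun x : Fin P.runs × Fin 2 → V.Coins =>
        ind (hybRun E c pp q.1.1 q.1.2 (fun k b => V.view pp b (q.2.1 (k, b)) (x (k, b)))
          (fun k b => if b = 0 then q.2.2.1 (k, b) else q.2.1 (k, b) - q.2.2.1 (k, b))
          (simMask F sid q.1) (fun k s b => q.2.1 (k, b) + s) q.2.2.2.1 q.2.2.2.2) := by
  simp only [avg_prod]
  rw [← avg_real_order]
  refine congrArg avg (funext fun pp => ?_)
  let G : (Fin P.runs → Fin 2 → P.Idx × P.Idx × V.Coins) → Bits κ → Bits κ → ℝ :=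
    fun x key key' => avg fun ec : Bits E.coinLen => avg fun r : Fin P.runs → P.K =>
      ind (hybRun E c pp key key' (honestView V pp x) (honestShares x)
        (simMask F sid (key, key')) (fun k s b => (x k b).1 + s) r ec)
  have h1 : (avg fun keys : Fin 3 → Bits κ =>
      avg fun dc : Fin P.runs → Fin 3 → P.Idx × P.Idx × V.Coins =>
        G (fun k b => dc k (pairOf c b)) (keys c) (keys (c - 1))) =
      avg fun key => avg fun key' => avg fun dc : Fin P.runs → Fin 3 → P.Idx × P.Idx × V.Coins =>
        G (fun k b => dc k (pairOf c b)) key key' :=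
    avg_keys c fun key key' => avg fun dc : Fin P.runs → Fin 3 → P.Idx × P.Idx × V.Coins =>
      G (fun k b => dc k (pairOf c b)) key key'
  refine h1.trans (congrArg avg (funext fun key => congrArg avg (funext fun key' => ?_)))
  rw [avg_dealers c fun x => G x key key', avg_pi_prod]
  refine congrArg avg (funext fun α => ?_)
  rw [avg_pi_prod]
  rfl

/-! ### The chain of experiments for a corrupted party -/

section
variable {P : ℕ → Params} {V : ∀ κ, VDPF (P κ)}

theorem corrupted_secure (hm : PolyBounded fun κ => 2 ^ (P κ).ellm)
    (hell : PolyBounded fun κ => (P κ).ell) (hruns : PolyBounded fun κ => (P κ).runs)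
    (hV : IsSecureVDPF V) {F : ∀ κ, Bits κ → Bits κ → (P κ).K} (hF : IsSecurePRF F)
    (sid : ∀ κ, Fin (P κ).runs → Bits κ)
    (hsid : ∀ᶠ κ in Filter.atTop, Function.Injective (sid κ)) (c : Fin 3) :
    ∃ S : ∀ κ, Simulator κ (V κ), (∃ p : Polynomial ℕ, ∀ κ, (S κ).Bounded (p.eval κ)) ∧
      ∀ E : ∀ κ, Environment κ (V κ), (∃ p : Polynomial ℕ, ∀ κ, (E κ).Bounded (p.eval κ)) →
        Negligible fun κ =>
          |prob (realRun (F κ) (sid κ) (E κ) c) - prob (idealRun (E κ) (S κ) c)| := by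
  obtain ⟨heff, hcor, hpriv, hver⟩ := hV
  have hV' := effVDPF_of_secure hm hell hruns heff
  obtain ⟨r, r', sim, hsim, hpriv'⟩ := exists_view_simulator hpriv hV'
  refine ⟨fun κ => simulator (sim κ) (F κ) (sid κ), simulator_bounded hV' hsim hF.1,
    fun E hE => ?_⟩
  have hE' := effEnv_of_bounded hE
  obtain ⟨ν₁, g1, p1, b1⟩ := maskedRun_prf hF hV' hE' sid c
  obtain ⟨ν₂, g2, p2, b2⟩ := maskedRun_hyb hcor hver (F := F) hV' hE' sid c
  obtain ⟨ν₃, g3, p3, b3⟩ := hybRun_private hsim hpriv' hV' hE' c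
  -- The three errors come from the PRF, from incorrect or unverifiable keys, and from privacy; the
  -- last experiment equals the ideal one exactly. Injectivity of the session identifiers for large
  -- `κ` is enough, since negligibility is asymptotic.
  refine ((g1.add g2).add g3).mono (hsid.mono fun κ hκ => ?_)
  rw [abs_abs]
  refine le_trans ?_ (le_abs_self _)
  have h1 : prob (realRun (F κ) (sid κ) (E κ) c) =
      avg fun ω : RealCoins κ (V κ) × Bits (E κ).coinLen => avg fun key : Bits κ =>
        ind (maskedRun (E κ) c ω.1 (fun k p => if p = c + 1 then F κ key (sid κ k)
          else F κ (ω.1.2.1 p) (sid κ k)) ω.2) := by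
    rw [prob_eq_avg, avg_update_key (c + 1)]
    simp only [realRun_update_key]
  rw [h1, prob_idealRun]
  refine (abs_sub_le _ _ _).trans (add_le_add ((abs_sub_le _ _ _).trans (add_le_add
    (abs_avg_sub_le_const fun ω => b1 κ ω.1 ω.2 (fun k p => F κ (ω.1.2.1 p) (sid κ k)) hκ)
    (b2 κ))) ?_)
  rw [avg_hybRun_honest]
  exact abs_avg_sub_le_const fun q => b3 κ (fun k b => q.2.1 (k, b))
    (fun k b => if b = 0 then q.2.2.1 (k, b) else q.2.1 (k, b) - q.2.2.1 (k, b))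
    (simMask (F κ) (sid κ) q.1) q.1.1 q.1.2 q.2.2.2.1 q.2.2.2.2

end

/-! ## Security when no party is corrupted -/

section
variable {κ : ℕ} {P : Params} {V : VDPF P}

/-- A selection of the honest execution with arbitrary masks. -/
def honestMaskedSelect (E : HonestEnvironment V) (pp : V.PP) (d : Fin 3 → Fin 2 → V.Deal)
    (mask : Fin 3 → P.K) (k : Fin P.runs) (st : Bits E.stateLen) : Bits E.stateLen × Bool :=
  (E.output k ((E.input k st).1, rssPair (V.reshareMsg pp d (E.input k st).2.1
    (fun i => (d i 0).2 + (d i 1).2 + ∑ p, (E.input k st).2.2 p) mask)), true)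

/-- The honest execution with arbitrary masks and without the checks. -/
def honestMaskedRun (E : HonestEnvironment V) (ω : RealCoins κ V) (mask : Fin P.runs → Fin 3 → P.K)
    (ec : Bits E.coinLen) : Bool :=
  E.decision (runSteps P.runs (fun k => honestMaskedSelect E ω.1
    (fun i => V.honestDeal ω.1 (ω.2.2 k i)) (mask k) k) (E.setup (ec, ω.1)))

/-- The dealt keys share a point function and are accepted. -/
def VDPF.GoodDeals (V : VDPF P) (ω : RealCoins κ V) : Prop :=
  ∀ k i, V.Shares ω.1 (V.gen ω.1 (ω.2.2 k i).1 1 (ω.2.2 k i).2.2) (ω.2.2 k i).1 1 ∧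
    V.Accepts ω.1 (V.gen ω.1 (ω.2.2 k i).1 1 (ω.2.2 k i).2.2)

theorem honestRealRun_eq (F : Bits κ → Bits κ → P.K) (sid : Fin P.runs → Bits κ)
    (E : HonestEnvironment V) (ω : RealCoins κ V) (ec : Bits E.coinLen) (h : V.GoodDeals ω) :
    honestRealRun F sid E (ω, ec) = honestMaskedRun E ω (fun k p => F (ω.2.1 p) (sid k)) ec := by
  unfold honestRealRun honestMaskedRun
  have hsel : honestSelect F sid E ω (fun k i => V.honestDeal ω.1 (ω.2.2 k i)) =
      fun k => honestMaskedSelect E ω.1 (fun i => V.honestDeal ω.1 (ω.2.2 k i))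
        (fun p => F (ω.2.1 p) (sid k)) k := by
    funext k st
    simp only [honestSelect, honestMaskedSelect, reconstruct_deltaRSS]
  simp only [hsel]
  refine if_pos fun k => ⟨fun i => (h k i).2, fun i => ?_⟩
  have := GoodPair_checks (honestDeal_goodPair (h k i).1)
  exact ⟨congrArg Prod.fst this, congrArg Prod.snd this⟩

/-- With the third mask fixed, the first two messages are `u + y₀` and `v + y₁ - y₀`, where `u` and
`v` depend only on the state. This is a bijective image of the two uniform masks, and the third
message follows from the sum. -/
theorem avg_honestMaskedRun (E : HonestEnvironment V) (ω : RealCoins κ V) (h : V.GoodDeals ω)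
    (m : Fin P.runs → P.K) (ec : Bits E.coinLen) :
    (avg fun y₀ : Fin P.runs → P.K => avg fun y₁ : Fin P.runs → P.K =>
      ind (honestMaskedRun E ω
        (fun k p => if p = 1 then y₁ k else if p = 0 then y₀ k else m k) ec)) =
    avg fun r : Fin P.runs → P.K × P.K => ind (honestIdealRun E ((ω.1, r), ec)) := by
  rw [← avg_pi_prod fun y : Fin P.runs → P.K × P.K => ind (honestMaskedRun E ω
    (fun k p => if p = 1 then (y k).2 else if p = 0 then (y k).1 else m k) ec)]
  let z : Fin P.runs → Bits E.stateLen → P.K × P.K → Fin 3 → P.K := fun k st y =>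
    V.reshareMsg ω.1 (fun i => V.honestDeal ω.1 (ω.2.2 k i)) (E.input k st).2.1
      (fun i => (V.honestDeal ω.1 (ω.2.2 k i) 0).2 + (V.honestDeal ω.1 (ω.2.2 k i) 1).2 +
        ∑ p, (E.input k st).2.2 p) (fun p => if p = 1 then y.2 else if p = 0 then y.1 else m k)
  have hz : ∀ k st y, z k st y = ![z k st y 0, z k st y 1,
      selected (E.input k st).2.1 (E.input k st).2.2 - z k st y 0 - z k st y 1] := by
    intro k st y
    have h1 := reshareMsg_sum (fun i => honestDeal_goodPair (h k i).1) (E.input k st).2.1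
      (∑ p, (E.input k st).2.2 p) (fun p => if p = 1 then y.2 else if p = 0 then y.1 else m k)
    have h2 : selected (E.input k st).2.1 (E.input k st).2.2 =
        z k st y 0 + z k st y 1 + z k st y 2 := by
      rw [selected, ← h1, Fin.sum_univ_three]
    rw [h2]
    funext p
    fin_cases p
    · rfl
    · rfl
    · change z k st y 2 = z k st y 0 + z k st y 1 + z k st y 2 - z k st y 0 - z k st y 1
      ring
  refine Eq.trans ?_ (avg_foldl_bijective
    (fun k (a : Bits E.stateLen × Bool) (r : P.K × P.K) => if a.2 = true then
      (E.output k ((E.input k a.1).1, rssPair ![r.1, r.2,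
        selected (E.input k a.1).2.1 (E.input k a.1).2.2 - r.1 - r.2]), true) else a)
    (fun k a y => (z k a.1 y 0, z k a.1 y 1)) (fun k a => ?_) (fun a => ind (E.decision a))
    (E.setup (ec, ω.1), true))
  · refine congrArg avg (funext fun y => ?_)
    simp only [honestMaskedRun, runSteps, honestMaskedSelect]
    congr 3
    funext a k
    refine if_congr Iff.rfl ?_ rfl
    rw [← hz]
  · let u := z k a.1 (0, 0) 0
    let v := z k a.1 (0, 0) 1
    have hu : ∀ y, z k a.1 y 0 = u + y.1 := fun y => by
      simp only [u, z, VDPF.reshareMsg]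
      simp only [show ¬ ((0 : Fin 3) = 1) by decide, show ¬ ((0 : Fin 3) - 1 = 1) by decide,
        show ¬ ((0 : Fin 3) - 1 = 0) by decide, if_true, if_false]
      ring
    have hv : ∀ y, z k a.1 y 1 = v + y.2 - y.1 := fun y => by
      simp only [v, z, VDPF.reshareMsg]
      simp only [show ((1 : Fin 3) - 1 = 0) by decide,
        show ¬ ((0 : Fin 3) = 1) by decide, if_true, if_false]
      ring
    simp only [hu, hv]
    refine Function.bijective_iff_has_inverse.2
      ⟨fun w => (w.1 - u, w.2 - v + (w.1 - u)), fun y => ?_, fun w => ?_⟩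
    · refine Prod.ext ?_ ?_ <;> simp only <;> ring
    · refine Prod.ext ?_ ?_ <;> simp only <;> ring

end

/-! ### The chain of experiments without corruption -/

section
variable {P : ℕ → Params} {V : ∀ κ, VDPF (P κ)}

/-- Stated for arbitrary experiments because it is used twice: to drop the checks under real masks,
and to use the sum of the messages under random masks. -/
theorem goodDeals_bound (hcor : VDPFCorrect V) (hruns : PolyBounded fun κ => (P κ).runs)
    {Ω : ℕ → Type} [∀ κ, Fintype (Ω κ)] [∀ κ, Nonempty (Ω κ)] :
    ∃ ν : ℕ → ℝ, Negligible ν ∧ (∀ κ, 0 ≤ ν κ) ∧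
      ∀ κ (f g : RealCoins κ (V κ) × Ω κ → ℝ), (∀ ω, |f ω - g ω| ≤ 1) →
        (∀ ω, (V κ).GoodDeals ω.1 → f ω = g ω) → |avg f - avg g| ≤ ν κ := by
  classical
  obtain ⟨ν, h1, h2, h3⟩ := honestDeal_bound hcor
  refine ⟨fun κ => ((P κ).runs : ℝ) * (3 * ν κ), (h1.const_mul 3).poly_mul hruns,
    fun κ => ?_, fun κ f g hfg h => ?_⟩
  · have := h2 κ
    positivity
  · refine (abs_avg_sub_le_sum (J := Fin (P κ).runs × Fin 3) (ν := fun _ => ν κ)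
      (bad := fun j ω => decide (¬ ((V κ).Shares ω.1.1
        ((V κ).gen ω.1.1 (ω.1.2.2 j.1 j.2).1 1 (ω.1.2.2 j.1 j.2).2.2) (ω.1.2.2 j.1 j.2).1 1 ∧
        (V κ).Accepts ω.1.1 ((V κ).gen ω.1.1 (ω.1.2.2 j.1 j.2).1 1 (ω.1.2.2 j.1 j.2).2.2))))
      hfg (fun ω hω => h ω fun k i => ?_) fun j => ?_).trans (le_of_eq ?_)
    · simpa only [decide_eq_false_iff_not, not_not] using hω (k, i)
    · exact (avg_slot j.1 j.2 fun pp z => ind (decide (¬ ((V κ).Shares pp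
        ((V κ).gen pp z.1 1 z.2.2) z.1 1 ∧ (V κ).Accepts pp ((V κ).gen pp z.1 1 z.2.2))))).trans_le
        (h3 κ)
    · simp only [Finset.sum_const, Finset.card_univ, Fintype.card_prod, Fintype.card_fin,
        nsmul_eq_mul, Nat.cast_mul, Nat.cast_ofNat, mul_assoc]

theorem honestMaskedRun_prf {F : ∀ κ, Bits κ → Bits κ → (P κ).K} (hF : IsSecurePRF F)
    {E : ∀ κ, HonestEnvironment (V κ)} (hV : EffVDPF (fun κ => κ) V)
    (hE : ∃ p : Polynomial ℕ, ∀ κ, (E κ).Bounded (p.eval κ))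
    (sid : ∀ κ, Fin (P κ).runs → Bits κ) (q : Fin 3) :
    ∃ ν : ℕ → ℝ, Negligible ν ∧ (∀ κ, 0 ≤ ν κ) ∧ ∀ κ (ω : RealCoins κ (V κ))
      (ec : Bits (E κ).coinLen) (m : Fin (P κ).runs → Fin 3 → (P κ).K),
      Function.Injective (sid κ) →
      |(avg fun key : Bits κ => ind (honestMaskedRun (E κ) ω
          (fun k p => if p = q then F κ key (sid κ k) else m k p) ec)) -
        avg fun y : Fin (P κ).runs → (P κ).K => ind (honestMaskedRun (E κ) ω
          (fun k p => if p = q then y k else m k p) ec)| ≤ ν κ := by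
  obtain ⟨p, hp⟩ := hE
  let Adv : ℕ → Type := fun κ =>
    RealCoins κ (V κ) × Bits (E κ).coinLen × (Fin (P κ).runs → Fin 3 → (P κ).K)
  have hdec : PolyCirc (fun κ => κ) fun κ => (E κ).decision :=
    PolyCirc.of_hasCircuit ⟨p, fun κ => (hp κ).2.2.2⟩
  have hinput : PolyCirc (fun x : Σ κ, Fin (P κ).runs => x.1)
      (A := fun x => Bits (E x.1).stateLen)
      (B := fun x => Bits (E x.1).stateLen × (Fin 3 → (P x.1).Idx → (P x.1).K) ×
        (Fin 3 → (P x.1).Idx)) (fun x => (E x.1).input x.2) :=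
    PolyCirc.of_hasCircuit ⟨p, fun x => (hp x.1).2.1 x.2⟩
  have houtput : PolyCirc (fun x : Σ κ, Fin (P κ).runs => x.1)
      (A := fun x => Bits (E x.1).stateLen × (Fin 3 → (P x.1).K × (P x.1).K))
      (B := fun x => Bits (E x.1).stateLen) (fun x => (E x.1).output x.2) :=
    PolyCirc.of_hasCircuit ⟨p, fun x => (hp x.1).2.2.1 x.2⟩
  let step : ∀ x : Σ κ, Adv κ, Fin (P x.1).runs → Bits (E x.1).stateLen × (P x.1).K →
      Bits (E x.1).stateLen × Bool := fun x k a =>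
    honestMaskedSelect (E x.1) x.2.1.1 (fun i => (V x.1).honestDeal x.2.1.1 (x.2.1.2.2 k i))
      (fun p => if p = q then a.2 else x.2.2.2 k p) k a.1
  let N : (Σ x : (Σ κ, Adv κ), Fin (P x.1).runs) → ℕ := fun z => z.1.1
  have hstep : PolyCirc N (A := fun z => Bits (E z.1.1).stateLen × (P z.1.1).K)
      (B := fun z => Bits (E z.1.1).stateLen × Bool) (fun z => step z.1 z.2) := by
    have hst : PolyWires (fun κ => κ) fun κ => Bits (E κ).stateLen :=
      have := hdec.left
      PolyWires.of_prod_left (B := fun _ => Bool)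
    have hw : PolyWires N (fun z => Bits (E z.1.1).stateLen × (P z.1.1).K) := by
      have := hV.field
      exact PolyWires.reindex (n := fun κ => κ) (A := fun κ => Bits (E κ).stateLen × (P κ).K)
        inferInstance (fun z : Σ x : (Σ κ, Adv κ), Fin (P x.1).runs => z.1.1)
    have hK : PolyWires N (fun z => (P z.1.1).K) :=
      hV.field.reindex (fun z : Σ x : (Σ κ, Adv κ), Fin (P x.1).runs => z.1.1)
    have hI : PolyWires N (fun z => (P z.1.1).Idx) :=
      hV.idx.reindex (fun z : Σ x : (Σ κ, Adv κ), Fin (P x.1).runs => z.1.1)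
    have hid : PolyCirc N (A := fun z => Bits (E z.1.1).stateLen × (P z.1.1).K)
        (B := fun z => Bits (E z.1.1).stateLen × (P z.1.1).K) (fun _ a => a) := PolyCirc.id
    have hmask : PolyCirc N (A := fun z => Bits (E z.1.1).stateLen × (P z.1.1).K)
        (B := fun z => Fin 3 → (P z.1.1).K)
        (fun z a p => if p = q then a.2 else z.1.2.2.2 z.2 p) := by
      refine PolyCirc.piFinite fun p => ?_
      by_cases hp : p = q
      · simp only [hp, if_true]
        exact hid.snd
      · simp only [hp, if_false]
        exact PolyCirc.const _
    have hin := (hinput.reindex fun z : Σ x : (Σ κ, Adv κ), Fin (P x.1).runs =>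
      (⟨z.1.1, z.2⟩ : Σ κ, Fin (P κ).runs)).comp hid.fst
    have hs : PolyCirc N (A := fun z => Bits (E z.1.1).stateLen × (P z.1.1).K)
        (B := fun z => (P z.1.1).Idx)
        (fun z a => ∑ p, ((E z.1.1).input z.2 a.1).2.2 p) :=
      PolyCirc.sumFin fun p => hin.snd.snd.apply fun _ => p
    have hz := fun p : Fin 3 =>
      (hV.reindex fun z : Σ x : (Σ κ, Adv κ), Fin (P x.1).runs => z.1.1).reshareMsg
        (pp := fun z => z.1.2.1.1)
        (d := fun z i => (V z.1.1).honestDeal z.1.2.1.1 (z.1.2.1.2.2 z.2 i))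
        hin.snd.fst hs hmask p
    have hout := (houtput.reindex fun z : Σ x : (Σ κ, Adv κ), Fin (P x.1).runs =>
      (⟨z.1.1, z.2⟩ : Σ κ, Fin (P κ).runs)).comp
      (hin.fst.pair (PolyCirc.piFinite fun p => (hz p).pair (hz (p - 1))))
    exact hout.pair (PolyCirc.const fun _ => true)
  obtain ⟨ν, h1, h2, h3⟩ := prf_bound hF (m := fun κ => (P κ).runs) hV.runs sid (Adv := Adv)
    (len := fun x => (E x.1).stateLen) (step := step) (dec := fun x => (E x.1).decision)
    (fun x => (E x.1).setup (x.2.2.1, x.2.1.1)) hstep (hdec.reindex Sigma.fst)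
  exact ⟨ν, h1, h2, fun κ ω ec m hinj => h3 κ (ω, ec, m) hinj⟩

theorem abs_ind_sub_le_one (a b : Bool) : |ind a - ind b| ≤ 1 := by
  cases a <;> cases b <;> simp [ind]

theorem honest_secure (hm : PolyBounded fun κ => 2 ^ (P κ).ellm)
    (hell : PolyBounded fun κ => (P κ).ell) (hruns : PolyBounded fun κ => (P κ).runs)
    (hV : IsSecureVDPF V) {F : ∀ κ, Bits κ → Bits κ → (P κ).K} (hF : IsSecurePRF F)
    (sid : ∀ κ, Fin (P κ).runs → Bits κ)
    (hsid : ∀ᶠ κ in Filter.atTop, Function.Injective (sid κ))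
    (E : ∀ κ, HonestEnvironment (V κ)) (hE : ∃ p : Polynomial ℕ, ∀ κ, (E κ).Bounded (p.eval κ)) :
    Negligible fun κ =>
      |prob (honestRealRun (F κ) (sid κ) (E κ)) - prob (honestIdealRun (E κ))| := by
  have hV' := effVDPF_of_secure hm hell hruns hV.1
  obtain ⟨ν₁, g1, p1, b1⟩ := goodDeals_bound hV.2.1 hruns (Ω := fun κ => Bits (E κ).coinLen)
  obtain ⟨ν₂, g2, p2, b2⟩ := honestMaskedRun_prf hF hV' hE sid 0
  obtain ⟨ν₃, g3, p3, b3⟩ := honestMaskedRun_prf hF hV' hE sid 1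
  refine ((g1.add g2).add (g3.add g1)).mono (hsid.mono fun κ hκ => ?_)
  rw [abs_abs]
  refine le_trans ?_ (le_abs_self _)
  have h1 : (avg fun ω : RealCoins κ (V κ) × Bits (E κ).coinLen =>
      ind (honestMaskedRun (E κ) ω.1 (fun k p => F κ (ω.1.2.1 p) (sid κ k)) ω.2)) =
      avg fun ω : RealCoins κ (V κ) × Bits (E κ).coinLen => avg fun key : Bits κ =>
        ind (honestMaskedRun (E κ) ω.1 (fun k p => if p = 0 then F κ key (sid κ k)
          else F κ (ω.1.2.1 p) (sid κ k)) ω.2) := by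
    rw [avg_update_key 0]
    refine congrArg avg (funext fun ω => congrArg avg (funext fun key => ?_))
    have h : ∀ k p, F κ (Function.update ω.1.2.1 0 key p) (sid κ k) =
        if p = 0 then F κ key (sid κ k) else F κ (ω.1.2.1 p) (sid κ k) := by
      intro k p
      by_cases hp : p = 0
      · subst hp
        simp
      · simp [hp]
    simp only [h]
    rfl
  -- The second PRF step replaces key 1. Key 2 is never replaced: two random masks already randomize
  -- the sharing, and the values under key 2 become constants in the change of variables.
  have h2 : (avg fun ω : RealCoins κ (V κ) × Bits (E κ).coinLen =>
      avg fun y : Fin (P κ).runs → (P κ).K =>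
        ind (honestMaskedRun (E κ) ω.1 (fun k p => if p = 0 then y k
          else F κ (ω.1.2.1 p) (sid κ k)) ω.2)) =
      avg fun ω : RealCoins κ (V κ) × Bits (E κ).coinLen =>
        avg fun y : Fin (P κ).runs → (P κ).K => avg fun key : Bits κ =>
        ind (honestMaskedRun (E κ) ω.1 (fun k p => if p = 1 then F κ key (sid κ k) else
          if p = 0 then y k else F κ (ω.1.2.1 2) (sid κ k)) ω.2) := by
    rw [avg_update_key 1]
    refine congrArg avg (funext fun ω => ?_)
    rw [avg_comm]
    refine congrArg avg (funext fun y => congrArg avg (funext fun key => ?_))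
    have h : ∀ k p, (if p = 0 then y k else F κ (Function.update ω.1.2.1 1 key p) (sid κ k)) =
        if p = 1 then F κ key (sid κ k) else if p = 0 then y k
          else F κ (ω.1.2.1 2) (sid κ k) := by
      intro k p
      fin_cases p <;> simp
    simp only [h]
    rfl
  have h3 : prob (honestIdealRun (E κ)) =
      avg fun ω : RealCoins κ (V κ) × Bits (E κ).coinLen =>
        avg fun r : Fin (P κ).runs → (P κ).K × (P κ).K =>
          ind (honestIdealRun (E κ) ((ω.1.1, r), ω.2)) := by
    rw [prob_eq_avg]
    simp only [avg_prod, avg_const]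
    refine congrArg avg (funext fun pp => ?_)
    rw [avg_comm]
  have e1 : |(avg fun ω => ind (honestRealRun (F κ) (sid κ) (E κ) ω)) -
      avg fun ω : RealCoins κ (V κ) × Bits (E κ).coinLen =>
        ind (honestMaskedRun (E κ) ω.1 (fun k p => F κ (ω.1.2.1 p) (sid κ k)) ω.2)| ≤ ν₁ κ := by
    refine b1 κ _ (fun ω : RealCoins κ (V κ) × Bits (E κ).coinLen =>
      ind (honestMaskedRun (E κ) ω.1 (fun k p => F κ (ω.1.2.1 p) (sid κ k)) ω.2))
      (fun ω => ?_) fun ω hω => ?_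
    · exact abs_ind_sub_le_one _ _
    · exact congrArg ind (honestRealRun_eq (F κ) (sid κ) (E κ) ω.1 ω.2 hω)
  have e2 := abs_avg_sub_le_const fun ω : RealCoins κ (V κ) × Bits (E κ).coinLen =>
    b2 κ ω.1 ω.2 (fun k p => F κ (ω.1.2.1 p) (sid κ k)) hκ
  have e3 := abs_avg_sub_le_const fun ω : RealCoins κ (V κ) × Bits (E κ).coinLen =>
    abs_avg_sub_le_const fun y : Fin (P κ).runs → (P κ).K =>
      b3 κ ω.1 ω.2 (fun k p => if p = 0 then y k else F κ (ω.1.2.1 2) (sid κ k)) hκ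
  have e4 : |(avg fun ω : RealCoins κ (V κ) × Bits (E κ).coinLen =>
      avg fun y₀ : Fin (P κ).runs → (P κ).K => avg fun y₁ : Fin (P κ).runs → (P κ).K =>
        ind (honestMaskedRun (E κ) ω.1 (fun k p => if p = 1 then y₁ k else
          if p = 0 then y₀ k else F κ (ω.1.2.1 2) (sid κ k)) ω.2)) -
      avg fun ω : RealCoins κ (V κ) × Bits (E κ).coinLen =>
        avg fun r : Fin (P κ).runs → (P κ).K × (P κ).K =>
          ind (honestIdealRun (E κ) ((ω.1.1, r), ω.2))| ≤ ν₁ κ := by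
    refine b1 κ _ (fun ω : RealCoins κ (V κ) × Bits (E κ).coinLen =>
        avg fun r : Fin (P κ).runs → (P κ).K × (P κ).K =>
          ind (honestIdealRun (E κ) ((ω.1.1, r), ω.2))) (fun ω => ?_) fun ω hω => ?_
    · rw [← avg_prod fun y : (Fin (P κ).runs → (P κ).K) × (Fin (P κ).runs → (P κ).K) =>
        ind (honestMaskedRun (E κ) ω.1 (fun k p => if p = 1 then y.2 k else
          if p = 0 then y.1 k else F κ (ω.1.2.1 2) (sid κ k)) ω.2)]
      exact abs_avg_ind_sub_le_one _ _
    · exact avg_honestMaskedRun (E κ) ω.1 hω _ ω.2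
  rw [prob_eq_avg (honestRealRun (F κ) (sid κ) (E κ)), h3]
  rw [← h1] at e2
  rw [← h2] at e3
  refine (abs_sub_le _ _ _).trans ((add_le_add ((abs_sub_le _ _ _).trans (add_le_add e1 e2))
    ((abs_sub_le _ _ _).trans (add_le_add e3 e4))).trans_eq rfl)

end

end ObliviousSelection

end

theorem mainTheorem2 (P : ℕ → ObliviousSelection.Params)
    (hm : ObliviousSelection.PolyBounded fun κ => 2 ^ (P κ).ellm)
    (hell : ObliviousSelection.PolyBounded fun κ => (P κ).ell)
    (hruns : ObliviousSelection.PolyBounded fun κ => (P κ).runs)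
    (V : ∀ κ, ObliviousSelection.VDPF (P κ)) (hV : ObliviousSelection.IsSecureVDPF V)
    (F : ∀ κ, ObliviousSelection.Bits κ → ObliviousSelection.Bits κ → (P κ).K)
    (hF : ObliviousSelection.IsSecurePRF F)
    (sid : ∀ κ, Fin (P κ).runs → ObliviousSelection.Bits κ)
    (hsid : ∀ᶠ κ in Filter.atTop, Function.Injective (sid κ)) :
    ObliviousSelection.SecurelyComputesOS V F sid :=
  ⟨fun c => ObliviousSelection.corrupted_secure hm hell hruns hV hF sid hsid c,
    fun E hE => ObliviousSelection.honest_secure hm hell hruns hV hF sid hsid E hE⟩
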